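/- Let $M$ be either the unit sphere $\mathbb{S}^2\subset\mathbb{R}^3$ with its surface measure, or a flat square torus $\mathbb{T}^2=(\mathbb{R}/L\mathbb{Z})^2$, $L>0$, with Lebesgue measure. Let $N\ge 0$ and let $\psi_1,\dots,\psi_N$ be (real- or complex-valued) functions in the Sobolev space $H^1(M)$ with mean value zero, $\int_M\psi_j\,dM=0$, which are orthonormal in $L_2(M)$. Then the function $$\rho(x):=\sum_{j=1}^N|\psi_j(x)|^2$$ is square integrable on $M$ and satisfies $$\int_M\rho(x)^2\,dM\le\mathrm{k}\sum_{j=1}^N\|\nabla\psi_j\|^2\qquad\text{with}\qquad \mathrm{k}=\frac{3\pi}{32},$$ where $\nabla\psi_j$ is the weak gradient and $\|\cdot\|$ is the $L_2(M)$ norm. In other words, the best constant $\mathrm{k}$ in this inequality, for each of these manifolds $M$, is at most $3\pi/32$. -/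

import Mathlib

open MeasureTheory
open scoped ContDiff InnerProductSpace

noncomputable section

namespace LiebThirring

/-- Euclidean three-space. -/
abbrev E3 : Type := EuclideanSpace ℝ (Fin 3)

/-- The unit sphere of Euclidean three-space. -/
abbrev S2 : Type := Metric.sphere (0 : E3) 1

/-- The surface measure of the unit sphere (of total mass `4π`). -/
def surf : Measure S2 := (volume : Measure E3).toSphere

/-- Smooth vector fields on `ℝ³` that are tangent to the unit sphere along the unit sphere. Their
restrictions are exactly the smooth tangent vector fields of the sphere. -/
def IsSphereField (X : E3 → E3) : Prop :=
  ContDiff ℝ ∞ X ∧ ∀ x : S2, ⟪X x, (x : E3)⟫_ℝ = 0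

/-- The divergence on the sphere of a field that is tangent to the sphere: the trace of the ambient
derivative over the tangent plane at `x`, i.e. the full trace minus the normal part. -/
def sphereDiv (X : E3 → E3) (x : S2) : ℝ :=
  (∑ i : Fin 3, (fderiv ℝ X x (EuclideanSpace.single i 1)) i)
    - ⟪fderiv ℝ X x (x : E3), (x : E3)⟫_ℝ

/-- `ψ` belongs to the Sobolev space `H¹(𝕊²)` and `g` is its weak gradient: `ψ` and `g` are square
integrable, `g` is a (complexified) tangent field, and `∫ ψ div X = - ∫ ⟨X, g⟩` for every
smooth tangent vector field `X`. Such a `g` is unique almost everywhere. -/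
structure HasSphereGradient (ψ : S2 → ℂ) (g : S2 → EuclideanSpace ℂ (Fin 3)) : Prop where
  memLp : MemLp ψ 2 surf
  memLp_grad : MemLp g 2 surf
  tangent : ∀ᵐ x : S2 ∂surf, ∑ i : Fin 3, (((x : E3) i : ℝ) : ℂ) * g x i = 0
  integral_div : ∀ X : E3 → E3, IsSphereField X →
    ∫ x, ψ x * ((sphereDiv X x : ℝ) : ℂ) ∂surf
      = - ∫ x, ∑ i : Fin 3, ((X x i : ℝ) : ℂ) * g x i ∂surf

/-- The flat square torus `(ℝ / Lℤ)²` of side `L`; its `volume` is Lebesgue measure,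
of total mass `L²`. -/
abbrev T2 (L : ℝ) : Type := Fin 2 → AddCircle L

/-- Smooth functions on the torus: those whose periodic lift to the plane is smooth. -/
def IsTorusSmooth (L : ℝ) (φ : T2 L → ℂ) : Prop :=
  ContDiff ℝ ∞ (fun x : Fin 2 → ℝ => φ (fun i => (x i : AddCircle L)))

/-- The classical partial derivative in the `i`-th coordinate of a function on the torus. -/
def torusPartial (L : ℝ) (i : Fin 2) (φ : T2 L → ℂ) (x : T2 L) : ℂ :=
  deriv (fun t : ℝ => φ (x + Pi.single i (t : AddCircle L))) 0

/-- `ψ` belongs to the Sobolev space `H¹` of the torus and `g` is its weak gradient: both are square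
integrable and `∫ ψ ∂ᵢφ = - ∫ gᵢ φ` for every smooth `φ` and every `i`. Such a `g` is unique
almost everywhere. -/
structure HasTorusGradient (L : ℝ) [Fact (0 < L)] (ψ : T2 L → ℂ)
    (g : T2 L → EuclideanSpace ℂ (Fin 2)) : Prop where
  memLp : MemLp ψ 2 volume
  memLp_grad : MemLp g 2 volume
  integral_partial : ∀ φ : T2 L → ℂ, IsTorusSmooth L φ → ∀ i : Fin 2,
    ∫ x, ψ x * torusPartial L i φ x = - ∫ x, g x i * φ x

/-- A finite family is orthonormal in `L²(μ)`. -/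
def IsL2Orthonormal {M : Type*} [MeasurableSpace M] (μ : Measure M) {N : ℕ}
    (ψ : Fin N → M → ℂ) : Prop :=
  ∀ i j : Fin N, ∫ x, ψ i x * (starRingEnd ℂ) (ψ j x) ∂μ = if i = j then 1 else 0

/-- The density `ρ = ∑ⱼ |ψⱼ|²` of a finite family. -/
def density {M : Type*} {N : ℕ} (ψ : Fin N → M → ℂ) (x : M) : ℝ :=
  ∑ j : Fin N, ‖ψ j x‖ ^ 2

end LiebThirring

end

/-! ### The level integral behind the power `ρ²` -/

namespace LiebThirring

open Set Filter Topology
open scoped ENNReal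

/-! Every function is split at each energy level a > 0. For an eigenvalue λ of the negative
Laplacian let f = λ²/(λ² + a²). Minkowski's inequality in ℂ^N gives √ρ ≤ √ρ_a + √r_a pointwise,
where ρ_a is the density of the parts cut off by f and r_a that of the remainders. By Bessel's
inequality r_a is at most the diagonal kernel Σ (1 − f)² |e_k(x)|², whatever N is. If this kernel is
at most a/16, integrating (√ρ − √a/4)₊² ≤ ρ_a over a yields (8/3)ρ² ≤ ∫ ρ_a da. Since ∫ f² da =
πλ/4, a further integration over M turns the right side into (π/4) Σ ‖∇ψ_j‖², and (3/8)(π/4) =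
3π/32.

The bound a/16 is the semiclassical value of the kernel, so what remains is that a sum over the
nonzero eigenvalues does not exceed the corresponding integral. The zero mode, whose contribution
would break this for small a, is removed by the mean value condition. On the sphere the kernel of
each eigenspace is constant (`harmKernel_le`), and convexity compares the sum with the integral
interval by interval (`sum_profile_sphere_le`). On the torus the sum runs over ℤ² without the origin
(`sum_profile_lattice_le`): for large parameters each value is compared with its mean over a unit
cell, and the missing origin pays for the error; small parameters are settled by monotonicity and a
finite computation.

The argument is run for finitely many eigenfunctions (`lieb_thirring_truncated`), where all
interchanges of sums and integrals are trivial, and extended by Fatou's lemma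
(`lieb_thirring_of_eigenbasis`). The weak gradient enters only through the bound of the spectral
energy by the Dirichlet integral: Bessel's inequality for Fourier coefficients on the torus,
integration by parts along rotations on the sphere (`HasSphereGradient.sum_eigenvalue_mul_le`). -/

lemma hasDerivAt_quartic_antideriv {c : ℝ} (hc : 0 < c) (t : ℝ) :
    HasDerivAt (fun t => c ^ 2 * t / (2 * (c ^ 2 + t ^ 2)) + c / 2 * Real.arctan (t / c))
      (c ^ 4 / (c ^ 2 + t ^ 2) ^ 2) t := by
  have h1 : HasDerivAt (fun t : ℝ => c ^ 2 * t) (c ^ 2) t := by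
    simpa using (hasDerivAt_id t).const_mul (c ^ 2)
  have h2 : HasDerivAt (fun t : ℝ => 2 * (c ^ 2 + t ^ 2)) (2 * (2 * t)) t := by
    simpa using (((hasDerivAt_id t).pow 2).const_add (c ^ 2)).const_mul 2
  have h3 : HasDerivAt (fun t : ℝ => Real.arctan (t / c)) (1 / (1 + (t / c) ^ 2) * (1 / c)) t := by
    simpa using ((hasDerivAt_id t).div_const c).arctan
  have hp : 0 < c ^ 2 + t ^ 2 := by positivity
  refine ((h1.div h2 (by positivity)).add (h3.const_mul (c / 2))).congr_deriv ?_
  field_simp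
  ring

lemma tendsto_quartic_antideriv {c : ℝ} (hc : 0 < c) :
    Tendsto (fun t : ℝ => c ^ 2 * t / (2 * (c ^ 2 + t ^ 2)) + c / 2 * Real.arctan (t / c))
      atTop (𝓝 (Real.pi * c / 4)) := by
  have h1 : Tendsto (fun t : ℝ => c ^ 2 * t / (2 * (c ^ 2 + t ^ 2))) atTop (𝓝 0) := by
    have h0 : Tendsto (fun t : ℝ => c ^ 2 / t) atTop (𝓝 0) := tendsto_const_nhds.div_atTop tendsto_id
    refine tendsto_of_tendsto_of_tendsto_of_le_of_le' tendsto_const_nhds h0 ?_ ?_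
    · filter_upwards [eventually_gt_atTop 0] with t ht
      positivity
    · filter_upwards [eventually_gt_atTop 0] with t ht
      rw [div_le_div_iff₀ (by positivity) ht]
      nlinarith [sq_nonneg c, sq_nonneg t, mul_nonneg (sq_nonneg c) (sq_nonneg t), sq_nonneg (c * c)]
  have h2 : Tendsto (fun t : ℝ => c / 2 * Real.arctan (t / c)) atTop (𝓝 (c / 2 * (Real.pi / 2))) := by
    refine Tendsto.const_mul _ ?_
    exact (tendsto_nhds_of_tendsto_nhdsWithin Real.tendsto_arctan_atTop).comp
      (tendsto_id.atTop_div_const hc)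
  convert h1.add h2 using 2
  ring

lemma integrableOn_quartic {c : ℝ} (hc : 0 < c) :
    IntegrableOn (fun t : ℝ => c ^ 4 / (c ^ 2 + t ^ 2) ^ 2) (Ioi 0) :=
  integrableOn_Ioi_deriv_of_nonneg' (fun t _ => hasDerivAt_quartic_antideriv hc t)
    (fun t _ => by positivity) (tendsto_quartic_antideriv hc)

lemma integral_quartic {c : ℝ} (hc : 0 < c) :
    ∫ t in Ioi (0 : ℝ), c ^ 4 / (c ^ 2 + t ^ 2) ^ 2 = Real.pi * c / 4 := by
  rw [integral_Ioi_of_hasDerivAt_of_nonneg' (fun t _ => hasDerivAt_quartic_antideriv hc t)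
    (fun t _ => by positivity) (tendsto_quartic_antideriv hc)]
  simp

/-- The lower bound on the level integral which yields the power `ρ²`. -/
lemma sq_le_integral_of_sqrt_le {r : ℝ} (hr : 0 ≤ r) {R : ℝ → ℝ} (hR : ∀ a, 0 ≤ R a)
    (hint : IntegrableOn R (Ioi 0)) (h : ∀ a, 0 < a → √r ≤ √(R a) + √(a / 16)) :
    r ^ 2 ≤ 3 / 8 * ∫ a in Ioi (0 : ℝ), R a := by
  obtain ⟨q, hq, rfl⟩ : ∃ q : ℝ, 0 ≤ q ∧ r = q ^ 2 := ⟨√r, Real.sqrt_nonneg _, (Real.sq_sqrt hr).symm⟩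
  rw [Real.sqrt_sq hq] at h
  -- The integrand is (q − √a/4)², and 16q² is the level at which √a/4 reaches q. The value 8/3 is
  -- the source of the factor 3/8.
  have hI : ∫ a in (0 : ℝ)..(16 * q ^ 2), (q ^ 2 - q / 2 * a ^ (1 / 2 : ℝ) + a / 16) = 8 / 3 * (q ^ 2) ^ 2 := by
    rw [intervalIntegral.integral_add, intervalIntegral.integral_sub,
      intervalIntegral.integral_const_mul, integral_rpow (Or.inl (by norm_num)),
      intervalIntegral.integral_div, integral_id]
    · have : (16 * q ^ 2 : ℝ) ^ ((1 / 2 : ℝ) + 1) = 64 * q ^ 3 := by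
        rw [show (16 * q ^ 2 : ℝ) = (4 * q) ^ 2 by ring, ← Real.rpow_natCast (4 * q) 2,
          ← Real.rpow_mul (by positivity), show (((2 : ℕ) : ℝ) * (1 / 2 + 1)) = ((3 : ℕ) : ℝ) by norm_num,
          Real.rpow_natCast]
        ring
      rw [this, Real.zero_rpow (by norm_num)]
      simp
      ring
    · simp
    · exact (intervalIntegral.intervalIntegrable_rpow' (by norm_num)).const_mul _
    · exact intervalIntegrable_const.sub ((intervalIntegral.intervalIntegrable_rpow' (by norm_num)).const_mul _)
    · exact Continuous.intervalIntegrable (by fun_prop) _ _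
  have h1 : ∫ a in (0 : ℝ)..(16 * q ^ 2), (q ^ 2 - q / 2 * a ^ (1 / 2 : ℝ) + a / 16)
      ≤ ∫ a in Ioi (0 : ℝ), R a := by
    rw [intervalIntegral.integral_of_le (by positivity)]
    refine (setIntegral_mono_on ?_ (hint.mono_set Ioc_subset_Ioi_self) measurableSet_Ioc ?_).trans
      (setIntegral_mono_set hint (ae_of_all _ hR) (Ioc_subset_Ioi_self.eventuallyLE))
    · rw [← intervalIntegrable_iff_integrableOn_Ioc_of_le (by positivity)]
      exact (intervalIntegrable_const.sub
        ((intervalIntegral.intervalIntegrable_rpow' (by norm_num)).const_mul _)).add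
          (Continuous.intervalIntegrable (by fun_prop) _ _)
    · intro a ha
      have h2 := h a ha.1
      rw [← Real.sqrt_eq_rpow]
      have h3 : √(a / 16) = √a / 4 := by
        rw [Real.sqrt_div ha.1.le, show (16 : ℝ) = 4 ^ 2 by norm_num, Real.sqrt_sq (by norm_num)]
      rw [h3] at h2
      have h4 : √a ≤ 4 * q := by
        rw [show 4 * q = √(16 * q ^ 2) by
          rw [show 16 * q ^ 2 = (4 * q) ^ 2 by ring, Real.sqrt_sq (by positivity)]]
        exact Real.sqrt_le_sqrt ha.2
      have h5 := Real.sq_sqrt (hR a)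
      have h6 := Real.sq_sqrt ha.1.le
      nlinarith [Real.sqrt_nonneg (R a), mul_self_le_mul_self (by linarith : 0 ≤ q - √a / 4) (by linarith : q - √a / 4 ≤ √(R a))]
  linarith

end LiebThirring

/-! ### The inequality for finitely many eigenfunctions -/

namespace LiebThirring

open Set Filter Topology
open scoped ENNReal

/-- The spectral cut-off `λ² / (λ² + a²)` at energy level `a`. -/
noncomputable def cutoff (l a : ℝ) : ℝ := l ^ 2 / (l ^ 2 + a ^ 2)

lemma cutoff_nonneg (l a : ℝ) : 0 ≤ cutoff l a := by unfold cutoff; positivity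

lemma measurable_cutoff (l : ℝ) : Measurable (cutoff l) := by unfold cutoff; fun_prop

lemma cutoff_sq (l a : ℝ) : cutoff l a ^ 2 = l ^ 4 / (l ^ 2 + a ^ 2) ^ 2 := by
  unfold cutoff; rw [div_pow]; ring

lemma integrableOn_cutoff_mul {l m : ℝ} (hl : 0 < l) (hm : 0 < m) :
    IntegrableOn (fun a => cutoff l a * cutoff m a) (Ioi 0) := by
  have h1 : IntegrableOn (fun a => cutoff l a ^ 2) (Ioi 0) := by
    simp_rw [cutoff_sq]; exact integrableOn_quartic hl
  have h2 : IntegrableOn (fun a => cutoff m a ^ 2) (Ioi 0) := by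
    simp_rw [cutoff_sq]; exact integrableOn_quartic hm
  refine (h1.add h2).mono' ((measurable_cutoff l).mul (measurable_cutoff m)).aestronglyMeasurable
    (ae_of_all _ fun a => ?_)
  have := cutoff_nonneg l a
  have := cutoff_nonneg m a
  rw [Real.norm_of_nonneg (by positivity)]
  simp only [Pi.add_apply]
  nlinarith [sq_nonneg (cutoff l a - cutoff m a)]

variable {M ι : Type*} [MeasurableSpace M] {μ : Measure M} {N : ℕ}

/-- Minkowski's inequality for the splitting of a truncated density at level `a`. -/
lemma sqrt_density_le {K : Finset ι} {lam : ι → ℝ} {c : Fin N → ι → ℂ}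
    (hlam : ∀ k, 0 < lam k)
    (hbessel : ∀ z : ι → ℂ, ∑ j, ‖∑ k ∈ K, c j k * z k‖ ^ 2 ≤ ∑ k ∈ K, ‖z k‖ ^ 2)
    (z : ι → ℂ) (a : ℝ)
    (hker : ∑ k ∈ K, (a ^ 2 / (lam k ^ 2 + a ^ 2)) ^ 2 * ‖z k‖ ^ 2 ≤ a / 16) :
    √(∑ j, ‖∑ k ∈ K, c j k * z k‖ ^ 2)
      ≤ √(∑ j, ‖∑ k ∈ K, c j k * (cutoff (lam k) a * z k)‖ ^ 2) + √(a / 16) := by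
  let u : EuclideanSpace ℂ (Fin N) := WithLp.toLp 2 fun j => ∑ k ∈ K, c j k * (cutoff (lam k) a * z k)
  let v : EuclideanSpace ℂ (Fin N) :=
    WithLp.toLp 2 fun j => ∑ k ∈ K, c j k * (((a ^ 2 / (lam k ^ 2 + a ^ 2) : ℝ) : ℂ) * z k)
  have huv : ∀ j, (u + v) j = ∑ k ∈ K, c j k * z k := by
    intro j
    simp only [u, v, PiLp.add_apply, ← Finset.sum_add_distrib]
    refine Finset.sum_congr rfl fun k _ => ?_
    have : ((cutoff (lam k) a : ℝ) : ℂ) + ((a ^ 2 / (lam k ^ 2 + a ^ 2) : ℝ) : ℂ) = 1 := by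
      rw [← Complex.ofReal_add, cutoff, ← add_div, div_self, Complex.ofReal_one]
      have := hlam k
      positivity
    linear_combination c j k * z k * this
  -- Bessel's inequality is applied to the remainder alone, which makes its bound independent of the
  -- number of functions.
  have hv : ‖v‖ ≤ √(a / 16) := by
    rw [EuclideanSpace.norm_eq]
    refine Real.sqrt_le_sqrt ((hbessel _).trans (le_trans (le_of_eq ?_) hker))
    refine Finset.sum_congr rfl fun k _ => ?_
    rw [norm_mul, mul_pow, Complex.norm_real, Real.norm_eq_abs, sq_abs]
  have h := norm_add_le u v
  rw [EuclideanSpace.norm_eq, EuclideanSpace.norm_eq u] at h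
  simp_rw [huv] at h
  exact h.trans (by gcongr)

/-- As a finite double sum the square separates the level (in `f`) from the point (in `z`), so that
the two integrations commute without Fubini. -/
lemma norm_sum_sq_eq (K : Finset ι) (z : ι → ℂ) (f : ι → ℝ) :
    ‖∑ k ∈ K, (f k : ℂ) * z k‖ ^ 2
      = ∑ k ∈ K, ∑ l ∈ K, (f k * f l) * (z k * (starRingEnd ℂ) (z l)).re := by
  have h : ((‖∑ k ∈ K, (f k : ℂ) * z k‖ ^ 2 : ℝ) : ℂ)
      = ∑ k ∈ K, ∑ l ∈ K, ((f k * f l : ℝ) : ℂ) * (z k * (starRingEnd ℂ) (z l)) := by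
    push_cast
    rw [← Complex.mul_conj', map_sum, Finset.sum_mul_sum]
    refine Finset.sum_congr rfl fun k _ => Finset.sum_congr rfl fun l _ => ?_
    simp only [map_mul, Complex.conj_ofReal]
    ring
  have h2 := congrArg Complex.re h
  simpa only [Complex.ofReal_re, Complex.re_sum, Complex.re_ofReal_mul] using h2

/-- The Lieb–Thirring inequality for the projections onto finitely many eigenfunctions. -/
theorem lieb_thirring_truncated [DecidableEq ι] (K : Finset ι) {e : ι → M → ℂ} (he : ∀ k, MemLp (e k) 2 μ)
    {lam : ι → ℝ} (hlam : ∀ k, 0 < lam k)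
    (horth : ∀ k l, ∫ x, e k x * (starRingEnd ℂ) (e l x) ∂μ = if k = l then 1 else 0)
    {c : Fin N → ι → ℂ}
    (hbessel : ∀ z : ι → ℂ, ∑ j, ‖∑ k ∈ K, c j k * z k‖ ^ 2 ≤ ∑ k ∈ K, ‖z k‖ ^ 2)
    (hker : ∀ a, 0 < a → ∀ x,
      ∑ k ∈ K, (a ^ 2 / (lam k ^ 2 + a ^ 2)) ^ 2 * ‖e k x‖ ^ 2 ≤ a / 16) :
    Integrable (fun x => (∑ j, ‖∑ k ∈ K, c j k * e k x‖ ^ 2) ^ 2) μ ∧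
    ∫ x, (∑ j, ‖∑ k ∈ K, c j k * e k x‖ ^ 2) ^ 2 ∂μ
      ≤ 3 * Real.pi / 32 * ∑ j, ∑ k ∈ K, lam k * ‖c j k‖ ^ 2 := by
  -- Only the diagonal of this Gram matrix has to be computed: orthonormality of the `e k` removes
  -- the other entries after integration over `M`.
  set G : ι → ι → ℝ := fun k l => ∫ a in Ioi (0 : ℝ), cutoff (lam k) a * cutoff (lam l) a with hG
  have hGd : ∀ k, G k k = Real.pi * lam k / 4 := fun k => by
    simp only [hG, ← sq, cutoff_sq]; exact integral_quartic (hlam k)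
  set B : M → ℝ := fun x => ∑ j, ∑ k ∈ K, ∑ l ∈ K,
    G k l * ((c j k * e k x) * (starRingEnd ℂ) (c j l * e l x)).re with hB
  have hpt : ∀ x, (∑ j, ‖∑ k ∈ K, c j k * e k x‖ ^ 2) ^ 2 ≤ 3 / 8 * B x := by
    intro x
    have hexp : ∀ a, ∑ j, ‖∑ k ∈ K, c j k * (cutoff (lam k) a * e k x)‖ ^ 2
        = ∑ j, ∑ k ∈ K, ∑ l ∈ K, (cutoff (lam k) a * cutoff (lam l) a) *
          ((c j k * e k x) * (starRingEnd ℂ) (c j l * e l x)).re := by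
      intro a
      refine Finset.sum_congr rfl fun j _ => ?_
      rw [← norm_sum_sq_eq]
      congr 2
      exact Finset.sum_congr rfl fun k _ => by ring
    have hi : ∀ j k l, IntegrableOn (fun a => (cutoff (lam k) a * cutoff (lam l) a) *
          ((c j k * e k x) * (starRingEnd ℂ) (c j l * e l x)).re) (Ioi 0) :=
      fun j k l => (integrableOn_cutoff_mul (hlam k) (hlam l)).mul_const _
    have hint : ∫ a in Ioi (0 : ℝ), ∑ j, ‖∑ k ∈ K, c j k * (cutoff (lam k) a * e k x)‖ ^ 2 = B x := by
      simp_rw [hexp]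
      rw [integral_finsetSum _ fun j _ => integrable_finsetSum _ fun k _ =>
        integrable_finsetSum _ fun l _ => hi j k l]
      refine Finset.sum_congr rfl fun j _ => ?_
      rw [integral_finsetSum _ fun k _ => integrable_finsetSum _ fun l _ => hi j k l]
      refine Finset.sum_congr rfl fun k _ => ?_
      rw [integral_finsetSum _ fun l _ => hi j k l]
      refine Finset.sum_congr rfl fun l _ => ?_
      rw [integral_mul_const]
    rw [← hint]
    refine sq_le_integral_of_sqrt_le (by positivity) (fun a => by positivity) ?_ ?_
    · simp_rw [hexp]
      exact integrable_finsetSum _ fun j _ => integrable_finsetSum _ fun k _ =>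
        integrable_finsetSum _ fun l _ => hi j k l
    · exact fun a ha => sqrt_density_le hlam hbessel _ a (hker a ha x)
  have hprod : ∀ k l, Integrable (fun x => e k x * (starRingEnd ℂ) (e l x)) μ :=
    fun k l => (he k).integrable_mul (he l).star
  have hterm : ∀ j k l x, G k l * ((c j k * e k x) * (starRingEnd ℂ) (c j l * e l x)).re
      = (G k l * (c j k * (starRingEnd ℂ) (c j l)) * (e k x * (starRingEnd ℂ) (e l x))).re := by
    intro j k l x
    rw [← Complex.re_ofReal_mul, map_mul]
    congr 1
    ring
  have hi : ∀ j k l, Integrable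
      (fun x => G k l * ((c j k * e k x) * (starRingEnd ℂ) (c j l * e l x)).re) μ := by
    intro j k l
    simp_rw [hterm]
    exact ((hprod k l).const_mul _).re
  have hBint : Integrable B μ := integrable_finsetSum _ fun j _ => integrable_finsetSum _ fun k _ =>
        integrable_finsetSum _ fun l _ => hi j k l
  have hBval : ∫ x, B x ∂μ = Real.pi / 4 * ∑ j, ∑ k ∈ K, lam k * ‖c j k‖ ^ 2 := by
    rw [hB, integral_finsetSum _ fun j _ => integrable_finsetSum _ fun k _ =>
        integrable_finsetSum _ fun l _ => hi j k l, Finset.mul_sum]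
    refine Finset.sum_congr rfl fun j _ => ?_
    rw [integral_finsetSum _ fun k _ => integrable_finsetSum _ fun l _ => hi j k l, Finset.mul_sum]
    refine Finset.sum_congr rfl fun k hk => ?_
    rw [integral_finsetSum _ fun l _ => hi j k l]
    have : ∀ l, ∫ x, G k l * ((c j k * e k x) * (starRingEnd ℂ) (c j l * e l x)).re ∂μ
        = if k = l then G k l * ‖c j k‖ ^ 2 else 0 := by
      intro l
      simp_rw [hterm]
      have h := integral_re (𝕜 := ℂ) (((hprod k l).const_mul (G k l * (c j k * (starRingEnd ℂ) (c j l)))))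
      simp only [RCLike.re_eq_complex_re] at h
      rw [h, integral_const_mul, horth]
      split_ifs with hkl
      · subst hkl
        rw [mul_one, Complex.mul_conj', Complex.re_ofReal_mul]
        norm_cast
      · simp
    simp_rw [this]
    rw [Finset.sum_ite_eq, if_pos hk, hGd]
    ring
  have hI : Integrable (fun x => (∑ j, ‖∑ k ∈ K, c j k * e k x‖ ^ 2) ^ 2) μ := by
    refine (hBint.const_mul (3 / 8)).mono' ?_ (ae_of_all _ fun x => ?_)
    · refine AEStronglyMeasurable.pow ?_ 2
      refine Finset.aestronglyMeasurable_fun_sum _ fun j _ => AEStronglyMeasurable.pow ?_ 2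
      exact (Finset.aestronglyMeasurable_fun_sum _ fun k _ =>
        (he k).aestronglyMeasurable.const_mul _).norm
    · rw [Real.norm_of_nonneg (by positivity)]
      exact hpt x
  refine ⟨hI, (integral_mono hI (hBint.const_mul _) hpt).trans (le_of_eq ?_)⟩
  rw [integral_const_mul, hBval]
  ring

end LiebThirring

/-! ### From truncations to complete eigenbases -/

namespace LiebThirring

open Set Filter Topology
open scoped ENNReal

variable {M ι : Type*} [MeasurableSpace M] {μ : Measure M} {N : ℕ}

lemma inner_toLp {f g : M → ℂ} (hf : MemLp f 2 μ) (hg : MemLp g 2 μ) :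
    ⟪hf.toLp f, hg.toLp g⟫_ℂ = ∫ x, g x * (starRingEnd ℂ) (f x) ∂μ := by
  rw [L2.inner_def]
  refine integral_congr_ae ?_
  filter_upwards [hf.coeFn_toLp, hg.coeFn_toLp] with x h1 h2
  rw [h1, h2]
  simp

lemma orthonormal_toLp [DecidableEq ι] {e : ι → M → ℂ} (he : ∀ k, MemLp (e k) 2 μ)
    (horth : ∀ k l, ∫ x, e k x * (starRingEnd ℂ) (e l x) ∂μ = if k = l then 1 else 0) :
    Orthonormal ℂ (fun k => (he k).toLp (e k)) := by
  rw [orthonormal_iff_ite]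
  intro k l
  rw [inner_toLp, horth]
  simp [eq_comm]

/-- Expansion of an `L²` function in a complete orthonormal system, the modes outside `p` being
absent. -/
lemma tendsto_eLpNorm_sub_partial_sum [DecidableEq ι] {e : ι → M → ℂ} (he : ∀ k, MemLp (e k) 2 μ)
    (horth : ∀ k l, ∫ x, e k x * (starRingEnd ℂ) (e l x) ∂μ = if k = l then 1 else 0)
    (hdense : ⊤ ≤ (Submodule.span ℂ (range fun k => (he k).toLp (e k))).topologicalClosure)
    {p : ι → Prop} {f : M → ℂ} (hf : MemLp f 2 μ)
    (hp : ∀ k, ¬ p k → ∫ x, f x * (starRingEnd ℂ) (e k x) ∂μ = 0) :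
    Tendsto (fun K : Finset {k // p k} => eLpNorm
      (fun x => f x - ∑ k ∈ K, (∫ y, f y * (starRingEnd ℂ) (e k y) ∂μ) * e k x) 2 μ) atTop (𝓝 0) := by
  let b : HilbertBasis ι ℂ (Lp ℂ 2 μ) := HilbertBasis.mk (orthonormal_toLp he horth) hdense
  have hb : ∀ k, b k = (he k).toLp (e k) := fun k => by simp [b]
  have hs := b.hasSum_repr (hf.toLp f)
  have hc : ∀ k, b.repr (hf.toLp f) k = ∫ x, f x * (starRingEnd ℂ) (e k x) ∂μ := by
    intro k
    rw [b.repr_apply_apply, hb, inner_toLp]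
  simp only [hc, hb] at hs
  have hs' : HasSum (fun k : {k // p k} =>
      (∫ x, f x * (starRingEnd ℂ) (e k x) ∂μ) • (he k).toLp (e k)) (hf.toLp f) := by
    refine (hasSum_subtype_iff_of_support_subset (s := {k | p k}) ?_).2 hs
    intro k hk
    by_contra h
    exact hk (by simp only [hp k h, zero_smul])
  have hs2 : Tendsto (fun K : Finset {k // p k} => ‖hf.toLp f - ∑ k ∈ K,
      (∫ x, f x * (starRingEnd ℂ) (e k x) ∂μ) • (he k).toLp (e k)‖ₑ) atTop (𝓝 0) := by
    have := (tendsto_const_nhds (x := hf.toLp f)).sub hs'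
    simp only [sub_self] at this
    simpa using this.enorm
  refine hs2.congr fun K => ?_
  rw [Lp.enorm_def]
  refine eLpNorm_congr_ae ?_
  have h1 : ∀ k : {k // p k}, ((∫ x, f x * (starRingEnd ℂ) (e k x) ∂μ) • (he k).toLp (e k) : Lp ℂ 2 μ)
      =ᵐ[μ] fun x => (∫ x, f x * (starRingEnd ℂ) (e k x) ∂μ) * e k x := by
    intro k
    filter_upwards [Lp.coeFn_smul (∫ x, f x * (starRingEnd ℂ) (e k x) ∂μ) ((he k).toLp (e k)),
      (he k).coeFn_toLp] with x h1 h2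
    rw [h1, Pi.smul_apply, h2, smul_eq_mul]
  have h2 : ∀ᵐ x ∂μ, ∀ k ∈ K, ((∫ x, f x * (starRingEnd ℂ) (e k x) ∂μ) • (he k).toLp (e k) : Lp ℂ 2 μ) x
      = (∫ x, f x * (starRingEnd ℂ) (e k x) ∂μ) * e k x :=
    (ae_ball_iff K.countable_toSet).2 fun k _ => h1 k
  filter_upwards [Lp.coeFn_sub (hf.toLp f) (∑ k ∈ K,
      (∫ x, f x * (starRingEnd ℂ) (e k x) ∂μ) • (he k).toLp (e k)), hf.coeFn_toLp, h2,
      Lp.coeFn_finsetSum K fun k : {k // p k} => (∫ x, f x * (starRingEnd ℂ) (e k x) ∂μ) • (he k).toLp (e k)]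
    with x h3 h4 h5 h6
  rw [h3, Pi.sub_apply, h4, h6, Finset.sum_apply, Finset.sum_congr rfl h5]

/-- Passage to the limit in an `L²` bound for densities. -/
lemma integral_density_sq_le_of_tendsto {u : Filter ι} [u.NeBot] [u.IsCountablyGenerated]
    {ψ : Fin N → M → ℂ} (hψ : ∀ j, MemLp (ψ j) 2 μ) {φ : ι → Fin N → M → ℂ}
    (hφ : ∀ K j, AEStronglyMeasurable (φ K j) μ)
    (hlim : ∀ j, Tendsto (fun K => eLpNorm (fun x => ψ j x - φ K j x) 2 μ) u (𝓝 0))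
    {A : ℝ} (hint : ∀ K, Integrable (fun x => density (φ K) x ^ 2) μ)
    (hA : ∀ K, ∫ x, density (φ K) x ^ 2 ∂μ ≤ A) :
    Integrable (fun x => density ψ x ^ 2) μ ∧ ∫ x, density ψ x ^ 2 ∂μ ≤ A := by
  have hψm : AEStronglyMeasurable (fun x j => ψ j x) μ :=
    (aemeasurable_pi_lambda _ fun j => (hψ j).aestronglyMeasurable.aemeasurable).aestronglyMeasurable
  have hφm : ∀ K, AEStronglyMeasurable (fun x j => φ K j x) μ := fun K =>
    (aemeasurable_pi_lambda _ fun j => (hφ K j).aemeasurable).aestronglyMeasurable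
  have hL : Tendsto (fun K => eLpNorm ((fun x j => φ K j x) - fun x j => ψ j x) 2 μ) u (𝓝 0) := by
    have h0 : Tendsto (fun K => ∑ j, eLpNorm (fun x => ψ j x - φ K j x) 2 μ) u (𝓝 0) := by
      simpa using tendsto_finsetSum Finset.univ fun j _ => hlim j
    refine tendsto_of_tendsto_of_tendsto_of_le_of_le tendsto_const_nhds h0 (fun _ => zero_le) ?_
    intro K
    have h1 : eLpNorm ((fun x j => φ K j x) - fun x j => ψ j x) 2 μ
        ≤ eLpNorm (∑ j, fun x => ‖ψ j x - φ K j x‖) 2 μ := by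
      refine eLpNorm_mono fun x => ?_
      rw [Finset.sum_apply, Real.norm_of_nonneg (by positivity)]
      refine (pi_norm_le_iff_of_nonneg (by positivity)).2 fun j => ?_
      simp only [Pi.sub_apply]
      rw [norm_sub_rev]
      exact Finset.single_le_sum (f := fun j => ‖ψ j x - φ K j x‖) (fun _ _ => norm_nonneg _)
        (Finset.mem_univ j)
    refine h1.trans ((eLpNorm_sum_le (fun j _ => ?_) (by norm_num)).trans (le_of_eq ?_))
    · exact ((hψ j).aestronglyMeasurable.sub (hφ K j)).norm
    · exact Finset.sum_congr rfl fun j _ => eLpNorm_norm _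
  -- Convergence in `L²` implies convergence in measure, hence almost everywhere along a sequence,
  -- since the filter is countably generated. Fatou's lemma then applies to the squared densities.
  obtain ⟨ns, hns, hae⟩ := (tendstoInMeasure_of_tendsto_eLpNorm (by norm_num) hφm hψm hL).exists_seq_tendsto_ae'
  have hρm : AEStronglyMeasurable (fun x => density ψ x ^ 2) μ := by
    refine AEStronglyMeasurable.pow ?_ 2
    exact Finset.aestronglyMeasurable_fun_sum _ fun j _ =>
      ((hψ j).aestronglyMeasurable.norm).pow 2
  have hfat : ∫⁻ x, ENNReal.ofReal (density ψ x ^ 2) ∂μ ≤ ENNReal.ofReal A := by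
    have h1 : ∀ᵐ x ∂μ, ENNReal.ofReal (density ψ x ^ 2)
        = liminf (fun n => ENNReal.ofReal (density (φ (ns n)) x ^ 2)) atTop := by
      filter_upwards [hae] with x hx
      refine (Tendsto.liminf_eq ?_).symm
      refine ENNReal.tendsto_ofReal (Tendsto.pow (tendsto_finsetSum _ fun j _ => ?_) 2)
      exact ((tendsto_pi_nhds.1 hx j).norm).pow 2
    rw [lintegral_congr_ae h1]
    refine (lintegral_liminf_le' fun n => (hint (ns n)).aestronglyMeasurable.aemeasurable.ennreal_ofReal).trans ?_
    refine liminf_le_of_le (by isBoundedDefault) fun b hb => ?_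
    obtain ⟨n, hn⟩ := hb.exists
    refine hn.trans ?_
    rw [← ofReal_integral_eq_lintegral_ofReal (hint _) (ae_of_all _ fun x => by positivity)]
    exact ENNReal.ofReal_le_ofReal (hA _)
  have hI : Integrable (fun x => density ψ x ^ 2) μ := by
    refine ⟨hρm, ?_⟩
    rw [hasFiniteIntegral_iff_ofReal (ae_of_all _ fun x => by positivity)]
    exact hfat.trans_lt ENNReal.ofReal_lt_top
  refine ⟨hI, ?_⟩
  have hA0 : 0 ≤ A := by
    obtain ⟨K⟩ := u.nonempty_of_neBot
    exact (integral_nonneg fun x => by positivity).trans (hA K)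
  rw [← ofReal_integral_eq_lintegral_ofReal hI (ae_of_all _ fun x => by positivity)] at hfat
  exact (ENNReal.ofReal_le_ofReal_iff hA0).1 hfat

/-- Bessel's inequality for the family `ψ`, applied to the vector with coefficients conj(z k) in the
orthonormal system `e`. -/
lemma sum_norm_sq_coeff_le {ψ : Fin N → M → ℂ} (hψ : ∀ j, MemLp (ψ j) 2 μ)
    (hort : IsL2Orthonormal μ ψ) [DecidableEq ι] {e : ι → M → ℂ} (he : ∀ k, MemLp (e k) 2 μ)
    (horth : ∀ k l, ∫ x, e k x * (starRingEnd ℂ) (e l x) ∂μ = if k = l then 1 else 0)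
    (K : Finset ι) (z : ι → ℂ) :
    ∑ j, ‖∑ k ∈ K, (∫ x, ψ j x * (starRingEnd ℂ) (e k x) ∂μ) * z k‖ ^ 2 ≤ ∑ k ∈ K, ‖z k‖ ^ 2 := by
  set v : Lp ℂ 2 μ := ∑ k ∈ K, (starRingEnd ℂ) (z k) • (he k).toLp (e k) with hv
  have h1 := (orthonormal_toLp hψ hort).sum_inner_products_le v (s := Finset.univ)
  have h2 : ‖v‖ ^ 2 = ∑ k ∈ K, ‖z k‖ ^ 2 := by
    have h := (orthonormal_toLp he horth).inner_sum (fun k => (starRingEnd ℂ) (z k))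
      (fun k => (starRingEnd ℂ) (z k)) K
    rw [← hv, inner_self_eq_norm_sq_to_K] at h
    have h3 : ((‖v‖ ^ 2 : ℝ) : ℂ) = ((∑ k ∈ K, ‖z k‖ ^ 2 : ℝ) : ℂ) := by
      push_cast
      refine (show ((‖v‖ : ℂ) ^ 2 = _) from h).trans (Finset.sum_congr rfl fun k _ => ?_)
      rw [Complex.conj_conj, Complex.mul_conj']
    exact_mod_cast h3
  rw [h2] at h1
  refine le_trans (le_of_eq (Finset.sum_congr rfl fun j _ => ?_)) h1
  rw [← inner_conj_symm, RCLike.norm_conj, hv, sum_inner]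
  congr 2
  refine Finset.sum_congr rfl fun k _ => ?_
  rw [inner_smul_left, inner_toLp, Complex.conj_conj, mul_comm]

/-- The abstract form of the Lieb–Thirring inequality, for an orthonormal family expanded in the
non-constant eigenfunctions `e k`, `p k`, of a positive operator. -/
theorem lieb_thirring_of_eigenbasis [DecidableEq ι] [Countable ι] {e : ι → M → ℂ}
    (he : ∀ k, MemLp (e k) 2 μ)
    (horth : ∀ k l, ∫ x, e k x * (starRingEnd ℂ) (e l x) ∂μ = if k = l then 1 else 0)
    (hdense : ⊤ ≤ (Submodule.span ℂ (range fun k => (he k).toLp (e k))).topologicalClosure)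
    {p : ι → Prop} {lam : ι → ℝ} (hlam : ∀ k, p k → 0 < lam k)
    (hker : ∀ K : Finset ι, (∀ k ∈ K, p k) → ∀ a, 0 < a → ∀ x,
      ∑ k ∈ K, (a ^ 2 / (lam k ^ 2 + a ^ 2)) ^ 2 * ‖e k x‖ ^ 2 ≤ a / 16)
    {ψ : Fin N → M → ℂ} (hψ : ∀ j, MemLp (ψ j) 2 μ) (hort : IsL2Orthonormal μ ψ)
    (hp : ∀ j k, ¬ p k → ∫ x, ψ j x * (starRingEnd ℂ) (e k x) ∂μ = 0)
    {A : Fin N → ℝ}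
    (hA : ∀ (K : Finset ι), (∀ k ∈ K, p k) → ∀ j,
      ∑ k ∈ K, lam k * ‖∫ x, ψ j x * (starRingEnd ℂ) (e k x) ∂μ‖ ^ 2 ≤ A j) :
    Integrable (fun x => density ψ x ^ 2) μ ∧
    ∫ x, density ψ x ^ 2 ∂μ ≤ 3 * Real.pi / 32 * ∑ j, A j := by
  have horth' : ∀ k l : {k // p k}, ∫ x, e k x * (starRingEnd ℂ) (e l x) ∂μ = if k = l then 1 else 0 := by
    intro k l
    rw [horth]
    simp [Subtype.ext_iff]
  -- On the subtype of modes satisfying `p` all eigenvalues are positive, as the truncated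
  -- inequality demands.
  have key : ∀ K : Finset {k // p k}, _ := fun K => lieb_thirring_truncated (μ := μ) K
    (e := fun k : {k // p k} => e k) (fun k => he k) (lam := fun k => lam k) (fun k => hlam k k.2)
    horth' (c := fun j k => ∫ x, ψ j x * (starRingEnd ℂ) (e k x) ∂μ)
    (sum_norm_sq_coeff_le hψ hort (fun k : {k // p k} => he k) horth' K) (by
      intro a ha x
      have := hker (K.map (Function.Embedding.subtype p)) (by simp +contextual) a ha x
      rwa [Finset.sum_map] at this)
  refine integral_density_sq_le_of_tendsto (u := (atTop : Filter (Finset {k // p k}))) hψ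
    (φ := fun K j x => ∑ k ∈ K, (∫ y, ψ j y * (starRingEnd ℂ) (e k y) ∂μ) * e k x) ?_ ?_ ?_ ?_
  · exact fun K j => Finset.aestronglyMeasurable_fun_sum _ fun k _ =>
      (he k).aestronglyMeasurable.const_mul _
  · exact fun j => tendsto_eLpNorm_sub_partial_sum he horth hdense (hψ j) (hp j)
  · exact fun K => (key K).1
  · intro K
    refine (key K).2.trans ?_
    gcongr with j
    have := hA (K.map (Function.Embedding.subtype p)) (by simp +contextual) j
    rwa [Finset.sum_map] at this

end LiebThirring

/-! ### The eigenvalue sum of the sphere -/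

namespace LiebThirring

open Set Filter Topology
open scoped ENNReal

/-- The profile `b⁴ / (b² + s²)²`. -/
noncomputable def profile (b s : ℝ) : ℝ := b ^ 4 / (b ^ 2 + s ^ 2) ^ 2

lemma profile_nonneg (b s : ℝ) : 0 ≤ profile b s := by unfold profile; positivity

lemma continuous_profile {b : ℝ} (hb : 0 < b) : Continuous (profile b) := by
  unfold profile
  exact continuous_const.div (by fun_prop) fun s => by positivity

/-- The tangent inequality for the profile, convex as a function of `s²`. -/
lemma profile_tangent {b : ℝ} (hb : 0 < b) (l s : ℝ) :
    profile b l * (1 - 2 * (s ^ 2 - l ^ 2) / (b ^ 2 + l ^ 2)) ≤ profile b s := by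
  unfold profile
  have h1 : 0 < b ^ 2 + l ^ 2 := by positivity
  have h2 : 0 < b ^ 2 + s ^ 2 := by positivity
  rw [div_mul_eq_mul_div, mul_div_assoc]
  have : (1 - 2 * (s ^ 2 - l ^ 2) / (b ^ 2 + l ^ 2)) / (b ^ 2 + l ^ 2) ^ 2 ≤ 1 / (b ^ 2 + s ^ 2) ^ 2 := by
    rw [div_le_div_iff₀ (by positivity) (by positivity), one_mul, one_sub_div h1.ne',
      div_mul_eq_mul_div, div_le_iff₀ h1]
    -- With u = b² + l² and v = b² + s² the claim is u³ − 3uv² + 2v³ = (u − v)²(u + 2v) ≥ 0.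
    nlinarith [mul_nonneg (sq_nonneg (l ^ 2 - s ^ 2)) (by positivity : 0 ≤ b ^ 2 + l ^ 2 + 2 * (b ^ 2 + s ^ 2))]
  calc _ ≤ b ^ 4 * (1 / (b ^ 2 + s ^ 2) ^ 2) := by gcongr
    _ = _ := by ring

/-- The interval has length 2n + 1, and the mean of s² over it is l² − (2l − 1)/3 ≤ l² for l = n(n +
1). As the profile is convex and decreasing in s², its tangent at l² gives the bound. From n = 1 on,
these intervals tile the half-line [0, ∞). -/
lemma term_le_integral_profile {a : ℝ} (ha : 0 < a) {n : ℝ} (hn : 1 ≤ n) :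
    (2 * n + 1) * profile a (n * (n + 1)) ≤ ∫ s in (n ^ 2 - 1)..((n + 1) ^ 2 - 1), profile a s := by
  set l := n * (n + 1) with hl
  have hle : n ^ 2 - 1 ≤ (n + 1) ^ 2 - 1 := by nlinarith
  have hD : 0 < a ^ 2 + l ^ 2 := by positivity
  have h1 : ∫ s in (n ^ 2 - 1)..((n + 1) ^ 2 - 1), profile a l * (1 - 2 * (s ^ 2 - l ^ 2) / (a ^ 2 + l ^ 2))
      ≤ ∫ s in (n ^ 2 - 1)..((n + 1) ^ 2 - 1), profile a s := by
    refine intervalIntegral.integral_mono_on hle (Continuous.intervalIntegrable (by fun_prop) _ _)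
      ((continuous_profile ha).intervalIntegrable _ _) fun s _ => profile_tangent ha l s
  refine le_trans ?_ h1
  rw [intervalIntegral.integral_const_mul, mul_comm]
  refine mul_le_mul_of_nonneg_left ?_ (profile_nonneg _ _)
  rw [intervalIntegral.integral_sub (by simp) (Continuous.intervalIntegrable (by fun_prop) _ _),
    intervalIntegral.integral_div, intervalIntegral.integral_const_mul,
    intervalIntegral.integral_sub (Continuous.intervalIntegrable (by fun_prop) _ _) (by simp),
    integral_pow]
  simp only [intervalIntegral.integral_const, smul_eq_mul]
  have h2 : 2 * ((((n + 1) ^ 2 - 1) ^ (2 + 1) - (n ^ 2 - 1) ^ (2 + 1)) / (((2 : ℕ) : ℝ) + 1)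
      - ((n + 1) ^ 2 - 1 - (n ^ 2 - 1)) * l ^ 2) / (a ^ 2 + l ^ 2) ≤ 0 := by
    refine div_nonpos_of_nonpos_of_nonneg ?_ hD.le
    have h3 : 2 * ((((n + 1) ^ 2 - 1) ^ (2 + 1) - (n ^ 2 - 1) ^ (2 + 1)) / (((2 : ℕ) : ℝ) + 1)
      - ((n + 1) ^ 2 - 1 - (n ^ 2 - 1)) * l ^ 2) = - (2 * (2 * n + 1) * (2 / 3 * (n * (n + 1)) - 1 / 3)) := by
      rw [hl]; push_cast; ring
    rw [h3]
    have : 0 ≤ 2 / 3 * (n * (n + 1)) - 1 / 3 := by nlinarith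
    have : 0 ≤ 2 * (2 * n + 1) * (2 / 3 * (n * (n + 1)) - 1 / 3) := by positivity
    linarith
  nlinarith

lemma integral_profile {b : ℝ} (hb : 0 < b) : ∫ s in Ioi (0 : ℝ), profile b s = Real.pi * b / 4 :=
  integral_quartic hb

lemma integrableOn_profile {b : ℝ} (hb : 0 < b) : IntegrableOn (profile b) (Ioi (0 : ℝ)) :=
  integrableOn_quartic hb

/-- The lattice sum for the sphere. -/
lemma sum_profile_sphere_le {a : ℝ} (ha : 0 < a) (K : Finset ℕ) (hK : ∀ n ∈ K, 1 ≤ n) :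
    ∑ n ∈ K, (2 * (n : ℝ) + 1) * profile a (n * (n + 1)) ≤ Real.pi * a / 4 := by
  obtain ⟨m, hm⟩ : ∃ m, ∀ n ∈ K, n < m := ⟨K.sup id + 1, fun n hn => Nat.lt_succ_of_le (Finset.le_sup (f := id) hn)⟩
  have h1 : ∑ n ∈ K, (2 * (n : ℝ) + 1) * profile a (n * (n + 1))
      ≤ ∑ n ∈ Finset.Ico 1 (m + 1), ∫ s in ((n : ℝ) ^ 2 - 1)..(((n + 1 : ℕ) : ℝ) ^ 2 - 1), profile a s := by
    refine (Finset.sum_le_sum_of_subset_of_nonneg (t := Finset.Ico 1 (m + 1)) ?_ ?_).trans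
      (Finset.sum_le_sum fun n hn => ?_)
    · intro n hn
      have := hK n hn
      have := hm n hn
      simp; omega
    · intro n _ _
      have := profile_nonneg a (n * (n + 1))
      positivity
    · have h : (1 : ℝ) ≤ n := by exact_mod_cast (Finset.mem_Ico.1 hn).1
      push_cast
      exact term_le_integral_profile ha h
  refine h1.trans ?_
  rw [intervalIntegral.sum_integral_adjacent_intervals_Ico (a := fun n : ℕ => (n : ℝ) ^ 2 - 1) (by omega)
    fun n _ => (continuous_profile ha).intervalIntegrable _ _, ← integral_profile ha]
  simp only [Nat.cast_one, one_pow, sub_self]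
  rw [intervalIntegral.integral_of_le (by push_cast; nlinarith [(Nat.cast_nonneg m : (0 : ℝ) ≤ m)])]
  exact setIntegral_mono_set (integrableOn_profile ha) (ae_of_all _ fun s => profile_nonneg _ _)
    Ioc_subset_Ioi_self.eventuallyLE

end LiebThirring

/-! ### Tools for the cell estimate on the planar lattice -/

namespace LiebThirring

open Set Filter Topology
open scoped ENNReal

/-- A cubic minorant of `x⁻²`, touching at `x = 1` and `x = 4/3`. -/
lemma cubic_le_inv_sq {w : ℝ} (hw : -1 < w) :
    1 - 2 * w + 87 / 32 * w ^ 2 - 63 / 32 * w ^ 3 ≤ 1 / (1 + w) ^ 2 := by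
  have h : 0 < 1 + w := by linarith
  rw [le_div_iff₀ (by positivity)]
  -- After multiplication by (1 + w)² the difference is (63/32) w² (w − 1/3)² (w + 9/7).
  nlinarith [mul_nonneg (mul_nonneg (sq_nonneg w) (sq_nonneg (w - 1 / 3)))
    (by linarith : 0 ≤ w + 9 / 7)]

/-- Symmetrised lower bound of the profile near a point at squared distance `s` from the origin;
`d` is the odd and `q` the even part of the increment. -/
lemma profile_symm_lower {b s d q : ℝ} (hb : 0 < b) (hs : 0 ≤ s) (hq : 0 ≤ q) (hq2 : q ≤ 1 / 2)
    (hd : d ^ 2 ≤ 4 * s * q) :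
    profile b s * (1 - 2 * (2 * s * q + d ^ 2 + q ^ 2) / (b ^ 2 + s ^ 2)
      + 87 / 32 * (4 * s ^ 2 * d ^ 2) / (b ^ 2 + s ^ 2) ^ 2
      - 63 / 32 * ((3 * s + 1 / 4) * ((2 * s + 1 / 2) * q + d ^ 2) ^ 2
          + 12 * (s + 1 / 2) ^ 2 * (((2 * s + 1 / 2) * q + d ^ 2) * d ^ 2)) / (b ^ 2 + s ^ 2) ^ 3)
      ≤ (profile b (s + d + q) + profile b (s - d + q)) / 2 := by
  have hD : 0 < b ^ 2 + s ^ 2 := by positivity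
  have key : ∀ r, profile b s * (1 - 2 * ((r ^ 2 - s ^ 2) / (b ^ 2 + s ^ 2))
      + 87 / 32 * ((r ^ 2 - s ^ 2) / (b ^ 2 + s ^ 2)) ^ 2
      - 63 / 32 * ((r ^ 2 - s ^ 2) / (b ^ 2 + s ^ 2)) ^ 3) ≤ profile b r := by
    intro r
    have h1 : 1 + (r ^ 2 - s ^ 2) / (b ^ 2 + s ^ 2) = (b ^ 2 + r ^ 2) / (b ^ 2 + s ^ 2) := by
      field_simp; ring
    have h2 : -1 < (r ^ 2 - s ^ 2) / (b ^ 2 + s ^ 2) := by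
      have : 0 < (b ^ 2 + r ^ 2) / (b ^ 2 + s ^ 2) := by positivity
      linarith
    refine (mul_le_mul_of_nonneg_left (cubic_le_inv_sq h2) (profile_nonneg b s)).trans (le_of_eq ?_)
    rw [h1]
    unfold profile
    have : 0 < b ^ 2 + r ^ 2 := by positivity
    field_simp
  have h1 := key (s + d + q)
  have h2 := key (s - d + q)
  refine le_trans ?_ (div_le_div_of_nonneg_right (add_le_add h1 h2) zero_le_two)
  rw [← mul_add, mul_div_assoc (profile b s)]
  refine mul_le_mul_of_nonneg_left ?_ (profile_nonneg b s)
  set D := b ^ 2 + s ^ 2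
  -- Averaging over ±d leaves only e and even powers of d. When d is linear and q quadratic in the
  -- cell coordinates, `g` is a quadratic form dominating e; replacing one factor of e³ by the
  -- constant 3s + 1/4 and the others by `g` keeps the bound of degree four in the coordinates.
  set e := 2 * s * q + d ^ 2 + q ^ 2 with he
  set g := (2 * s + 1 / 2) * q + d ^ 2 with hg
  have he0 : 0 ≤ e := by positivity
  have heg : e ≤ g := by rw [he, hg]; nlinarith
  have he3 : e ≤ 3 * s + 1 / 4 := by rw [he]; nlinarith
  have hexp : (1 - 2 * (((s + d + q) ^ 2 - s ^ 2) / D) + 87 / 32 * (((s + d + q) ^ 2 - s ^ 2) / D) ^ 2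
        - 63 / 32 * (((s + d + q) ^ 2 - s ^ 2) / D) ^ 3 +
      (1 - 2 * (((s - d + q) ^ 2 - s ^ 2) / D) + 87 / 32 * (((s - d + q) ^ 2 - s ^ 2) / D) ^ 2
        - 63 / 32 * (((s - d + q) ^ 2 - s ^ 2) / D) ^ 3)) / 2
      = 1 - 2 * e / D + 87 / 32 * (e ^ 2 + 4 * d ^ 2 * (s + q) ^ 2) / D ^ 2
        - 63 / 32 * (e ^ 3 + 12 * (s + q) ^ 2 * (e * d ^ 2)) / D ^ 3 := by
    rw [he]; field_simp; ring
  rw [hexp]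
  have hA : 4 * s ^ 2 * d ^ 2 ≤ e ^ 2 + 4 * d ^ 2 * (s + q) ^ 2 := by
    have : s ^ 2 ≤ (s + q) ^ 2 := by nlinarith
    nlinarith [sq_nonneg e, mul_le_mul_of_nonneg_left this (sq_nonneg d)]
  have hB : e ^ 3 + 12 * (s + q) ^ 2 * (e * d ^ 2)
      ≤ (3 * s + 1 / 4) * g ^ 2 + 12 * (s + 1 / 2) ^ 2 * (g * d ^ 2) := by
    have h1 : e ^ 3 ≤ (3 * s + 1 / 4) * g ^ 2 := by
      calc e ^ 3 = e * e ^ 2 := by ring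
        _ ≤ (3 * s + 1 / 4) * g ^ 2 := by gcongr
    have h2 : 12 * (s + q) ^ 2 * (e * d ^ 2) ≤ 12 * (s + 1 / 2) ^ 2 * (g * d ^ 2) := by gcongr
    linarith
  gcongr

/-- Iterated integral over the centred unit square. -/
noncomputable def squareInt (f : ℝ → ℝ → ℝ) : ℝ :=
  ∫ x in (-1 / 2 : ℝ)..(1 / 2), ∫ y in (-1 / 2 : ℝ)..(1 / 2), f x y

lemma squareInt_neg (f : ℝ → ℝ → ℝ) : squareInt (fun x y => f (-x) (-y)) = squareInt f := by
  unfold squareInt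
  have h1 : ∀ x, ∫ y in (-1 / 2 : ℝ)..(1 / 2), f (-x) (-y) = ∫ y in (-1 / 2 : ℝ)..(1 / 2), f (-x) y := by
    intro x
    rw [intervalIntegral.integral_comp_neg]
    norm_num
  simp_rw [h1]
  rw [intervalIntegral.integral_comp_neg (fun x => ∫ y in (-1 / 2 : ℝ)..(1 / 2), f x y)]
  norm_num

lemma continuous_inner_squareInt {f : ℝ → ℝ → ℝ} (hf : Continuous (Function.uncurry f)) :
    Continuous fun x => ∫ y in (-1 / 2 : ℝ)..(1 / 2), f x y :=
  intervalIntegral.continuous_parametric_intervalIntegral_of_continuous' hf _ _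

lemma squareInt_mono {f g : ℝ → ℝ → ℝ} (hf : Continuous (Function.uncurry f))
    (hg : Continuous (Function.uncurry g))
    (h : ∀ x ∈ Icc (-1 / 2 : ℝ) (1 / 2), ∀ y ∈ Icc (-1 / 2 : ℝ) (1 / 2), f x y ≤ g x y) :
    squareInt f ≤ squareInt g := by
  refine intervalIntegral.integral_mono_on (by norm_num)
    ((continuous_inner_squareInt hf).intervalIntegrable _ _)
    ((continuous_inner_squareInt hg).intervalIntegrable _ _) fun x hx => ?_
  refine intervalIntegral.integral_mono_on (by norm_num) ?_ ?_ fun y hy => h x hx y hy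
  · exact (hf.comp (Continuous.prodMk_right x)).intervalIntegrable _ _
  · exact (hg.comp (Continuous.prodMk_right x)).intervalIntegrable _ _

lemma squareInt_add {f g : ℝ → ℝ → ℝ} (hf : Continuous (Function.uncurry f))
    (hg : Continuous (Function.uncurry g)) :
    squareInt (fun x y => f x y + g x y) = squareInt f + squareInt g := by
  unfold squareInt
  rw [← intervalIntegral.integral_add ((continuous_inner_squareInt hf).intervalIntegrable _ _)
    ((continuous_inner_squareInt hg).intervalIntegrable _ _)]
  congr 1
  ext x
  exact intervalIntegral.integral_add ((hf.comp (Continuous.prodMk_right x)).intervalIntegrable _ _)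
    ((hg.comp (Continuous.prodMk_right x)).intervalIntegrable _ _)

lemma squareInt_const_mul (c : ℝ) (f : ℝ → ℝ → ℝ) :
    squareInt (fun x y => c * f x y) = c * squareInt f := by
  unfold squareInt
  simp_rw [intervalIntegral.integral_const_mul]

/-- Integral over the unit square of an even polynomial of degree four. -/
lemma squareInt_quartic (c₀ c₁ c₂ c₃ c₄ c₅ c₆ c₇ c₈ : ℝ) :
    squareInt (fun x y => c₀ + c₁ * x ^ 2 + c₂ * (x * y) + c₃ * y ^ 2 + c₄ * x ^ 4 + c₅ * (x ^ 3 * y)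
      + c₆ * (x ^ 2 * y ^ 2) + c₇ * (x * y ^ 3) + c₈ * y ^ 4)
      = c₀ + c₁ / 12 + c₃ / 12 + c₄ / 80 + c₆ / 144 + c₈ / 80 := by
  have h : ∀ m n : ℕ, squareInt (fun x y => x ^ m * y ^ n)
      = (((1 / 2 : ℝ) ^ (m + 1) - (-1 / 2) ^ (m + 1)) / (m + 1))
        * (((1 / 2 : ℝ) ^ (n + 1) - (-1 / 2) ^ (n + 1)) / (n + 1)) := by
    intro m n
    unfold squareInt
    simp_rw [intervalIntegral.integral_const_mul, intervalIntegral.integral_mul_const, integral_pow]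
  have e : (fun x y : ℝ => c₀ + c₁ * x ^ 2 + c₂ * (x * y) + c₃ * y ^ 2 + c₄ * x ^ 4 + c₅ * (x ^ 3 * y)
      + c₆ * (x ^ 2 * y ^ 2) + c₇ * (x * y ^ 3) + c₈ * y ^ 4)
      = fun x y => c₀ * (x ^ 0 * y ^ 0) + c₁ * (x ^ 2 * y ^ 0) + c₂ * (x ^ 1 * y ^ 1)
        + c₃ * (x ^ 0 * y ^ 2) + c₄ * (x ^ 4 * y ^ 0) + c₅ * (x ^ 3 * y ^ 1)
      + c₆ * (x ^ 2 * y ^ 2) + c₇ * (x ^ 1 * y ^ 3) + c₈ * (x ^ 0 * y ^ 4) := by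
    ext x y; ring
  rw [e]
  repeat rw [squareInt_add (by fun_prop) (by fun_prop)]
  simp only [squareInt_const_mul, h]
  norm_num
  ring

/-- The polynomial inequality behind the cell estimate. -/
lemma cell_polynomial_ineq {t i : ℝ} (ht : 0 ≤ t) (hi : 0 ≤ i) (hi7 : i ≤ 1 / 7) :
    (1 + 405 / 1000 * i) * (2 * (2 / 3 * t + 7 / 180 * i) * (1 + t ^ 2) ^ 2
        - 29 / 8 * t ^ 3 * (1 + t ^ 2)
        + 63 / 32 * i * (i * (3 * t + 1 / 4 * i) * ((2 * t + 1 / 2 * i) ^ 2 * (7 / 180)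
            + 2 * (2 * t + 1 / 2 * i) * (7 / 90 * t) + 16 / 60 * t ^ 2)
          + 12 * (t + 1 / 2 * i) ^ 2 * ((2 * t + 1 / 2 * i) * (7 / 90 * t) + 16 / 60 * t ^ 2)))
      ≤ 405 / 1000 * (1 + t ^ 2) ^ 3 := by
  set B : ℝ → ℝ := fun i => 2 * (2 / 3 * t + 7 / 180 * i) * (1 + t ^ 2) ^ 2
        + 63 / 32 * i * (i * (3 * t + 1 / 4 * i) * ((2 * t + 1 / 2 * i) ^ 2 * (7 / 180)
            + 2 * (2 * t + 1 / 2 * i) * (7 / 90 * t) + 16 / 60 * t ^ 2)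
          + 12 * (t + 1 / 2 * i) ^ 2 * ((2 * t + 1 / 2 * i) * (7 / 90 * t) + 16 / 60 * t ^ 2)) with hB
  -- `B` collects the terms with nonnegative coefficients in `i`, so the worst case is i = 1/7.
  have hmono : B i ≤ B (1 / 7) := by
    simp only [hB]
    gcongr
  have hP : (1 + 405 / 1000 * (1 / 7)) * (B (1 / 7) - 29 / 8 * t ^ 3 * (1 + t ^ 2))
      ≤ 405 / 1000 * (1 + t ^ 2) ^ 3 := by
    simp only [hB]
    -- The squares are centred near the point where the inequality has least slack.
    nlinarith [sq_nonneg (t - 383 / 1000), mul_nonneg ht (sq_nonneg (t - 383 / 1000)),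
      mul_nonneg (pow_nonneg ht 2) (sq_nonneg (t - 383 / 1000)),
      mul_nonneg (pow_nonneg ht 3) (sq_nonneg (t - 383 / 1000)),
      mul_nonneg (pow_nonneg ht 4) (sq_nonneg (t - 383 / 1000))]
  have hle : B i - 29 / 8 * t ^ 3 * (1 + t ^ 2) ≤ B (1 / 7) - 29 / 8 * t ^ 3 * (1 + t ^ 2) := by linarith
  refine le_trans (le_of_eq ?_) (le_trans (b := (1 + 405 / 1000 * i) * (B i - 29 / 8 * t ^ 3 * (1 + t ^ 2))) le_rfl ?_)
  · simp only [hB]; ring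
  -- The outer factor may be raised to its value at i = 1/7 only if the bracket is positive;
  -- otherwise the left side is nonpositive.
  · rcases le_or_gt (B i - 29 / 8 * t ^ 3 * (1 + t ^ 2)) 0 with h | h
    · have : (1 + 405 / 1000 * i) * (B i - 29 / 8 * t ^ 3 * (1 + t ^ 2)) ≤ 0 :=
        mul_nonpos_of_nonneg_of_nonpos (by positivity) h
      exact this.trans (by positivity)
    · refine le_trans ?_ hP
      gcongr

end LiebThirring

/-! ### The torus sum for large parameters -/

namespace LiebThirring

open Set Filter Topology
open scoped ENNReal

lemma squareInt_mul_quadratic (A E C a F c : ℝ) :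
    squareInt (fun x y => (A * x ^ 2 + E * (x * y) + C * y ^ 2) * (a * x ^ 2 + F * (x * y) + c * y ^ 2))
      = A * a / 80 + (A * c + C * a + E * F) / 144 + C * c / 80 := by
  rw [← zero_add (A * a / 80), ← show (0 : ℝ) + 0 / 12 + 0 / 12 = 0 by norm_num, ← squareInt_quartic 0 0 0 0 (A * a) (A * F + E * a) (A * c + C * a + E * F)
    (E * c + C * F) (C * c)]
  congr 1
  ext x y
  ring

lemma squareInt_quadratic (c₀ A E C : ℝ) :
    squareInt (fun x y => c₀ + A * x ^ 2 + E * (x * y) + C * y ^ 2) = c₀ + A / 12 + C / 12 := by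
  have := squareInt_quartic c₀ A E C 0 0 0 0 0
  simpa using this

lemma squareInt_linear_comb {f₀ f₁ f₂ f₃ f₄ : ℝ → ℝ → ℝ} (h₀ : Continuous (Function.uncurry f₀))
    (h₁ : Continuous (Function.uncurry f₁)) (h₂ : Continuous (Function.uncurry f₂))
    (h₃ : Continuous (Function.uncurry f₃)) (h₄ : Continuous (Function.uncurry f₄))
    (c₁ c₂ c₃ c₄ : ℝ) :
    squareInt (fun x y => f₀ x y + (c₁ * f₁ x y + (c₂ * f₂ x y + (c₃ * f₃ x y + c₄ * f₄ x y))))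
      = squareInt f₀ + (c₁ * squareInt f₁ + (c₂ * squareInt f₂ + (c₃ * squareInt f₃
        + c₄ * squareInt f₄))) := by
  have g₁ : Continuous (Function.uncurry fun x y => c₁ * f₁ x y) := continuous_const.mul h₁
  have g₂ : Continuous (Function.uncurry fun x y => c₂ * f₂ x y) := continuous_const.mul h₂
  have g₃ : Continuous (Function.uncurry fun x y => c₃ * f₃ x y) := continuous_const.mul h₃
  have g₄ : Continuous (Function.uncurry fun x y => c₄ * f₄ x y) := continuous_const.mul h₄
  rw [squareInt_add h₀ (by exact g₁.add (g₂.add (g₃.add g₄))),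
    squareInt_add g₁ (by exact g₂.add (g₃.add g₄)), squareInt_add g₂ (by exact g₃.add g₄), squareInt_add g₃ g₄]
  simp only [squareInt_const_mul]

/-- The substitution b = 1/i, s = t/i scales both sides by i⁻⁵ and leaves the inequality
`cell_polynomial_ineq`, with i ≤ 1/7 in place of b ≥ 7. -/
lemma cell_loss_le {b s : ℝ} (hb : 7 ≤ b) (hs : 0 ≤ s) :
    (1 + 405 / 1000 / b) * (2 * (2 / 3 * s + 7 / 180) * (b ^ 2 + s ^ 2) ^ 2
      - 29 / 8 * s ^ 3 * (b ^ 2 + s ^ 2)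
      + 63 / 32 * ((3 * s + 1 / 4) * ((2 * s + 1 / 2) ^ 2 * (7 / 180)
          + 2 * (2 * s + 1 / 2) * (7 / 90 * s) + 16 / 60 * s ^ 2)
        + 12 * (s + 1 / 2) ^ 2 * ((2 * s + 1 / 2) * (7 / 90 * s) + 16 / 60 * s ^ 2)))
      ≤ 405 / 1000 / b * (b ^ 2 + s ^ 2) ^ 3 := by
  have hb0 : 0 < b := by linarith
  obtain ⟨i, hi0, hi, rfl⟩ : ∃ i : ℝ, 0 < i ∧ i ≤ 1 / 7 ∧ b = i⁻¹ :=
    ⟨b⁻¹, by positivity, by rw [inv_eq_one_div, div_le_div_iff₀ hb0 (by norm_num)]; linarith, by simp⟩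
  obtain ⟨t, ht, rfl⟩ : ∃ t : ℝ, 0 ≤ t ∧ s = t / i := ⟨s * i, by positivity, by field_simp⟩
  have h2 := mul_le_mul_of_nonneg_left (cell_polynomial_ineq ht hi0.le hi) (by positivity : 0 ≤ (i⁻¹) ^ 5)
  refine le_trans (le_of_eq ?_) (h2.trans (le_of_eq ?_))
  · field_simp
  · field_simp

/-- In each unit cell, the value at the centre is controlled by the mean value. -/
lemma profile_le_squareInt {b : ℝ} (hb : 7 ≤ b) (p r : ℝ) :
    profile b (p ^ 2 + r ^ 2) ≤ (1 + 405 / 1000 / b) *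
      squareInt (fun x y => profile b ((p + x) ^ 2 + (r + y) ^ 2)) := by
  have hb0 : 0 < b := by linarith
  have hcont : Continuous (Function.uncurry fun x y => profile b ((p + x) ^ 2 + (r + y) ^ 2)) :=
    (continuous_profile hb0).comp (by fun_prop)
  have hcont' : Continuous (Function.uncurry fun x y => profile b ((p + -x) ^ 2 + (r + -y) ^ 2)) :=
    (continuous_profile hb0).comp (by fun_prop)
  set s := p ^ 2 + r ^ 2 with hs
  set D := b ^ 2 + s ^ 2 with hD
  have hs0 : 0 ≤ s := by positivity
  have hD0 : 0 < D := by positivity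
  set h := 2 * s + 1 / 2 with hh
  -- The reflection of the cell in its centre removes the terms of odd order.
  have hsymm : squareInt (fun x y => profile b ((p + x) ^ 2 + (r + y) ^ 2))
      = squareInt (fun x y => 1 / 2 * (profile b ((p + x) ^ 2 + (r + y) ^ 2)
        + profile b ((p + -x) ^ 2 + (r + -y) ^ 2))) := by
    rw [squareInt_const_mul, squareInt_add hcont hcont',
      squareInt_neg (fun x y => profile b ((p + x) ^ 2 + (r + y) ^ 2))]
    ring
  have hlow : squareInt (fun x y => profile b s *
      ((1 + (-(4 * s / D)) * x ^ 2 + 0 * (x * y) + (-(4 * s / D)) * y ^ 2)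
      + ((-2 / D + 87 / 32 * (4 * s ^ 2) / D ^ 2) *
          (0 + 4 * p ^ 2 * x ^ 2 + 8 * p * r * (x * y) + 4 * r ^ 2 * y ^ 2)
      + ((-2 / D) * ((1 * x ^ 2 + 0 * (x * y) + 1 * y ^ 2) * (1 * x ^ 2 + 0 * (x * y) + 1 * y ^ 2))
      + ((-(63 / 32) / D ^ 3 * (3 * s + 1 / 4)) *
          (((h + 4 * p ^ 2) * x ^ 2 + 8 * p * r * (x * y) + (h + 4 * r ^ 2) * y ^ 2)
            * ((h + 4 * p ^ 2) * x ^ 2 + 8 * p * r * (x * y) + (h + 4 * r ^ 2) * y ^ 2))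
      + (-(63 / 32) / D ^ 3 * (12 * (s + 1 / 2) ^ 2)) *
          (((h + 4 * p ^ 2) * x ^ 2 + 8 * p * r * (x * y) + (h + 4 * r ^ 2) * y ^ 2)
            * ((4 * p ^ 2) * x ^ 2 + 8 * p * r * (x * y) + (4 * r ^ 2) * y ^ 2)))))))
      ≤ squareInt (fun x y => profile b ((p + x) ^ 2 + (r + y) ^ 2)) := by
    rw [hsymm]
    refine squareInt_mono (by fun_prop) (by
      exact continuous_const.mul (hcont.add hcont')) fun x hx y hy => ?_
    have hx2 : x ^ 2 ≤ 1 / 4 := by nlinarith [hx.1, hx.2]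
    have hy2 : y ^ 2 ≤ 1 / 4 := by nlinarith [hy.1, hy.2]
    -- Here |(p + x, r + y)|² = s + d + q; the condition d² ≤ 4sq is the Cauchy–Schwarz inequality.
    have := profile_symm_lower (b := b) (s := s) (d := 2 * (p * x + r * y)) (q := x ^ 2 + y ^ 2)
      hb0 hs0 (by positivity) (by linarith) (by rw [hs]; nlinarith [sq_nonneg (p * y - r * x)])
    refine le_trans (le_of_eq ?_) (this.trans (le_of_eq ?_))
    · rw [← hD, hh]; ring
    · rw [show s + 2 * (p * x + r * y) + (x ^ 2 + y ^ 2) = (p + x) ^ 2 + (r + y) ^ 2 by rw [hs]; ring,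
        show s - 2 * (p * x + r * y) + (x ^ 2 + y ^ 2) = (p + -x) ^ 2 + (r + -y) ^ 2 by rw [hs]; ring]
      ring
  rw [squareInt_const_mul, squareInt_linear_comb (by fun_prop) (by fun_prop) (by fun_prop)
    (by fun_prop) (by fun_prop), squareInt_quadratic, squareInt_quadratic,
    squareInt_mul_quadratic, squareInt_mul_quadratic, squareInt_mul_quadratic] at hlow
  have hbpos : (0 : ℝ) ≤ 1 + 405 / 1000 / b := by positivity
  refine le_trans ?_ (mul_le_mul_of_nonneg_left hlow hbpos)
  rw [mul_left_comm]
  refine le_mul_of_one_le_right (profile_nonneg b s) ?_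
  -- The means over the cell of q², d² and qd² are 7/180, s/3 and 7s/90; that of d⁴ is at most
  -- 16s²/60. `L / D ^ 3` is then a bound for the relative loss.
  set L : ℝ := 2 * (2 / 3 * s + 7 / 180) * D ^ 2 - 29 / 8 * s ^ 3 * D
    + 63 / 32 * ((3 * s + 1 / 4) * (h ^ 2 * (7 / 180) + 2 * h * (7 / 90 * s) + 16 / 60 * s ^ 2)
      + 12 * (s + 1 / 2) ^ 2 * (h * (7 / 90 * s) + 16 / 60 * s ^ 2)) with hL
  have hmain : (1 + 405 / 1000 / b) * L ≤ 405 / 1000 / b * D ^ 3 := cell_loss_le hb hs0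
  -- The fourth moment of d depends on the direction of (p, r) and is largest on the diagonals p² =
  -- r².
  have hp4 : 16 * (p ^ 4 + r ^ 4) / 80 + 96 * p ^ 2 * r ^ 2 / 144 ≤ 16 / 60 * s ^ 2 := by
    have hdiff : 16 / 60 * s ^ 2 - (16 * (p ^ 4 + r ^ 4) / 80 + 96 * p ^ 2 * r ^ 2 / 144)
        = (p ^ 2 - r ^ 2) ^ 2 / 15 := by rw [hs]; ring
    linarith [sq_nonneg (p ^ 2 - r ^ 2)]
  have hge : 1 - L / D ^ 3 ≤ 1 + -(4 * s / D) / 12 + -(4 * s / D) / 12 +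
      ((-2 / D + 87 / 32 * (4 * s ^ 2) / D ^ 2) * (0 + 4 * p ^ 2 / 12 + 4 * r ^ 2 / 12) +
        (-2 / D * (1 * 1 / 80 + (1 * 1 + 1 * 1 + 0 * 0) / 144 + 1 * 1 / 80) +
          (-(63 / 32) / D ^ 3 * (3 * s + 1 / 4) *
              ((h + 4 * p ^ 2) * (h + 4 * p ^ 2) / 80 +
                  ((h + 4 * p ^ 2) * (h + 4 * r ^ 2) + (h + 4 * r ^ 2) * (h + 4 * p ^ 2) + 8 * p * r * (8 * p * r)) / 144 +
                (h + 4 * r ^ 2) * (h + 4 * r ^ 2) / 80) +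
            -(63 / 32) / D ^ 3 * (12 * (s + 1 / 2) ^ 2) *
              ((h + 4 * p ^ 2) * (4 * p ^ 2) / 80 +
                  ((h + 4 * p ^ 2) * (4 * r ^ 2) + (h + 4 * r ^ 2) * (4 * p ^ 2) + 8 * p * r * (8 * p * r)) / 144 +
                (h + 4 * r ^ 2) * (4 * r ^ 2) / 80)))) := by
    have e1 : (h + 4 * p ^ 2) * (h + 4 * p ^ 2) / 80 +
                  ((h + 4 * p ^ 2) * (h + 4 * r ^ 2) + (h + 4 * r ^ 2) * (h + 4 * p ^ 2) + 8 * p * r * (8 * p * r)) / 144 +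
                (h + 4 * r ^ 2) * (h + 4 * r ^ 2) / 80
        ≤ h ^ 2 * (7 / 180) + 2 * h * (7 / 90 * s) + 16 / 60 * s ^ 2 := by
      refine le_trans (le_of_eq ?_) (add_le_add_right hp4 _)
      rw [hs]; ring
    have e2 : (h + 4 * p ^ 2) * (4 * p ^ 2) / 80 +
                  ((h + 4 * p ^ 2) * (4 * r ^ 2) + (h + 4 * r ^ 2) * (4 * p ^ 2) + 8 * p * r * (8 * p * r)) / 144 +
                (h + 4 * r ^ 2) * (4 * r ^ 2) / 80
        ≤ h * (7 / 90 * s) + 16 / 60 * s ^ 2 := by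
      refine le_trans (le_of_eq ?_) (add_le_add_right hp4 _)
      rw [hs]; ring
    have e3 : (0 + 4 * p ^ 2 / 12 + 4 * r ^ 2 / 12) = s / 3 := by rw [hs]; ring
    rw [e3]
    have f1 := mul_le_mul_of_nonneg_left e1 (by positivity : 0 ≤ 63 / 32 / D ^ 3 * (3 * s + 1 / 4))
    have f2 := mul_le_mul_of_nonneg_left e2 (by positivity : 0 ≤ 63 / 32 / D ^ 3 * (12 * (s + 1 / 2) ^ 2))
    have e4 : 1 - L / D ^ 3 = 1 + -(4 * s / D) / 12 + -(4 * s / D) / 12 +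
      ((-2 / D + 87 / 32 * (4 * s ^ 2) / D ^ 2) * (s / 3) +
        (-2 / D * (7 / 180)) - (63 / 32 / D ^ 3 * (3 * s + 1 / 4) *
          (h ^ 2 * (7 / 180) + 2 * h * (7 / 90 * s) + 16 / 60 * s ^ 2)) -
          63 / 32 / D ^ 3 * (12 * (s + 1 / 2) ^ 2) * (h * (7 / 90 * s) + 16 / 60 * s ^ 2)) := by
      have hLD : L / D ^ 3 = 2 * (2 / 3 * s + 7 / 180) / D - 29 / 8 * s ^ 3 / D ^ 2
          + 63 / 32 * ((3 * s + 1 / 4) * (h ^ 2 * (7 / 180) + 2 * h * (7 / 90 * s) + 16 / 60 * s ^ 2)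
      + 12 * (s + 1 / 2) ^ 2 * (h * (7 / 90 * s) + 16 / 60 * s ^ 2)) / D ^ 3 := by
        rw [hL, add_div, sub_div]
        congr 2 <;> field_simp
      rw [hLD]
      ring
    rw [e4]
    have e5 : (1 * 1 / 80 + (1 * 1 + 1 * 1 + 0 * 0) / 144 + 1 * 1 / 80 : ℝ) = 7 / 180 := by norm_num
    rw [e5]
    have e6 : -(63 / 32) / D ^ 3 = -(63 / 32 / D ^ 3) := by ring
    rw [e6]
    linarith
  refine le_trans ?_ (mul_le_mul_of_nonneg_left hge hbpos)
  have : (1 + 405 / 1000 / b) * (1 - L / D ^ 3)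
      = (1 + 405 / 1000 / b) - ((1 + 405 / 1000 / b) * L) / D ^ 3 := by ring
  rw [this]
  have h3 : ((1 + 405 / 1000 / b) * L) / D ^ 3 ≤ 405 / 1000 / b := by
    rw [div_le_iff₀ (by positivity)]; exact hmain
  linarith

/-- The planar integral of the profile. -/
lemma lintegral_profile_plane {b : ℝ} (hb : 0 < b) :
    ∫⁻ z : ℝ × ℝ, ENNReal.ofReal (profile b (z.1 ^ 2 + z.2 ^ 2)) = ENNReal.ofReal (Real.pi ^ 2 * b / 4) := by
  rw [← lintegral_comp_polarCoord_symm]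
  -- The substitution t = r² reduces the radial integral to the one-dimensional one, with a factor
  -- 1/2; the angle contributes 2π.
  have hderiv : ∀ x ∈ Ici (0 : ℝ), HasDerivAt (fun r => 1 / 2 * (b ^ 2 * r ^ 2 / (2 * (b ^ 2 + (r ^ 2) ^ 2))
      + b / 2 * Real.arctan (r ^ 2 / b))) (x * profile b (x ^ 2)) x := by
    intro x _
    have h := ((hasDerivAt_quartic_antideriv hb (x ^ 2)).comp x (hasDerivAt_pow 2 x)).const_mul (1 / 2)
    refine h.congr_deriv ?_
    unfold profile
    push_cast
    ring
  have hlim : Tendsto (fun r => 1 / 2 * (b ^ 2 * r ^ 2 / (2 * (b ^ 2 + (r ^ 2) ^ 2))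
      + b / 2 * Real.arctan (r ^ 2 / b))) atTop (𝓝 (1 / 2 * (Real.pi * b / 4))) :=
    ((tendsto_quartic_antideriv hb).comp (tendsto_pow_atTop two_ne_zero)).const_mul _
  have hpos : ∀ x ∈ Ioi (0 : ℝ), 0 ≤ x * profile b (x ^ 2) := fun x hx =>
    mul_nonneg (le_of_lt hx) (profile_nonneg _ _)
  have hI := integral_Ioi_of_hasDerivAt_of_nonneg' hderiv hpos hlim
  have hint := integrableOn_Ioi_deriv_of_nonneg' hderiv hpos hlim
  have h1 : ∫⁻ z in polarCoord.target, ENNReal.ofReal z.1 • ENNReal.ofReal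
        (profile b ((polarCoord.symm z).1 ^ 2 + (polarCoord.symm z).2 ^ 2))
      = ∫⁻ z in Ioi (0 : ℝ) ×ˢ Ioo (-Real.pi) Real.pi, ENNReal.ofReal (z.1 * profile b (z.1 ^ 2)) * 1 := by
    refine setLIntegral_congr_fun polarCoord.open_target.measurableSet fun z hz => ?_
    have hz1 : 0 < z.1 := hz.1
    simp only [polarCoord_symm_apply, smul_eq_mul, mul_one]
    rw [← ENNReal.ofReal_mul hz1.le]
    congr 3
    nlinarith [Real.sin_sq_add_cos_sq z.2]
  rw [h1, Measure.volume_eq_prod, ← Measure.prod_restrict, lintegral_prod_mul (f := fun x => ENNReal.ofReal (x * profile b (x ^ 2)))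
    (g := fun _ => 1), ← ofReal_integral_eq_lintegral_ofReal hint, hI]
  · simp only [lintegral_const, one_mul, Measure.restrict_apply_univ, Real.volume_Ioo]
    rw [← ENNReal.ofReal_mul]
    · congr 1
      simp
      ring
    · simp; positivity
  · exact (ae_restrict_iff' measurableSet_Ioi).2 (ae_of_all _ hpos)
  · have : Continuous fun x => x * profile b (x ^ 2) :=
      continuous_id.mul ((continuous_profile hb).comp (by fun_prop))
    exact this.measurable.ennreal_ofReal.aemeasurable
  · exact aemeasurable_const

lemma integrable_profile_plane {b : ℝ} (hb : 0 < b) :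
    Integrable (fun z : ℝ × ℝ => profile b (z.1 ^ 2 + z.2 ^ 2)) := by
  have hc : Continuous (fun z : ℝ × ℝ => profile b (z.1 ^ 2 + z.2 ^ 2)) :=
    (continuous_profile hb).comp (by fun_prop)
  refine ⟨hc.aestronglyMeasurable, ?_⟩
  rw [hasFiniteIntegral_iff_ofReal (ae_of_all _ fun z => profile_nonneg _ _), lintegral_profile_plane hb]
  exact ENNReal.ofReal_lt_top

lemma integral_profile_plane {b : ℝ} (hb : 0 < b) :
    ∫ z : ℝ × ℝ, profile b (z.1 ^ 2 + z.2 ^ 2) = Real.pi ^ 2 * b / 4 := by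
  rw [integral_eq_lintegral_of_nonneg_ae (ae_of_all _ fun z => profile_nonneg _ _)
    (integrable_profile_plane hb).aestronglyMeasurable, lintegral_profile_plane hb,
    ENNReal.toReal_ofReal (by positivity)]

/-- The half-open unit squares around lattice points are disjoint, so the integrals over them add up
to at most the integral over the plane. -/
lemma sum_squareInt_le {b : ℝ} (hb : 0 < b) (K : Finset (ℤ × ℤ)) :
    ∑ k ∈ K, squareInt (fun x y => profile b (((k.1 : ℝ) + x) ^ 2 + ((k.2 : ℝ) + y) ^ 2))
      ≤ Real.pi ^ 2 * b / 4 := by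
  let cell : ℤ × ℤ → Set (ℝ × ℝ) := fun k =>
    Ioc ((k.1 : ℝ) + -1 / 2) (k.1 + 1 / 2) ×ˢ Ioc ((k.2 : ℝ) + -1 / 2) (k.2 + 1 / 2)
  have hcell : ∀ k : ℤ × ℤ, squareInt (fun x y => profile b (((k.1 : ℝ) + x) ^ 2 + ((k.2 : ℝ) + y) ^ 2))
      = ∫ z in cell k, profile b (z.1 ^ 2 + z.2 ^ 2) := by
    intro k
    simp only [cell]
    rw [Measure.volume_eq_prod, setIntegral_prod _ (integrable_profile_plane hb).integrableOn]
    unfold squareInt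
    have hin : ∀ x : ℝ, ∫ y in (-1 / 2 : ℝ)..(1 / 2), profile b (((k.1 : ℝ) + x) ^ 2 + ((k.2 : ℝ) + y) ^ 2)
        = ∫ y in ((k.2 : ℝ) + -1 / 2)..(k.2 + 1 / 2), profile b (((k.1 : ℝ) + x) ^ 2 + y ^ 2) :=
      fun x => intervalIntegral.integral_comp_add_left
        (fun y => profile b (((k.1 : ℝ) + x) ^ 2 + y ^ 2)) (k.2 : ℝ)
    simp_rw [hin]
    rw [intervalIntegral.integral_comp_add_left
      (fun x => ∫ y in ((k.2 : ℝ) + -1 / 2)..(k.2 + 1 / 2), profile b (x ^ 2 + y ^ 2)) (k.1 : ℝ),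
      intervalIntegral.integral_of_le (by linarith)]
    refine setIntegral_congr_fun measurableSet_Ioc fun x _ => ?_
    exact intervalIntegral.integral_of_le (by linarith)
  have hdisj : (K : Set (ℤ × ℤ)).PairwiseDisjoint cell := by
    intro k _ l _ hkl
    have hone : ∀ m n : ℤ, ∀ x : ℝ, x ∈ Ioc ((m : ℝ) + -1 / 2) (m + 1 / 2) →
        x ∈ Ioc ((n : ℝ) + -1 / 2) (n + 1 / 2) → m = n := by
      intro m n x h1 h2
      have h3 : (m : ℝ) < n + 1 := by linarith [h1.1, h2.2]
      have h4 : (n : ℝ) < m + 1 := by linarith [h2.1, h1.2]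
      have h5 : m < n + 1 := by exact_mod_cast h3
      have h6 : n < m + 1 := by exact_mod_cast h4
      omega
    refine Set.disjoint_left.2 fun z hz1 hz2 => hkl ?_
    exact Prod.ext (hone _ _ _ hz1.1 hz2.1) (hone _ _ _ hz1.2 hz2.2)
  simp_rw [hcell]
  rw [← integral_biUnion_finset K (fun k _ => measurableSet_Ioc.prod measurableSet_Ioc) hdisj
    fun k _ => (integrable_profile_plane hb).integrableOn, ← integral_profile_plane hb]
  exact setIntegral_le_integral (integrable_profile_plane hb) (ae_of_all _ fun z => profile_nonneg _ _)

/-- The lattice sum for the torus, for large parameters. -/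
lemma sum_profile_lattice_le_of_seven_le {b : ℝ} (hb : 7 ≤ b) (K : Finset (ℤ × ℤ)) (h0 : (0 : ℤ × ℤ) ∉ K) :
    ∑ k ∈ K, profile b ((k.1 : ℝ) ^ 2 + (k.2 : ℝ) ^ 2) ≤ Real.pi ^ 2 * b / 4 := by
  have hb0 : 0 < b := by linarith
  -- The origin is included for the comparison and then subtracted. Its value 1 outweighs the excess
  -- (405/4000)π² < 1, which dictates the constant 405/1000.
  have h1 : ∑ k ∈ insert 0 K, profile b ((k.1 : ℝ) ^ 2 + (k.2 : ℝ) ^ 2)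
      ≤ (1 + 405 / 1000 / b) * (Real.pi ^ 2 * b / 4) := by
    refine (Finset.sum_le_sum fun k _ => profile_le_squareInt hb (k.1 : ℝ) (k.2 : ℝ)).trans ?_
    rw [← Finset.mul_sum]
    exact mul_le_mul_of_nonneg_left (sum_squareInt_le hb0 _) (by positivity)
  rw [Finset.sum_insert h0] at h1
  have h2 : profile b (((0 : ℤ × ℤ).1 : ℝ) ^ 2 + ((0 : ℤ × ℤ).2 : ℝ) ^ 2) = 1 := by
    simp [profile]
    field_simp
  rw [h2] at h1
  have h3 : (1 + 405 / 1000 / b) * (Real.pi ^ 2 * b / 4) = Real.pi ^ 2 * b / 4 + 405 / 4000 * Real.pi ^ 2 := by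
    field_simp; ring
  have h4 : Real.pi ^ 2 ≤ 3.1416 ^ 2 := by
    have := Real.pi_lt_d4
    have := Real.pi_pos
    gcongr
  norm_num at h4
  linarith

end LiebThirring

/-! ### The torus sum for small parameters -/

namespace LiebThirring

open Set Filter Topology
open scoped ENNReal

/-- Allows every `b` between two grid points to be replaced by the right one. -/
lemma profile_mono_left {b b' s : ℝ} (hb : 0 < b) (hbb : b ≤ b') : profile b s ≤ profile b' s := by
  unfold profile
  have hb' : 0 < b' := hb.trans_le hbb
  rw [div_le_div_iff₀ (by positivity) (by positivity)]
  have : b ^ 2 * (b' ^ 2 + s ^ 2) ≤ b' ^ 2 * (b ^ 2 + s ^ 2) := by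
    have : b ^ 2 ≤ b' ^ 2 := by gcongr
    nlinarith [mul_le_mul_of_nonneg_right this (sq_nonneg s)]
  have h2 := pow_le_pow_left₀ (by positivity) this 2
  nlinarith

/-- For `b ≤ √3 s` even `profile b s / b` is monotone. -/
lemma profile_div_mono {b b' s : ℝ} (hb : 0 < b) (hbb : b ≤ b') (hs : b' ^ 2 ≤ 3 * s ^ 2) :
    profile b s / b ≤ profile b' s / b' := by
  unfold profile
  have hb' : 0 < b' := hb.trans_le hbb
  have e : ∀ c : ℝ, 0 < c → c ^ 4 / (c ^ 2 + s ^ 2) ^ 2 / c = c ^ 3 / (c ^ 2 + s ^ 2) ^ 2 := by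
    intro c hc; field_simp
  rw [e b hb, e b' hb', div_le_div_iff₀ (by positivity) (by positivity)]
  have hP : b * b' ≤ 3 * s ^ 2 := (mul_le_mul_of_nonneg_right hbb hb'.le).trans (by rw [← sq]; exact hs)
  have hfac : b' ^ 3 * (b ^ 2 + s ^ 2) ^ 2 - b ^ 3 * (b' ^ 2 + s ^ 2) ^ 2
      = (b' - b) * ((b * b') * (3 * s ^ 2 - b * b') * (s ^ 2 + b * b') + s ^ 4 * (b' - b) ^ 2) := by ring
  have h1 : 0 ≤ (b' - b) * ((b * b') * (3 * s ^ 2 - b * b') * (s ^ 2 + b * b') + s ^ 4 * (b' - b) ^ 2) := by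
    have h2 : 0 ≤ b' - b := by linarith
    have h3 : 0 ≤ 3 * s ^ 2 - b * b' := by linarith
    positivity
  linarith

/-- Upper bound, in units of `10⁻⁶`, for the profile with `b = p / 20` at a lattice point. -/
def latticeTerm (p : ℕ) (k : ℤ × ℤ) : ℕ :=
  -- Since 20⁴ = 400², the powers of 20 cancel in the profile. The final 1 makes up for the rounding
  -- down of the division.
  p ^ 4 * 10 ^ 6 / (p ^ 2 + 400 * (k.1.natAbs ^ 2 + k.2.natAbs ^ 2) ^ 2) ^ 2 + 1

/-- The lattice points of the square of half side eight, without the origin. -/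
noncomputable def latticeBox : Finset (ℤ × ℤ) := (Finset.Icc (-8) 8 ×ˢ Finset.Icc (-8) 8).erase 0

lemma profile_le_latticeTerm {p : ℕ} (hp : 0 < p) (k : ℤ × ℤ) :
    profile (p / 20) ((k.1 : ℝ) ^ 2 + (k.2 : ℝ) ^ 2) ≤ latticeTerm p k / 10 ^ 6 := by
  have hp' : (0 : ℝ) < p := by exact_mod_cast hp
  set n := k.1.natAbs ^ 2 + k.2.natAbs ^ 2 with hn
  have hs : (k.1 : ℝ) ^ 2 + (k.2 : ℝ) ^ 2 = n := by
    rw [hn]; push_cast [Nat.cast_natAbs]; simp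
  have h := Nat.lt_div_mul_add (a := p ^ 4 * 10 ^ 6) (b := (p ^ 2 + 400 * n ^ 2) ^ 2) (by positivity)
  have h2 : p ^ 4 * 10 ^ 6 ≤ latticeTerm p k * (p ^ 2 + 400 * n ^ 2) ^ 2 := by
    unfold latticeTerm; rw [add_mul, one_mul]; exact h.le
  have h3 : (p : ℝ) ^ 4 * 10 ^ 6 ≤ latticeTerm p k * ((p : ℝ) ^ 2 + 400 * n ^ 2) ^ 2 := by exact_mod_cast h2
  rw [hs]
  unfold profile
  rw [div_le_div_iff₀ (by positivity) (by positivity)]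
  have e : (((p : ℝ) / 20) ^ 2 + (n : ℝ) ^ 2) ^ 2 = ((p : ℝ) ^ 2 + 400 * n ^ 2) ^ 2 / 160000 := by ring
  rw [e]
  calc ((p : ℝ) / 20) ^ 4 * 10 ^ 6 = (p : ℝ) ^ 4 * 10 ^ 6 / 160000 := by ring
    _ ≤ latticeTerm p k * ((p : ℝ) ^ 2 + 400 * n ^ 2) ^ 2 / 160000 := by gcongr
    _ = _ := by ring

/-- Each term is at most the telescoping difference ((m − 1)⁻⁶ − m⁻⁶)/6, as in the integral test. -/
lemma sum_inv_pow_seven_le (R : ℕ) : ∑ m ∈ Finset.Ico 9 (9 + R), (1 : ℝ) / m ^ 7 ≤ 1 / 6 * (1 / 8 ^ 6 - 1 / (8 + R) ^ 6) := by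
  induction R with
  | zero => simp
  | succ R ih =>
    rw [← add_assoc, Finset.sum_Ico_succ_top (by omega)]
    have h : (1 : ℝ) / ((9 + R : ℕ) : ℝ) ^ 7 ≤ 1 / 6 * (1 / (8 + R) ^ 6 - 1 / (8 + (R + 1 : ℕ)) ^ 6) := by
      push_cast
      obtain ⟨x, hx, h8⟩ : ∃ x : ℝ, 0 < x ∧ (8 : ℝ) + R = x := ⟨8 + R, by positivity, rfl⟩
      rw [show (9 : ℝ) + R = x + 1 by linarith, show (8 : ℝ) + (R + 1) = x + 1 by linarith, h8,
        div_sub_div _ _ (by positivity) (by positivity), div_mul_div_comm,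
        div_le_div_iff₀ (by positivity) (by positivity)]
      have h6 : 6 * x ^ 5 ≤ (x + 1) ^ 6 - x ^ 6 := by
        have : (x + 1) ^ 6 - x ^ 6 - 6 * x ^ 5 = 15 * x ^ 4 + 20 * x ^ 3 + 15 * x ^ 2 + 6 * x + 1 := by ring
        have : 0 ≤ 15 * x ^ 4 + 20 * x ^ 3 + 15 * x ^ 2 + 6 * x + 1 := by positivity
        linarith
      have h7 : 6 * x ^ 6 ≤ ((x + 1) ^ 6 - x ^ 6) * (x + 1) := by
        have : 6 * x ^ 5 * x ≤ ((x + 1) ^ 6 - x ^ 6) * (x + 1) := by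
          apply mul_le_mul h6 (by linarith) hx.le
          nlinarith [pow_pos hx 5]
        nlinarith
      have := mul_le_mul_of_nonneg_right h7 (by positivity : 0 ≤ (x + 1) ^ 6)
      nlinarith
    linarith

/-- Lattice points outside the box contribute little. -/
lemma sum_profile_outside_le {b : ℝ} (hb : 0 < b) (K : Finset (ℤ × ℤ))
    (hK : ∀ k ∈ K, 9 ≤ max k.1.natAbs k.2.natAbs) :
    ∑ k ∈ K, profile b ((k.1 : ℝ) ^ 2 + (k.2 : ℝ) ^ 2) ≤ 4 / 3 * b ^ 4 / 8 ^ 6 := by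
  obtain ⟨R, hR⟩ : ∃ R, ∀ k ∈ K, max k.1.natAbs k.2.natAbs < 9 + R :=
    ⟨K.sup fun k => max k.1.natAbs k.2.natAbs, fun k hk => by
      have := Finset.le_sup (f := fun k : ℤ × ℤ => max k.1.natAbs k.2.natAbs) hk
      omega⟩
  rw [← Finset.sum_fiberwise_of_maps_to (t := Finset.Ico 9 (9 + R)) (g := fun k : ℤ × ℤ => max k.1.natAbs k.2.natAbs)
    (fun k hk => Finset.mem_Ico.2 ⟨hK k hk, hR k hk⟩)]
  -- The shell of points with maximum norm `m` has 8m elements, and each contributes at most b⁴/m⁸.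
  have h1 : ∀ m ∈ Finset.Ico 9 (9 + R),
      ∑ k ∈ K with max k.1.natAbs k.2.natAbs = m, profile b ((k.1 : ℝ) ^ 2 + (k.2 : ℝ) ^ 2)
        ≤ 8 * b ^ 4 * (1 / (m : ℝ) ^ 7) := by
    intro m hm
    have hm9 : 9 ≤ m := (Finset.mem_Ico.1 hm).1
    have hm0 : (0 : ℝ) < m := by exact_mod_cast (by omega : 0 < m)
    have h2 : ∀ k ∈ K.filter (fun k => max k.1.natAbs k.2.natAbs = m),
        profile b ((k.1 : ℝ) ^ 2 + (k.2 : ℝ) ^ 2) ≤ b ^ 4 / (m : ℝ) ^ 8 := by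
      intro k hk
      have hk2 : max k.1.natAbs k.2.natAbs = m := (Finset.mem_filter.1 hk).2
      have hs : (m : ℝ) ^ 2 ≤ (k.1 : ℝ) ^ 2 + (k.2 : ℝ) ^ 2 := by
        have e : ∀ a : ℤ, (a : ℝ) ^ 2 = (a.natAbs : ℝ) ^ 2 := fun a => by
          rw [Nat.cast_natAbs]; simp
        rw [e k.1, e k.2]
        rcases max_choice k.1.natAbs k.2.natAbs with h | h <;> rw [h] at hk2 <;> rw [hk2] <;>
          nlinarith [sq_nonneg (k.1.natAbs : ℝ), sq_nonneg (k.2.natAbs : ℝ)]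
      unfold profile
      have h4 : ((m : ℝ) ^ 2) ^ 2 ≤ ((k.1 : ℝ) ^ 2 + (k.2 : ℝ) ^ 2) ^ 2 := by gcongr
      have h5 : (((m : ℝ) ^ 2) ^ 2) ^ 2 ≤ (b ^ 2 + ((k.1 : ℝ) ^ 2 + (k.2 : ℝ) ^ 2) ^ 2) ^ 2 := by
        gcongr
        nlinarith
      rw [show (m : ℝ) ^ 8 = (((m : ℝ) ^ 2) ^ 2) ^ 2 by ring]
      gcongr
    refine (Finset.sum_le_card_nsmul _ _ _ h2).trans ?_
    have h3 : (K.filter (fun k => max k.1.natAbs k.2.natAbs = m)).card ≤ 8 * m := by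
      rw [← Int.card_box (by omega : m ≠ 0)]
      refine Finset.card_le_card fun k hk => ?_
      rw [Int.mem_box]
      exact (Finset.mem_filter.1 hk).2
    have h3' : ((K.filter (fun k => max k.1.natAbs k.2.natAbs = m)).card : ℝ) ≤ 8 * m := by exact_mod_cast h3
    rw [nsmul_eq_mul]
    calc _ ≤ (8 * m : ℝ) * (b ^ 4 / (m : ℝ) ^ 8) := by gcongr
      _ = _ := by field_simp
  refine (Finset.sum_le_sum h1).trans ?_
  rw [← Finset.mul_sum]
  calc 8 * b ^ 4 * ∑ m ∈ Finset.Ico 9 (9 + R), 1 / (m : ℝ) ^ 7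
      ≤ 8 * b ^ 4 * (1 / 6 * (1 / 8 ^ 6 - 1 / (8 + R) ^ 6)) := by gcongr; exact sum_inv_pow_seven_le R
    _ ≤ 8 * b ^ 4 * (1 / 6 * (1 / 8 ^ 6)) := by
      gcongr
      have : (0 : ℝ) ≤ 1 / (8 + R) ^ 6 := by positivity
      linarith
    _ = _ := by ring

lemma sum_profile_le_of_nat {p : ℕ} (hp : 0 < p) (K : Finset (ℤ × ℤ)) (h0 : (0 : ℤ × ℤ) ∉ K) :
    ∑ k ∈ K, profile (p / 20) ((k.1 : ℝ) ^ 2 + (k.2 : ℝ) ^ 2)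
      ≤ (∑ k ∈ latticeBox, latticeTerm p k : ℕ) / 10 ^ 6 + 4 / 3 * ((p : ℝ) / 20) ^ 4 / 8 ^ 6 := by
  have hp' : (0 : ℝ) < p / 20 := by have : (0 : ℝ) < p := by exact_mod_cast hp
                                    positivity
  rw [← Finset.sum_filter_add_sum_filter_not K (fun k => k ∈ latticeBox)]
  refine add_le_add ?_ (sum_profile_outside_le hp' _ fun k hk => ?_)
  · push_cast
    rw [Finset.sum_div]
    refine (Finset.sum_le_sum fun k _ => profile_le_latticeTerm hp k).trans ?_
    refine Finset.sum_le_sum_of_subset_of_nonneg (fun k hk => (Finset.mem_filter.1 hk).2) fun _ _ _ => by positivity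
  · obtain ⟨hk1, hk2⟩ := Finset.mem_filter.1 hk
    have hk0 : k ≠ 0 := fun h => h0 (h ▸ hk1)
    simp only [latticeBox, Finset.mem_erase, Finset.mem_product, Finset.mem_Icc, hk0, ne_eq,
      not_false_eq_true, true_and] at hk2
    omega

/-- The numerical verification on the grid `b = p / 20`, `p = 34, 41, …, 146`. -/
lemma latticeTerm_grid : ∀ i < 17, 10 * 8 ^ 6 * 3 * 160000 * ∑ k ∈ latticeBox, latticeTerm (34 + 7 * i) k
    + 4 * 10 ^ 7 * (34 + 7 * i) ^ 4
      ≤ 24674000 * (27 + 7 * i) * 8 ^ 6 * 3 * 8000 := by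
  -- With p = 34 + 7i this is S/10⁶ + (4/3)(p/20)⁴/8⁶ ≤ (9.8696/4)(p − 7)/20, cleared of
  -- denominators, where S is the sum over the box and 9.8696 is a lower bound for π².
  decide +kernel

/-- The right side belongs to the preceding point (p − 7)/20. With monotonicity in `b` this covers
the whole interval between the two. -/
lemma sum_profile_le_of_mem_grid {p : ℕ} (hp : ∃ i < 17, p = 34 + 7 * i) (K : Finset (ℤ × ℤ))
    (h0 : (0 : ℤ × ℤ) ∉ K) :
    ∑ k ∈ K, profile (p / 20) ((k.1 : ℝ) ^ 2 + (k.2 : ℝ) ^ 2) ≤ Real.pi ^ 2 / 4 * ((p - 7) / 20) := by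
  obtain ⟨i, hi, rfl⟩ := hp
  refine (sum_profile_le_of_nat (by omega) K h0).trans ?_
  have h := latticeTerm_grid i hi
  generalize ∑ k ∈ latticeBox, latticeTerm (34 + 7 * i) k = S at *
  have h' : (10 * 8 ^ 6 * 3 * 160000 * S + 4 * 10 ^ 7 * (34 + 7 * i) ^ 4 : ℝ)
      ≤ 24674000 * (27 + 7 * i) * 8 ^ 6 * 3 * 8000 := by exact_mod_cast h
  have hpi : 9.8696 ≤ Real.pi ^ 2 := by
    have := Real.pi_gt_d6
    nlinarith
  have hpos : (0 : ℝ) ≤ 27 + 7 * i := by positivity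
  have h2 := mul_le_mul_of_nonneg_right hpi hpos
  push_cast
  linarith

/-- The lattice sum for the torus. -/
lemma sum_profile_lattice_le {b : ℝ} (hb : 0 < b) (K : Finset (ℤ × ℤ)) (h0 : (0 : ℤ × ℤ) ∉ K) :
    ∑ k ∈ K, profile b ((k.1 : ℝ) ^ 2 + (k.2 : ℝ) ^ 2) ≤ Real.pi ^ 2 * b / 4 := by
  rcases le_total 7 b with h7 | h7
  · exact sum_profile_lattice_le_of_seven_le h7 K h0
  rcases le_total b (34 / 20) with h1 | h1
  -- Below 34/20 the bound must vanish linearly in `b`. As (34/20)² = 2.89 ≤ 3 and s ≥ 1 off the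
  -- origin, the quotient of the profile by `b` increases there, so the case b = 34/20 suffices.
  · have hg := sum_profile_le_of_mem_grid ⟨0, by norm_num, rfl⟩ K h0
    have hk : ∀ k ∈ K, profile b ((k.1 : ℝ) ^ 2 + (k.2 : ℝ) ^ 2)
        ≤ b * (profile (34 / 20) ((k.1 : ℝ) ^ 2 + (k.2 : ℝ) ^ 2) / (34 / 20)) := by
      intro k hk
      have hs : (1 : ℝ) ≤ (k.1 : ℝ) ^ 2 + (k.2 : ℝ) ^ 2 := by
        have hz : 1 ≤ k.1 ^ 2 + k.2 ^ 2 := by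
          by_contra hlt
          have e1 : k.1 ^ 2 = 0 := by nlinarith [sq_nonneg k.1, sq_nonneg k.2]
          have e2 : k.2 ^ 2 = 0 := by nlinarith [sq_nonneg k.1, sq_nonneg k.2]
          refine h0 ?_
          rwa [show (0 : ℤ × ℤ) = k from Prod.ext (pow_eq_zero_iff two_ne_zero |>.1 e1).symm (pow_eq_zero_iff two_ne_zero |>.1 e2).symm]
        exact_mod_cast hz
      have := profile_div_mono hb h1 (s := (k.1 : ℝ) ^ 2 + (k.2 : ℝ) ^ 2) (by nlinarith)
      rwa [div_le_iff₀' hb] at this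
    refine (Finset.sum_le_sum hk).trans ?_
    rw [← Finset.mul_sum, ← Finset.sum_div]
    norm_num at hg ⊢
    have hpi : 0 < Real.pi ^ 2 := by positivity
    have h2 : (∑ k ∈ K, profile (17 / 10) ((k.1 : ℝ) ^ 2 + (k.2 : ℝ) ^ 2)) / (17 / 10) ≤ Real.pi ^ 2 / 4 := by
      rw [div_le_iff₀ (by norm_num)]
      linarith
    have := mul_le_mul_of_nonneg_left h2 hb.le
    linarith
  · obtain ⟨i, hi, hl, hu⟩ : ∃ i : ℕ, i < 17 ∧ (27 + 7 * i : ℝ) / 20 ≤ b ∧ b ≤ (34 + 7 * i : ℝ) / 20 := by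
      refine ⟨⌊(20 * b - 27) / 7⌋₊, ?_, ?_, ?_⟩
      · rw [Nat.floor_lt' (by norm_num)]
        push_cast
        linarith
      · have := Nat.floor_le (by linarith : 0 ≤ (20 * b - 27) / 7)
        linarith
      · have := Nat.lt_floor_add_one ((20 * b - 27) / 7)
        linarith
    have hg := sum_profile_le_of_mem_grid ⟨i, hi, rfl⟩ K h0
    push_cast at hg
    refine (Finset.sum_le_sum fun k _ => profile_mono_left hb hu).trans (hg.trans ?_)
    have hpi : 0 < Real.pi ^ 2 := by positivity
    nlinarith

end LiebThirring

/-! ### The flat torus -/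

namespace LiebThirring

open Set Filter Topology
open scoped ENNReal

/-- Bessel's inequality in terms of integrals. -/
lemma bessel_integral {M ι : Type*} [MeasurableSpace M] {μ : Measure M} [DecidableEq ι]
    {e : ι → M → ℂ} (he : ∀ k, MemLp (e k) 2 μ)
    (horth : ∀ k l, ∫ x, e k x * (starRingEnd ℂ) (e l x) ∂μ = if k = l then 1 else 0)
    {f : M → ℂ} (hf : MemLp f 2 μ) (K : Finset ι) :
    ∑ k ∈ K, ‖∫ x, f x * (starRingEnd ℂ) (e k x) ∂μ‖ ^ 2 ≤ ∫ x, ‖f x‖ ^ 2 ∂μ := by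
  have h := (orthonormal_toLp he horth).sum_inner_products_le (hf.toLp f) (s := K)
  simp only [inner_toLp] at h
  refine h.trans (le_of_eq ?_)
  have h2 := inner_toLp hf hf
  rw [inner_self_eq_norm_sq_to_K] at h2
  have h3 : ((‖hf.toLp f‖ ^ 2 : ℝ) : ℂ) = ((∫ x, ‖f x‖ ^ 2 ∂μ : ℝ) : ℂ) := by
    rw [← integral_complex_ofReal]
    push_cast
    refine (show ((‖hf.toLp f‖ : ℂ) ^ 2 = _) from h2).trans (integral_congr_ae (ae_of_all _ fun x => ?_))
    exact Complex.mul_conj' _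
  exact_mod_cast h3

section Torus

variable (L : ℝ)

/-- The exponential monomials on the torus. -/
noncomputable def torusMonomial (k : ℤ × ℤ) : C(T2 L, ℂ) where
  toFun x := fourier k.1 (x 0) * fourier k.2 (x 1)
  continuous_toFun := by fun_prop

variable {L}

lemma torusMonomial_apply (k : ℤ × ℤ) (x : T2 L) :
    torusMonomial L k x = fourier k.1 (x 0) * fourier k.2 (x 1) := rfl

lemma torusMonomial_zero : torusMonomial L 0 = 1 := by
  ext x
  simp [torusMonomial_apply]

lemma torusMonomial_add (k l : ℤ × ℤ) :
    torusMonomial L (k + l) = torusMonomial L k * torusMonomial L l := by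
  ext x
  simp only [torusMonomial_apply, ContinuousMap.mul_apply, Prod.fst_add, Prod.snd_add, fourier_add]
  ring

lemma torusMonomial_neg (k : ℤ × ℤ) (x : T2 L) :
    torusMonomial L (-k) x = (starRingEnd ℂ) (torusMonomial L k x) := by
  simp only [torusMonomial_apply, Prod.fst_neg, Prod.snd_neg, fourier_neg, map_mul]

lemma norm_torusMonomial (k : ℤ × ℤ) (x : T2 L) : ‖torusMonomial L k x‖ = 1 := by
  rw [torusMonomial_apply, norm_mul, fourier_apply, fourier_apply, Circle.norm_coe, Circle.norm_coe,
    one_mul]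

lemma integral_fourier [hL : Fact (0 < L)] (n : ℤ) :
    ∫ x : AddCircle L, fourier n x = if n = 0 then (L : ℂ) else 0 := by
  split_ifs with h
  · subst h
    simp [Measure.real, AddCircle.measure_univ, hL.out.le]
  · exact integral_eq_zero_of_add_right_eq_neg (μ := volume) (fourier_add_half_inv_index h hL.out)

lemma integral_torusMonomial [hL : Fact (0 < L)] (k : ℤ × ℤ) :
    ∫ x : T2 L, torusMonomial L k x = if k = 0 then (L : ℂ) ^ 2 else 0 := by
  have h := integral_fintype_prod_volume_eq_prod (𝕜 := ℂ) (E := fun _ : Fin 2 => AddCircle L)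
    (fun i x => fourier (![k.1, k.2] i) x)
  simp only [Fin.prod_univ_two, Matrix.cons_val_zero, Matrix.cons_val_one] at h
  simp only [torusMonomial_apply]
  rw [h, integral_fourier, integral_fourier]
  rcases k with ⟨m, n⟩
  by_cases hm : m = 0 <;> by_cases hn : n = 0 <;> simp [hm, hn, sq]

/-- The linear span of the exponential monomials is dense among the continuous functions. -/
lemma span_torusMonomial_closure [hL : Fact (0 < L)] :
    (Submodule.span ℂ (range (torusMonomial L))).topologicalClosure = ⊤ := by
  let S : StarSubalgebra ℂ C(T2 L, ℂ) :=
    { toSubalgebra := Algebra.adjoin ℂ (range (torusMonomial L))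
      star_mem' := by
        change Algebra.adjoin ℂ (range (torusMonomial L)) ≤ star (Algebra.adjoin ℂ (range (torusMonomial L)))
        refine Algebra.adjoin_le ?_
        rintro _ ⟨n, rfl⟩
        refine Algebra.subset_adjoin ⟨-n, ?_⟩
        ext x
        exact torusMonomial_neg n x }
  have hS : Subalgebra.toSubmodule S.toSubalgebra = Submodule.span ℂ (range (torusMonomial L)) := by
    refine Algebra.adjoin_eq_span_of_subset ℂ ?_
    refine .trans (fun x ↦ Submonoid.closure_induction (fun _ ↦ id) ⟨0, torusMonomial_zero⟩ ?_)
      Submodule.subset_span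
    rintro _ _ _ _ ⟨m, rfl⟩ ⟨n, rfl⟩
    exact ⟨m + n, torusMonomial_add m n⟩
  have hsep : S.SeparatesPoints := by
    intro x y hxy
    rw [Ne, funext_iff, not_forall] at hxy
    obtain ⟨i, hi⟩ := hxy
    fin_cases i
    · refine ⟨_, ⟨torusMonomial L (1, 0), Algebra.subset_adjoin ⟨(1, 0), rfl⟩, rfl⟩, ?_⟩
      simp only [torusMonomial_apply, fourier_zero, mul_one, fourier_one]
      contrapose! hi
      exact AddCircle.injective_toCircle hL.out.ne' (Subtype.coe_injective hi)
    · refine ⟨_, ⟨torusMonomial L (0, 1), Algebra.subset_adjoin ⟨(0, 1), rfl⟩, rfl⟩, ?_⟩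
      simp only [torusMonomial_apply, fourier_zero, one_mul, fourier_one]
      contrapose! hi
      exact AddCircle.injective_toCircle hL.out.ne' (Subtype.coe_injective hi)
  rw [← hS]
  exact congr_arg (Subalgebra.toSubmodule <| StarSubalgebra.toSubalgebra ·)
    (ContinuousMap.starSubalgebra_topologicalClosure_eq_top_of_separatesPoints S hsep)

variable (L) in
/-- The normalised eigenfunctions of the Laplacian on the torus. -/
noncomputable def torusEigen (k : ℤ × ℤ) (x : T2 L) : ℂ := (L : ℂ)⁻¹ * torusMonomial L k x

lemma memLp_torusEigen [Fact (0 < L)] (k : ℤ × ℤ) : MemLp (torusEigen L k) 2 volume :=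
  MemLp.const_mul (MemLp.of_bound (torusMonomial L k).continuous.aestronglyMeasurable 1
    (ae_of_all _ fun x => (norm_torusMonomial k x).le)) _

lemma orthonormal_torusEigen [hL : Fact (0 < L)] (k l : ℤ × ℤ) :
    ∫ x, torusEigen L k x * (starRingEnd ℂ) (torusEigen L l x) = if k = l then 1 else 0 := by
  have h : ∀ x, torusEigen L k x * (starRingEnd ℂ) (torusEigen L l x)
      = ((L : ℂ) ^ 2)⁻¹ * torusMonomial L (k + -l) x := by
    intro x
    rw [torusMonomial_add, ContinuousMap.mul_apply, torusMonomial_neg, torusEigen, torusEigen, map_mul,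
      map_inv₀, Complex.conj_ofReal]
    ring
  have hL0 : (L : ℂ) ≠ 0 := by exact_mod_cast hL.out.ne'
  simp_rw [h]
  rw [integral_const_mul, integral_torusMonomial]
  by_cases hkl : k = l
  · simp [hkl, hL0]
  · rw [if_neg hkl, if_neg (by rwa [← sub_eq_add_neg, sub_eq_zero]), mul_zero]

/-- Uniform density of the trigonometric polynomials is carried to `L²` by the density of the
continuous functions. -/
lemma dense_torusEigen [hL : Fact (0 < L)] :
    ⊤ ≤ (Submodule.span ℂ (range fun k => (memLp_torusEigen (L := L) k).toLp (torusEigen L k))).topologicalClosure := by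
  have h := (ContinuousMap.toLp_denseRange ℂ (volume : Measure (T2 L)) ℂ (p := 2)
    (by norm_num)).topologicalClosure_map_submodule (span_torusMonomial_closure (L := L))
  rw [← h]
  refine Submodule.topologicalClosure_mono ?_
  rw [Submodule.map_span, Submodule.span_le]
  rintro _ ⟨_, ⟨k, rfl⟩, rfl⟩
  have hL0 : (L : ℂ) ≠ 0 := by exact_mod_cast hL.out.ne'
  have : (ContinuousMap.toLp 2 volume ℂ) (torusMonomial L k)
      = (L : ℂ) • (memLp_torusEigen (L := L) k).toLp (torusEigen L k) := by
    refine Lp.ext ?_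
    filter_upwards [ContinuousMap.coeFn_toLp (𝕜 := ℂ) (p := 2) volume (torusMonomial L k),
      Lp.coeFn_smul (L : ℂ) ((memLp_torusEigen (L := L) k).toLp (torusEigen L k)),
      (memLp_torusEigen (L := L) k).coeFn_toLp] with x h1 h2 h3
    rw [h1, h2, Pi.smul_apply, h3, torusEigen, smul_eq_mul, mul_inv_cancel_left₀ hL0]
  change (ContinuousMap.toLp 2 volume ℂ) (torusMonomial L k) ∈ _
  rw [this]
  exact Submodule.smul_mem _ _ (Submodule.subset_span ⟨k, rfl⟩)

lemma isTorusSmooth_torusMonomial (k : ℤ × ℤ) : IsTorusSmooth L (torusMonomial L k) := by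
  unfold IsTorusSmooth
  simp only [torusMonomial_apply, fourier_coe_apply]
  have h : ∀ (n : ℤ) (i : Fin 2), ContDiff ℝ ∞ fun x : Fin 2 → ℝ =>
      Complex.exp (2 * Real.pi * Complex.I * n * (x i : ℝ) / L) := by
    intro n i
    have : ContDiff ℝ ∞ fun x : Fin 2 → ℝ => ((x i : ℝ) : ℂ) :=
      Complex.ofRealCLM.contDiff.comp (contDiff_apply ℝ ℝ i)
    exact ((contDiff_const.mul this).div_const _).cexp
  exact (h _ _).mul (h _ _)

lemma torusPartial_torusMonomial (k : ℤ × ℤ) (i : Fin 2) (x : T2 L) :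
    torusPartial L i (torusMonomial L k) x
      = 2 * Real.pi * Complex.I * (![k.1, k.2] i : ℤ) / L * torusMonomial L k x := by
  have hadd : ∀ (n : ℤ) (y : AddCircle L) (t : ℝ), fourier n (y + (t : AddCircle L))
      = fourier n y * Complex.exp (2 * Real.pi * Complex.I * n * t / L) := by
    intro n y t
    rw [← fourier_coe_apply, fourier_apply, fourier_apply, fourier_apply, smul_add,
      AddCircle.toCircle_add, Circle.coe_mul]
  have hd : ∀ n : ℤ, HasDerivAt (fun t : ℝ => Complex.exp (2 * Real.pi * Complex.I * n * t / L))
      (2 * Real.pi * Complex.I * n / L) 0 := by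
    intro n
    have h1 : HasDerivAt (fun t : ℝ => (2 * Real.pi * Complex.I * n * t / L : ℂ))
        (2 * Real.pi * Complex.I * n / L) 0 := by
      have := ((Complex.ofRealCLM.hasDerivAt (x := (0 : ℝ))).const_mul
        (2 * Real.pi * Complex.I * n : ℂ)).div_const (L : ℂ)
      simpa using this
    simpa using h1.cexp
  unfold torusPartial
  fin_cases i
  · have : (fun t : ℝ => torusMonomial L k (x + Pi.single 0 (t : AddCircle L)))
        = fun t : ℝ => torusMonomial L k x * Complex.exp (2 * Real.pi * Complex.I * k.1 * t / L) := by
      ext t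
      simp only [torusMonomial_apply, Pi.add_apply, Pi.single_eq_same,
        Pi.single_eq_of_ne (one_ne_zero : (1 : Fin 2) ≠ 0), add_zero]
      rw [hadd]
      ring
    simp only [Fin.zero_eta, Fin.isValue, this, ((hd k.1).const_mul _).deriv, Matrix.cons_val_zero]
    ring
  · have : (fun t : ℝ => torusMonomial L k (x + Pi.single 1 (t : AddCircle L)))
        = fun t : ℝ => torusMonomial L k x * Complex.exp (2 * Real.pi * Complex.I * k.2 * t / L) := by
      ext t
      simp only [torusMonomial_apply, Pi.add_apply, Pi.single_eq_same,
        Pi.single_eq_of_ne (zero_ne_one : (0 : Fin 2) ≠ 1), add_zero]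
      rw [hadd]
      ring
    simp only [Fin.mk_one, Fin.isValue, this, ((hd k.2).const_mul _).deriv, Matrix.cons_val_one,
      Matrix.cons_val_fin_one]
    ring

/-- Fourier coefficients of the weak gradient. -/
lemma HasTorusGradient.integral_grad_mul_eigen [hL : Fact (0 < L)] {ψ : T2 L → ℂ}
    {g : T2 L → EuclideanSpace ℂ (Fin 2)} (h : HasTorusGradient L ψ g) (k : ℤ × ℤ) (i : Fin 2) :
    ∫ x, g x i * (starRingEnd ℂ) (torusEigen L k x)
      = 2 * Real.pi * Complex.I * (![k.1, k.2] i : ℤ) / L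
        * ∫ x, ψ x * (starRingEnd ℂ) (torusEigen L k x) := by
  have h1 := h.integral_partial (torusMonomial L (-k)) (isTorusSmooth_torusMonomial _) i
  have h2 : ∀ x, (starRingEnd ℂ) (torusEigen L k x) = (L : ℂ)⁻¹ * torusMonomial L (-k) x := by
    intro x
    rw [torusMonomial_neg, torusEigen, map_mul, map_inv₀, Complex.conj_ofReal]
  have h3 : ∀ x, ψ x * torusPartial L i (torusMonomial L (-k)) x
      = (-(2 * Real.pi * Complex.I * (![k.1, k.2] i : ℤ) / L)) * (ψ x * torusMonomial L (-k) x) := by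
    intro x
    rw [torusPartial_torusMonomial]
    have : (![(-k).1, (-k).2] i : ℤ) = -(![k.1, k.2] i : ℤ) := by fin_cases i <;> simp
    rw [this]
    push_cast
    ring
  simp_rw [h3] at h1
  rw [integral_const_mul, neg_mul, neg_inj] at h1
  simp_rw [h2, mul_left_comm _ ((L : ℂ)⁻¹)]
  rw [integral_const_mul, integral_const_mul, ← h1]
  ring

/-- The Lieb–Thirring inequality on the torus. -/
theorem lieb_thirring_torus [hL : Fact (0 < L)] {N : ℕ} {ψ : Fin N → T2 L → ℂ}
    {g : Fin N → T2 L → EuclideanSpace ℂ (Fin 2)} (hg : ∀ j, HasTorusGradient L (ψ j) (g j))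
    (hmean : ∀ j, ∫ x, ψ j x = 0) (hort : IsL2Orthonormal volume ψ) :
    Integrable (fun x => density ψ x ^ 2) volume ∧
      ∫ x, density ψ x ^ 2 ≤ 3 * Real.pi / 32 * ∑ j : Fin N, ∫ x, ‖g j x‖ ^ 2 := by
  have hL0 : 0 < L := hL.out
  refine lieb_thirring_of_eigenbasis (e := torusEigen L) memLp_torusEigen orthonormal_torusEigen dense_torusEigen
    (p := fun k => k ≠ 0) (lam := fun k => 4 * Real.pi ^ 2 / L ^ 2 * ((k.1 : ℝ) ^ 2 + (k.2 : ℝ) ^ 2))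
    ?_ ?_ (fun j => (hg j).memLp) hort ?_ ?_
  · intro k hk
    have : 0 < (k.1 : ℝ) ^ 2 + (k.2 : ℝ) ^ 2 := by
      by_contra hlt
      have e1 : (k.1 : ℝ) ^ 2 = 0 := by nlinarith [sq_nonneg (k.1 : ℝ), sq_nonneg (k.2 : ℝ)]
      have e2 : (k.2 : ℝ) ^ 2 = 0 := by nlinarith [sq_nonneg (k.1 : ℝ), sq_nonneg (k.2 : ℝ)]
      refine hk (Prod.ext ?_ ?_)
      · simpa using e1
      · simpa using e2
    have := Real.pi_pos
    positivity
  · intro K hK a ha x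
    have hpi := Real.pi_pos
    set κ : ℝ := 4 * Real.pi ^ 2 / L ^ 2 with hκ
    have hκ0 : 0 < κ := by positivity
    have h1 : ∀ k : ℤ × ℤ, (a ^ 2 / ((κ * ((k.1 : ℝ) ^ 2 + (k.2 : ℝ) ^ 2)) ^ 2 + a ^ 2)) ^ 2
        * ‖torusEigen L k x‖ ^ 2 = (L ^ 2)⁻¹ * profile (a / κ) ((k.1 : ℝ) ^ 2 + (k.2 : ℝ) ^ 2) := by
      intro k
      rw [torusEigen, norm_mul, norm_torusMonomial, norm_inv, Complex.norm_real, Real.norm_of_nonneg hL0.le]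
      unfold profile
      generalize (k.1 : ℝ) ^ 2 + (k.2 : ℝ) ^ 2 = s
      field_simp
      ring
    simp_rw [h1]
    rw [← Finset.mul_sum]
    -- The side length drops out: L⁻² · (π²/4) · a/κ = a/16 for κ = 4π²/L².
    have h2 := sum_profile_lattice_le (b := a / κ) (by positivity) K (fun h0 => hK 0 h0 rfl)
    refine (mul_le_mul_of_nonneg_left h2 (by positivity)).trans (le_of_eq ?_)
    rw [hκ]
    field_simp
    norm_num
  · intro j k hk
    have hk0 : k = 0 := by simpa using hk
    subst hk0
    simp only [torusEigen, torusMonomial_zero, ContinuousMap.one_apply, mul_one]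
    rw [integral_mul_const, hmean, zero_mul]
  -- The squared moduli of the multipliers 2πi kᵢ/L add up to the eigenvalue, so Bessel's inequality
  -- for each component of the gradient gives the energy bound.
  · intro K _ j
    have hgi : ∀ i, MemLp (fun x => g j x i) 2 volume := fun i =>
      (EuclideanSpace.proj (𝕜 := ℂ) i).comp_memLp' (hg j).memLp_grad
    have h1 : ∫ x, ‖g j x‖ ^ 2 = ∑ i, ∫ x, ‖g j x i‖ ^ 2 := by
      rw [← integral_finsetSum _ fun i _ => (hgi i).integrable_norm_pow (by norm_num)]
      refine integral_congr_ae (ae_of_all _ fun x => ?_)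
      exact EuclideanSpace.norm_sq_eq _
    rw [h1]
    have h2 := fun i => bessel_integral memLp_torusEigen orthonormal_torusEigen (hgi i) K
    refine le_trans (le_of_eq ?_) (Finset.sum_le_sum fun i (_ : i ∈ Finset.univ) => h2 i)
    rw [Finset.sum_comm]
    refine Finset.sum_congr rfl fun k _ => ?_
    simp only [(hg j).integral_grad_mul_eigen, norm_mul, mul_pow, ← Finset.sum_mul]
    congr 1
    simp [Fin.sum_univ_two, abs_of_pos Real.pi_pos, abs_of_pos hL0]
    field_simp
    simp only [sq_abs]
    ring

end Torus

end LiebThirring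

/-! ### Polynomials on the sphere and the angular Laplacian -/

namespace LiebThirring

open Set Filter Topology
open scoped ENNReal

section Polynomials

open MvPolynomial

/-- Complex polynomials in three variables. -/
abbrev Poly : Type := MvPolynomial (Fin 3) ℂ

/-- Polynomials of degree less than `n`. -/
noncomputable def lowDeg (n : ℕ) : Submodule ℂ Poly :=
  Submodule.span ℂ {p | ∃ m < n, p.IsHomogeneous m}

/-- The value of a complex polynomial at a real point. -/
noncomputable def polyVal (p : Poly) (x : E3) : ℂ := eval (fun i => ((x i : ℝ) : ℂ)) p

/-- The restriction of a polynomial to the sphere. -/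
noncomputable def spherePoly : Poly →ₐ[ℂ] C(S2, ℂ) :=
  aeval fun i => ⟨fun x : S2 => (((x : E3) i : ℝ) : ℂ), by fun_prop⟩

/-- The coefficientwise complex conjugate. -/
noncomputable def polyConj : Poly →+* Poly := MvPolynomial.map (starRingEnd ℂ)

/-- The generator of the rotations around the `i`-th axis. -/
noncomputable def rotDeriv (i : Fin 3) : Derivation ℂ Poly Poly :=
  (X (i + 1) : Poly) • pderiv (i + 2) - (X (i + 2) : Poly) • pderiv (i + 1)

lemma rotDeriv_apply (i : Fin 3) (p : Poly) :
    rotDeriv i p = X (i + 1) * pderiv (i + 2) p - X (i + 2) * pderiv (i + 1) p := rfl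

/-- The angular Laplacian. -/
noncomputable def angLaplace (p : Poly) : Poly := ∑ i, rotDeriv i (rotDeriv i p)

lemma polyVal_X (i : Fin 3) (x : E3) : polyVal (X i) x = ((x i : ℝ) : ℂ) := by simp [polyVal]
lemma polyVal_C (c : ℂ) (x : E3) : polyVal (C c) x = c := by simp [polyVal]
lemma polyVal_add (p q : Poly) (x : E3) : polyVal (p + q) x = polyVal p x + polyVal q x := by
  simp [polyVal]
lemma polyVal_mul (p q : Poly) (x : E3) : polyVal (p * q) x = polyVal p x * polyVal q x := by
  simp [polyVal]

lemma spherePoly_apply (p : Poly) (x : S2) : spherePoly p x = polyVal p x := by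
  induction p using MvPolynomial.induction_on with
  | C c => exact (DFunLike.congr_fun (spherePoly.commutes c) x).trans (polyVal_C c _).symm
  | add p q hp hq => rw [map_add, ContinuousMap.add_apply, hp, hq, polyVal_add]
  | mul_X p i hp =>
    rw [map_mul, ContinuousMap.mul_apply, hp, polyVal_mul, polyVal_X]
    simp [spherePoly]

lemma polyVal_polyConj (p : Poly) (x : E3) :
    polyVal (polyConj p) x = (starRingEnd ℂ) (polyVal p x) := by
  induction p using MvPolynomial.induction_on with
  | C c => simp [polyConj, polyVal]
  | add p q hp hq => rw [map_add, polyVal_add, hp, hq, polyVal_add, map_add]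
  | mul_X p i hp =>
    rw [map_mul, polyVal_mul, hp, polyVal_mul, map_mul]
    congr 1
    simp [polyConj, polyVal]

lemma rotDeriv_polyConj (i : Fin 3) (p : Poly) :
    rotDeriv i (polyConj p) = polyConj (rotDeriv i p) := by
  simp only [rotDeriv_apply, polyConj, map_sub, map_mul, map_X, pderiv_map]

lemma pderiv_pderiv_comm (i j : Fin 3) (p : Poly) :
    pderiv i (pderiv j p) = pderiv j (pderiv i p) := by
  have h : ⁅(pderiv i : Derivation ℂ Poly Poly), (pderiv j : Derivation ℂ Poly Poly)⁆ = 0 := by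
    refine MvPolynomial.derivation_ext fun k => ?_
    rw [Derivation.commutator_apply, pderiv_X, pderiv_X]
    simp only [Pi.single_apply]
    split_ifs <;> simp
  have := DFunLike.congr_fun h p
  rwa [Derivation.commutator_apply, Derivation.zero_apply, sub_eq_zero] at this

/-- The sum of the squared rotation generators is |x|²Δ − E² − E with the Euler operator E = Σ xᵢ∂ᵢ,
which acts as n on homogeneous polynomials of degree n. -/
lemma angLaplace_eq {n : ℕ} {p : Poly} (hp : p.IsHomogeneous n) :
    angLaplace p = (∑ i, X i ^ 2) * (∑ i, pderiv i (pderiv i p)) - (n * (n + 1) : ℂ) • p := by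
  have h1 := hp.sum_X_mul_pderiv
  have h2 := congrArg (fun q : Poly => ∑ i : Fin 3, X i * pderiv i q) h1
  simp only [nsmul_eq_mul, Derivation.leibniz, Derivation.map_natCast, smul_zero, add_zero] at h2
  have e : ∑ i : Fin 3, (X i : Poly) * ((n : Poly) • pderiv i p) = (n : Poly) * ((n : Poly) * p) := by
    rw [← nsmul_eq_mul n p, ← h1, Finset.mul_sum]
    simp only [smul_eq_mul, mul_left_comm]
  rw [e] at h2
  have e2 : (n * (n + 1) : ℂ) • p = (n : Poly) * ((n : Poly) * p) + (n : Poly) * p := by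
    rw [MvPolynomial.smul_eq_C_mul]
    simp
    ring
  rw [e2, ← h2, ← nsmul_eq_mul, ← h1]
  have f1 : (1 : Fin 3) + 1 = 2 := rfl
  have f2 : (1 : Fin 3) + 2 = 0 := rfl
  have f3 : (2 : Fin 3) + 1 = 0 := rfl
  have f4 : (2 : Fin 3) + 2 = 1 := rfl
  simp only [angLaplace, rotDeriv_apply, Fin.sum_univ_three, map_sub, map_add, Derivation.leibniz, smul_eq_mul,
    pderiv_X, Pi.single_apply, f1, f2, f3, f4, zero_add, pderiv_pderiv_comm 1 0, pderiv_pderiv_comm 2 0,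
    pderiv_pderiv_comm 2 1, Fin.reduceEq, if_true, if_false]
  ring

lemma mem_lowDeg {m n : ℕ} {p : Poly} (hp : p.IsHomogeneous m) (h : m < n) : p ∈ lowDeg n :=
  Submodule.subset_span ⟨m, h, hp⟩

lemma lowDeg_mono {m n : ℕ} (h : m ≤ n) : lowDeg m ≤ lowDeg n :=
  Submodule.span_mono fun _ ⟨k, hk, hp⟩ => ⟨k, hk.trans_le h, hp⟩

lemma lowDeg_zero : lowDeg 0 = ⊥ := by simp [lowDeg]

lemma exists_mem_lowDeg (p : Poly) : ∃ n, p ∈ lowDeg n := by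
  refine ⟨p.totalDegree + 1, ?_⟩
  nth_rw 2 [← sum_homogeneousComponent p]
  exact Submodule.sum_mem _ fun i hi =>
    mem_lowDeg (homogeneousComponent_isHomogeneous i p) (Finset.mem_range.1 hi)

/-- A linear map preserves a degree bound if it does so on homogeneous polynomials. -/
lemma lowDeg_induction {n : ℕ} {V : Submodule ℂ Poly} (f : Poly →ₗ[ℂ] Poly)
    (h : ∀ m < n, ∀ p : Poly, p.IsHomogeneous m → f p ∈ V) {p : Poly} (hp : p ∈ lowDeg n) :
    f p ∈ V := by
  have : lowDeg n ≤ V.comap f := Submodule.span_le.2 fun p ⟨m, hm, hp⟩ => h m hm p hp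
  exact this hp

lemma rotDeriv_isHomogeneous (i : Fin 3) {m : ℕ} {p : Poly} (hp : p.IsHomogeneous m) :
    (rotDeriv i p).IsHomogeneous m := by
  rcases Nat.eq_zero_or_pos m with rfl | hm
  · obtain ⟨c, rfl⟩ : ∃ c, p = C c := by
      rw [← totalDegree_zero_iff_isHomogeneous, totalDegree_eq_zero_iff_eq_C] at hp
      exact ⟨_, hp⟩
    rw [rotDeriv_apply, pderiv_C, pderiv_C, mul_zero, mul_zero, sub_zero]
    exact isHomogeneous_zero _ _ _
  · have e : 1 + (m - 1) = m := by omega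
    have h : ∀ k l : Fin 3, (X k * pderiv l p : Poly).IsHomogeneous m := fun k l => by
      have := (isHomogeneous_X ℂ k).mul (hp.pderiv (i := l))
      rwa [e] at this
    exact (h _ _).sub (h _ _)

lemma rotDeriv_mem_lowDeg (i : Fin 3) {n : ℕ} {p : Poly} (hp : p ∈ lowDeg n) :
    rotDeriv i p ∈ lowDeg n :=
  lowDeg_induction (rotDeriv i : Poly →ₗ[ℂ] Poly)
    (fun _ hm _ hq => mem_lowDeg (rotDeriv_isHomogeneous i hq) hm) hp

lemma sum_sq_sphere (x : S2) : ∑ i, (x : E3) i ^ 2 = 1 := by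
  have h : ‖(x : E3)‖ = 1 := by simp
  rw [← EuclideanSpace.real_norm_sq_eq, h, one_pow]

lemma spherePoly_radius : spherePoly (∑ i, X i ^ 2) = 1 := by
  ext x
  rw [spherePoly_apply]
  have h := sum_sq_sphere x
  simp only [polyVal, map_sum, map_pow, eval_X, ContinuousMap.one_apply]
  exact_mod_cast h

/-- Modulo lower degree the angular Laplacian acts on polynomials of degree `n` on the sphere as
multiplication by `-n(n+1)`. -/
lemma exists_spherePoly_angLaplace {n : ℕ} {p : Poly} (hp : p ∈ lowDeg (n + 1)) :
    ∃ q ∈ lowDeg n, spherePoly (angLaplace p + (n * (n + 1) : ℂ) • p) = spherePoly q := by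
  let D : Poly →ₗ[ℂ] Poly := ∑ i, (rotDeriv i : Poly →ₗ[ℂ] Poly) ∘ₗ (rotDeriv i : Poly →ₗ[ℂ] Poly)
  have hD : ∀ p, D p = angLaplace p := fun p => by
    simp [D, angLaplace]
  let F : Poly →ₗ[ℂ] C(S2, ℂ) := spherePoly.toLinearMap ∘ₗ (D + (n * (n + 1) : ℂ) • LinearMap.id)
  have hF : ∀ p, F p = spherePoly (angLaplace p + (n * (n + 1) : ℂ) • p) := fun p => by
    simp [F, hD]
  have : lowDeg (n + 1) ≤ ((lowDeg n).map spherePoly.toLinearMap).comap F := by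
    refine Submodule.span_le.2 ?_
    rintro p ⟨m, hm, hp⟩
    change F p ∈ (lowDeg n).map spherePoly.toLinearMap
    -- On the sphere |x|² = 1, so only Δp, which has lower degree, and a multiple of p remain; the
    -- multiple vanishes for m = n.
    have h1 : F p = spherePoly (∑ i, pderiv i (pderiv i p)) + (n * (n + 1) - m * (m + 1) : ℂ) • spherePoly p := by
      rw [hF, angLaplace_eq hp, map_add, map_sub, map_mul, spherePoly_radius, one_mul, map_smul, map_smul]
      module
    rw [h1]
    have h2 : (∑ i, pderiv i (pderiv i p) : Poly) ∈ lowDeg n := by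
      rcases Nat.eq_zero_or_pos m with rfl | hm0
      · obtain ⟨c, rfl⟩ : ∃ c, p = C c := by
          rw [← totalDegree_zero_iff_isHomogeneous, totalDegree_eq_zero_iff_eq_C] at hp
          exact ⟨_, hp⟩
        simp
      · exact Submodule.sum_mem _ fun i _ => mem_lowDeg (hp.pderiv.pderiv) (by omega)
    refine add_mem ⟨_, h2, rfl⟩ ?_
    rcases (Nat.lt_succ_iff.1 hm).eq_or_lt with rfl | hlt
    · rw [sub_self, show (0 : ℂ) • spherePoly p = 0 from zero_smul ℂ (spherePoly p)]
      exact zero_mem _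
    · exact Submodule.smul_mem _ _ ⟨p, mem_lowDeg hp hlt, rfl⟩
  obtain ⟨q, hq, e⟩ := this hp
  exact ⟨q, hq, by rw [← hF]; exact e.symm⟩

/-- The linear substitution of variables by a linear map. -/
noncomputable def polySubst (φ : E3 →ₗ[ℝ] E3) : Poly →ₐ[ℂ] Poly :=
  aeval fun i => ∑ j, C ((φ (EuclideanSpace.single j 1) i : ℝ) : ℂ) * X j

lemma polyVal_polySubst (φ : E3 →ₗ[ℝ] E3) (p : Poly) (x : E3) :
    polyVal (polySubst φ p) x = polyVal p (φ x) := by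
  induction p using MvPolynomial.induction_on with
  | C c => rw [polyVal_C, ← algebraMap_eq, AlgHom.commutes, algebraMap_eq, polyVal_C]
  | add p q hp hq => rw [map_add, polyVal_add, hp, hq, polyVal_add]
  | mul_X p i hp =>
    rw [map_mul, polyVal_mul, hp, polyVal_mul, polyVal_X]
    congr 1
    have hx : x = ∑ j, x j • EuclideanSpace.single j (1 : ℝ) := by
      ext k
      simp [Finset.sum_apply, Pi.single_apply]
    have : φ x i = ∑ j, x j * φ (EuclideanSpace.single j 1) i := by
      conv_lhs => rw [hx, map_sum]
      simp
    rw [this]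
    simp [polySubst, polyVal, mul_comm]

lemma polySubst_mem_lowDeg (φ : E3 →ₗ[ℝ] E3) {n : ℕ} {p : Poly} (hp : p ∈ lowDeg n) :
    polySubst φ p ∈ lowDeg n := by
  refine lowDeg_induction (polySubst φ).toLinearMap (fun m hm q hq => ?_) hp
  have : (polySubst φ q).IsHomogeneous (1 * m) :=
    hq.aeval _ fun i => IsHomogeneous.sum _ _ _ fun j _ => isHomogeneous_C_mul_X _ _
  rw [one_mul] at this
  exact mem_lowDeg this hm

/-- Modulo lower degree, on the sphere the polynomials of degree `n` are spanned by `2n+1` monomials. -/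
lemma spherePoly_mem_sup {n : ℕ} {p : Poly} (hp : p ∈ lowDeg (n + 1)) :
    spherePoly p ∈ (lowDeg n).map spherePoly.toLinearMap ⊔ Submodule.span ℂ
      ((fun q : Poly => spherePoly q) '' ((Finset.range (n + 1)).image
          (fun a => (X 0 ^ a * X 1 ^ (n - a) : Poly)) ∪
        (Finset.range n).image (fun a => (X 0 ^ a * X 1 ^ (n - 1 - a) * X 2 : Poly)) : Finset Poly)) := by
  set V := (lowDeg n).map spherePoly.toLinearMap ⊔ Submodule.span ℂ
      ((fun q : Poly => spherePoly q) '' ((Finset.range (n + 1)).image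
          (fun a => (X 0 ^ a * X 1 ^ (n - a) : Poly)) ∪
        (Finset.range n).image (fun a => (X 0 ^ a * X 1 ^ (n - 1 - a) * X 2 : Poly)) : Finset Poly)) with hV
  have hhom : ∀ a b c : ℕ, (X 0 ^ a * X 1 ^ b * X 2 ^ c : Poly).IsHomogeneous (a + b + c) := fun a b c =>
    ((isHomogeneous_X_pow _ _).mul (isHomogeneous_X_pow _ _)).mul (isHomogeneous_X_pow _ _)
  have hlow : ∀ a b c : ℕ, a + b + c < n → spherePoly (X 0 ^ a * X 1 ^ b * X 2 ^ c : Poly) ∈ V :=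
    fun a b c h => Submodule.mem_sup_left ⟨_, mem_lowDeg (hhom a b c) h, rfl⟩
  -- The relation x₂² = 1 − x₀² − x₁² on the sphere lowers the exponent of x₂ to 0 or 1, leaving (n
  -- + 1) + n monomials of top degree.
  have key : ∀ c a b : ℕ, a + b + c ≤ n → spherePoly (X 0 ^ a * X 1 ^ b * X 2 ^ c : Poly) ∈ V := by
    intro c
    induction c using Nat.strong_induction_on with
    | _ c ih =>
      intro a b h
      rcases h.lt_or_eq with h | h
      · exact hlow a b c h
      match c, ih, h with
      | 0, _, h =>
        refine Submodule.mem_sup_right (Submodule.subset_span ⟨_, ?_, rfl⟩)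
        rw [Finset.mem_coe, Finset.mem_union]
        left
        rw [Finset.mem_image]
        exact ⟨a, Finset.mem_range.2 (by omega), by rw [show n - a = b by omega]; simp⟩
      | 1, _, h =>
        refine Submodule.mem_sup_right (Submodule.subset_span ⟨_, ?_, rfl⟩)
        rw [Finset.mem_coe, Finset.mem_union]
        right
        rw [Finset.mem_image]
        exact ⟨a, Finset.mem_range.2 (by omega), by rw [show n - 1 - a = b by omega]; simp⟩
      | c + 2, ih, h =>
        have e : (X 0 ^ a * X 1 ^ b * X 2 ^ (c + 2) : Poly)
            = X 0 ^ a * X 1 ^ b * X 2 ^ c * (∑ i, X i ^ 2) - X 0 ^ (a + 2) * X 1 ^ b * X 2 ^ c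
              - X 0 ^ a * X 1 ^ (b + 2) * X 2 ^ c := by
          rw [Fin.sum_univ_three]
          ring
        rw [e, map_sub, map_sub, map_mul _ _ (∑ i, X i ^ 2), spherePoly_radius, mul_one]
        exact sub_mem (sub_mem (ih c (by omega) a b (by omega)) (ih c (by omega) (a + 2) b (by omega)))
          (ih c (by omega) a (b + 2) (by omega))
  have : lowDeg (n + 1) ≤ V.comap spherePoly.toLinearMap := by
    refine Submodule.span_le.2 ?_
    rintro p ⟨m, hm, hp⟩
    change spherePoly p ∈ V
    rw [p.as_sum, map_sum]
    refine Submodule.sum_mem _ fun s hs => ?_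
    have hd : s.degree = m := (hp.degree_eq_sum_deg_support hs).symm
    rw [monomial_eq, map_mul, ← algebraMap_eq, AlgHom.commutes, ← Algebra.smul_def]
    refine Submodule.smul_mem _ _ ?_
    rw [Finsupp.prod_fintype _ _ (by simp), Fin.prod_univ_three]
    refine key _ _ _ ?_
    have : s.degree = s 0 + s 1 + s 2 := by
      rw [Finsupp.degree_eq_sum, Fin.sum_univ_three]
    omega
  exact this hp

end Polynomials

end LiebThirring

/-! ### Rotations and integration by parts -/

namespace LiebThirring

open Set Filter Topology
open scoped ENNReal

section Rotations

open MvPolynomial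

lemma polyVal_C_eq_const (c : ℂ) : polyVal (C c) = fun _ => c := by
  ext y
  rw [polyVal_C]

lemma hasFDerivAt_polyVal (p : Poly) (x : E3) :
    HasFDerivAt (polyVal p)
      (∑ j : Fin 3, (Complex.ofRealCLM.comp (EuclideanSpace.proj (𝕜 := ℝ) j)).smulRight
        (polyVal (pderiv j p) x)) x := by
  induction p using MvPolynomial.induction_on with
  | C c =>
    rw [polyVal_C_eq_const]
    convert hasFDerivAt_const c x
    simp [polyVal]
  | add p q hp hq =>
    have : polyVal (p + q) = fun y => polyVal p y + polyVal q y := by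
      ext y
      rw [polyVal_add]
    rw [this]
    refine (hp.add hq).congr_fderiv ?_
    ext v
    simp [polyVal_add, Finset.sum_add_distrib, mul_add]
  | mul_X p i hp =>
    have : polyVal (p * X i) = fun y => polyVal p y * ((y i : ℝ) : ℂ) := by
      ext y
      rw [polyVal_mul, polyVal_X]
    rw [this]
    have hX : HasFDerivAt (fun y : E3 => ((y i : ℝ) : ℂ))
        (Complex.ofRealCLM.comp (EuclideanSpace.proj (𝕜 := ℝ) i)) x :=
      (Complex.ofRealCLM.comp (EuclideanSpace.proj (𝕜 := ℝ) i)).hasFDerivAt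
    refine (hp.mul hX).congr_fderiv ?_
    ext v
    simp only [Derivation.leibniz, smul_eq_mul, polyVal_add, polyVal_mul, polyVal_X, pderiv_X]
    fin_cases i <;>
    simp [Fin.sum_univ_three, polyVal] <;> ring

lemma contDiff_polyVal (p : Poly) : ContDiff ℝ ∞ (polyVal p) := by
  induction p using MvPolynomial.induction_on with
  | C c =>
    rw [polyVal_C_eq_const]
    exact contDiff_const
  | add p q hp hq =>
    have : polyVal (p + q) = fun y => polyVal p y + polyVal q y := by
      ext y
      rw [polyVal_add]
    rw [this]
    exact hp.add hq
  | mul_X p i hp =>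
    have : polyVal (p * X i) = fun y => polyVal p y * ((y i : ℝ) : ℂ) := by
      ext y
      rw [polyVal_mul, polyVal_X]
    rw [this]
    exact hp.mul (Complex.ofRealCLM.comp (EuclideanSpace.proj (𝕜 := ℝ) i)).contDiff

/-- The velocity field of the rotation around the `i`-th axis. -/
noncomputable def axisField (i : Fin 3) : E3 →L[ℝ] E3 :=
  (EuclideanSpace.proj (𝕜 := ℝ) (i + 1)).smulRight (EuclideanSpace.single (i + 2) (1 : ℝ))
    - (EuclideanSpace.proj (𝕜 := ℝ) (i + 2)).smulRight (EuclideanSpace.single (i + 1) (1 : ℝ))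

lemma axisField_apply (i j : Fin 3) (x : E3) :
    axisField i x j = x (i + 1) * (if j = i + 2 then 1 else 0) - x (i + 2) * (if j = i + 1 then 1 else 0) := by
  simp [axisField]

/-- The rotation around the `i`-th axis with cosine `c` and sine `s`. -/
noncomputable def axisRotation (i : Fin 3) (c s : ℝ) : E3 →ₗ[ℝ] E3 :=
  LinearMap.id + (c - 1) • (LinearMap.id - (EuclideanSpace.proj (𝕜 := ℝ) i).toLinearMap.smulRight
    (EuclideanSpace.single i (1 : ℝ))) + s • (axisField i).toLinearMap

lemma axisRotation_apply (i j : Fin 3) (c s : ℝ) (x : E3) :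
    axisRotation i c s x j
      = x j + (c - 1) * (x j - x i * (if j = i then 1 else 0)) + s * axisField i x j := by
  simp [axisRotation]

lemma norm_axisRotation (i : Fin 3) (t : ℝ) (x : E3) :
    ‖axisRotation i (Real.cos t) (Real.sin t) x‖ = ‖x‖ := by
  have h : ‖axisRotation i (Real.cos t) (Real.sin t) x‖ ^ 2 = ‖x‖ ^ 2 := by
    rw [EuclideanSpace.real_norm_sq_eq, EuclideanSpace.real_norm_sq_eq]
    simp only [axisRotation_apply, axisField_apply, Fin.sum_univ_three]
    have hcs := Real.sin_sq_add_cos_sq t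
    fin_cases i
    · simp
      linear_combination (x 1 ^ 2 + x 2 ^ 2) * hcs
    · simp
      linear_combination (x 0 ^ 2 + x 2 ^ 2) * hcs
    · simp
      linear_combination (x 0 ^ 2 + x 1 ^ 2) * hcs
  exact (sq_eq_sq₀ (norm_nonneg _) (norm_nonneg _)).1 h

/-- The rotations are the flow of their velocity field, so differentiation along them at any time is
the action of `rotDeriv`. -/
lemma hasDerivAt_axisRotation (i : Fin 3) (t : ℝ) (x : E3) :
    HasDerivAt (fun t => axisRotation i (Real.cos t) (Real.sin t) x)
      (axisField i (axisRotation i (Real.cos t) (Real.sin t) x)) t := by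
  have h : HasDerivAt (fun t => axisRotation i (Real.cos t) (Real.sin t) x)
      ((-Real.sin t) • (x - (x i) • EuclideanSpace.single i (1 : ℝ)) + Real.cos t • axisField i x) t := by
    have := ((((Real.hasDerivAt_cos t).sub_const 1).smul_const
      (x - (x i) • EuclideanSpace.single i (1 : ℝ))).const_add x).add
      ((Real.hasDerivAt_sin t).smul_const (axisField i x))
    exact this
  convert h using 1
  ext j
  rw [axisField_apply]
  simp only [axisRotation_apply, axisField_apply]
  fin_cases i <;> fin_cases j <;> simp [axisField_apply] <;> ring

/-- A linear isometry acting on the sphere. -/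
noncomputable def sphereMap (φ : E3 ≃ₗᵢ[ℝ] E3) (x : S2) : S2 :=
  ⟨φ x, by rw [mem_sphere_zero_iff_norm, φ.norm_map]; exact mem_sphere_zero_iff_norm.1 x.2⟩

lemma continuous_sphereMap (φ : E3 ≃ₗᵢ[ℝ] E3) : Continuous (sphereMap φ) :=
  (φ.continuous.comp continuous_subtype_val).subtype_mk _

instance : IsFiniteMeasure surf := by unfold surf; infer_instance

instance : surf.IsOpenPosMeasure := by unfold surf; infer_instance

-- The surface measure of a set is, up to a factor, the volume of the cone over it, and a linear
-- isometry maps cones to cones and preserves volume.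
open scoped Pointwise in
lemma measurePreserving_sphereMap (φ : E3 ≃ₗᵢ[ℝ] E3) :
    MeasurePreserving (sphereMap φ) surf surf := by
  refine ⟨(continuous_sphereMap φ).measurable, ?_⟩
  ext s hs
  rw [Measure.map_apply (continuous_sphereMap φ).measurable hs, surf,
    Measure.toSphere_apply' _ hs, Measure.toSphere_apply' _ ((continuous_sphereMap φ).measurable hs)]
  congr 1
  have hset : Ioo (0 : ℝ) 1 • ((↑) '' (sphereMap φ ⁻¹' s) : Set E3)
      = φ ⁻¹' (Ioo (0 : ℝ) 1 • ((↑) '' s : Set E3)) := by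
    ext y
    simp only [Set.mem_smul, Set.mem_preimage, Set.mem_image]
    constructor
    · rintro ⟨r, hr, _, ⟨x, hx, rfl⟩, rfl⟩
      exact ⟨r, hr, _, ⟨_, hx, rfl⟩, by rw [map_smul]; rfl⟩
    · rintro ⟨r, hr, _, ⟨x, hx, rfl⟩, h⟩
      have hsymm : sphereMap φ (sphereMap φ.symm x) = x := by
        ext1; exact φ.apply_symm_apply _
      refine ⟨r, hr, _, ⟨sphereMap φ.symm x, Set.mem_preimage.2 (by rwa [hsymm]), rfl⟩, ?_⟩
      change r • φ.symm x = y
      rw [← map_smul, h, φ.symm_apply_apply]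
  rw [hset]
  exact φ.measurePreserving.measure_preimage_emb φ.toHomeomorph.measurableEmbedding _

lemma integral_comp_sphereMap (φ : E3 ≃ₗᵢ[ℝ] E3) (f : C(S2, ℂ)) :
    ∫ x, f (sphereMap φ x) ∂surf = ∫ x, f x ∂surf := by
  have h := (measurePreserving_sphereMap φ).map_eq
  conv_rhs => rw [← h]
  rw [integral_map (continuous_sphereMap φ).measurable.aemeasurable f.continuous.aestronglyMeasurable]

lemma polyVal_rotDeriv (i : Fin 3) (p : Poly) (x : E3) :
    polyVal (rotDeriv i p) x = ∑ j, ((axisField i x j : ℝ) : ℂ) * polyVal (pderiv j p) x := by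
  simp only [axisField_apply, Fin.sum_univ_three]
  fin_cases i <;> simp [rotDeriv_apply, polyVal] <;> ring

/-- The integral of a rotated polynomial does not depend on the angle; its derivative in the angle,
taken under the integral sign, is the integral in question. -/
lemma integral_rotDeriv (i : Fin 3) (p : Poly) : ∫ x, polyVal (rotDeriv i p) x ∂surf = 0 := by
  let R : ℝ → E3 ≃ₗᵢ[ℝ] E3 := fun t =>
    LinearIsometry.toLinearIsometryEquiv ⟨axisRotation i (Real.cos t) (Real.sin t), norm_axisRotation i t⟩ rfl
  have hR : ∀ t x, R t x = axisRotation i (Real.cos t) (Real.sin t) x := fun t x => rfl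
  have hint : ∀ (q : Poly) (t : ℝ), ∫ x : S2, polyVal q (R t x) ∂surf = ∫ x : S2, polyVal q x ∂surf := by
    intro q t
    have := integral_comp_sphereMap (R t) (spherePoly q)
    simp only [spherePoly_apply] at this
    exact this
  have hcont : ∀ (q : Poly) (t : ℝ), Continuous fun x : S2 => polyVal q (R t x) := fun q t =>
    (contDiff_polyVal q).continuous.comp ((R t).continuous.comp continuous_subtype_val)
  have hd := hasDerivAt_integral_of_dominated_loc_of_deriv_le (μ := surf) (x₀ := (0 : ℝ))
    (F := fun t x => polyVal p (R t x)) (F' := fun t x => polyVal (rotDeriv i p) (R t x))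
    (bound := fun _ => ‖spherePoly (rotDeriv i p)‖) (s := univ) univ_mem
    (Eventually.of_forall fun t => (hcont p t).aestronglyMeasurable)
    ((hcont p 0).integrable_of_hasCompactSupport (HasCompactSupport.of_compactSpace _))
    (hcont _ 0).aestronglyMeasurable
    (ae_of_all _ fun x t _ => by
      have := (spherePoly (rotDeriv i p)).norm_coe_le_norm (sphereMap (R t) x)
      rwa [spherePoly_apply] at this)
    (integrable_const _)
    (ae_of_all _ fun x t _ => by
      have h := (hasFDerivAt_polyVal p (R t x)).comp_hasDerivAt t (hasDerivAt_axisRotation i t x)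
      refine h.congr_deriv ?_
      rw [polyVal_rotDeriv]
      simp [hR])
  have h1 := hd.2
  simp only [hint] at h1
  exact (h1.unique (hasDerivAt_const _ _))

lemma memLp_continuous_mul {f : S2 → ℂ} (hf : MemLp f 2 surf) {h : S2 → ℂ} (hh : Continuous h) :
    MemLp (fun x => h x * f x) 2 surf := by
  refine hf.of_le_mul (c := ‖(⟨h, hh⟩ : C(S2, ℂ))‖) (hh.aestronglyMeasurable.mul hf.aestronglyMeasurable)
    (ae_of_all _ fun x => ?_)
  rw [norm_mul]
  exact mul_le_mul_of_nonneg_right ((⟨h, hh⟩ : C(S2, ℂ)).norm_coe_le_norm x) (norm_nonneg _)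

lemma continuous_polyVal_sphere (p : Poly) : Continuous fun x : S2 => polyVal p x :=
  (contDiff_polyVal p).continuous.comp continuous_subtype_val

/-- The derivative along the rotation around the `i`-th axis of a function with gradient `g`. -/
noncomputable def axisComponent (i : Fin 3) (g : S2 → EuclideanSpace ℂ (Fin 3)) (x : S2) : ℂ :=
  ∑ j, ((axisField i x j : ℝ) : ℂ) * g x j

lemma memLp_axisComponent (i : Fin 3) {g : S2 → EuclideanSpace ℂ (Fin 3)} (hg : MemLp g 2 surf) :
    MemLp (axisComponent i g) 2 surf := by
  refine memLp_finsetSum _ fun j _ => ?_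
  refine memLp_continuous_mul ((EuclideanSpace.proj (𝕜 := ℂ) j).comp_memLp' hg) ?_
  exact Complex.continuous_ofReal.comp ((EuclideanSpace.proj (𝕜 := ℝ) j).continuous.comp
    ((axisField i).continuous.comp continuous_subtype_val))

/-- Integration by parts against the velocity field of a rotation. -/
lemma HasSphereGradient.integral_rotDeriv {ψ : S2 → ℂ} {g : S2 → EuclideanSpace ℂ (Fin 3)}
    (h : HasSphereGradient ψ g) (i : Fin 3) (p : Poly) :
    ∫ x, ψ x * polyVal (rotDeriv i p) x ∂surf
      = - ∫ x, polyVal p x * axisComponent i g x ∂surf := by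
  have htan : ∀ x : E3, ⟪axisField i x, x⟫_ℝ = 0 := by
    intro x
    simp only [PiLp.inner_apply, axisField_apply, Fin.sum_univ_three]
    fin_cases i <;> simp <;> ring
  -- Test fields are real, so the real and imaginary parts of the polynomial are used separately and
  -- recombined at the end.
  have key : ∀ l : ℂ →L[ℝ] ℝ, ∫ x, ψ x * ((l (polyVal (rotDeriv i p) x) : ℝ) : ℂ) ∂surf
      = - ∫ x, ((l (polyVal p x) : ℝ) : ℂ) * axisComponent i g x ∂surf := by
    intro l
    set X : E3 → E3 := fun x => l (polyVal p x) • axisField i x with hX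
    have hsm : IsSphereField X :=
      ⟨(l.contDiff.comp (contDiff_polyVal p)).smul (axisField i).contDiff,
        fun x => by rw [hX]; simp only [inner_smul_left, htan, mul_zero]⟩
    -- The field of a rotation is linear and skew: it has trace zero and is orthogonal to `x`. Only
    -- the derivative of the coefficient along the field survives.
    have hdiv : ∀ x : S2, sphereDiv X x = l (polyVal (rotDeriv i p) x) := by
      intro x
      have hu : HasFDerivAt (fun y => l (polyVal p y)) (l.comp (∑ j : Fin 3,
          (Complex.ofRealCLM.comp (EuclideanSpace.proj (𝕜 := ℝ) j)).smulRight
          (polyVal (pderiv j p) x))) (x : E3) := l.hasFDerivAt.comp _ (hasFDerivAt_polyVal p x)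
      have hf := (hu.fun_smul (axisField i).hasFDerivAt).fderiv
      have hval : ∀ v : E3, fderiv ℝ X x v = l (polyVal p x) • axisField i v
          + l (∑ j, ((v j : ℝ) : ℂ) * polyVal (pderiv j p) x) • axisField i x := by
        intro v
        rw [hX, hf]
        simp
      have hlin : ∀ r : ℝ, ∀ z : ℂ, l ((r : ℂ) * z) = r * l z := fun r z => by
        rw [← Complex.real_smul, map_smul, smul_eq_mul]
      unfold sphereDiv
      simp only [hval, inner_add_left, inner_smul_left, htan, mul_zero, add_zero, sub_zero, polyVal_rotDeriv,
        map_add, hlin, axisField_apply, PiLp.add_apply, PiLp.smul_apply, smul_eq_mul, Fin.sum_univ_three]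
      fin_cases i <;> simp <;> ring
    have h1 := h.integral_div X hsm
    simp only [hdiv] at h1
    rw [h1]
    congr 1
    refine integral_congr_ae (ae_of_all _ fun x => ?_)
    simp [hX, axisComponent, Finset.mul_sum, mul_assoc]
  have hint : ∀ f : S2 → ℂ, MemLp f 2 surf → ∀ (q : Poly) (l : ℂ →L[ℝ] ℝ),
      Integrable (fun x : S2 => ((l (polyVal q x) : ℝ) : ℂ) * f x) surf := fun f hf q l =>
    (memLp_continuous_mul hf (Complex.continuous_ofReal.comp
      (l.continuous.comp (continuous_polyVal_sphere q)))).integrable (by norm_num)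
  have hsplit : ∀ f : S2 → ℂ, MemLp f 2 surf → ∀ q : Poly, ∫ x : S2, polyVal q x * f x ∂surf
      = ∫ x : S2, ((Complex.reCLM (polyVal q x) : ℝ) : ℂ) * f x ∂surf
        + Complex.I * ∫ x : S2, ((Complex.imCLM (polyVal q x) : ℝ) : ℂ) * f x ∂surf := by
    intro f hf q
    rw [← integral_const_mul, ← integral_add (hint f hf q _) ((hint f hf q _).const_mul _)]
    refine integral_congr_ae (ae_of_all _ fun x : S2 => ?_)
    simp only [Complex.reCLM_apply, Complex.imCLM_apply]
    linear_combination (-f x) * Complex.re_add_im (polyVal q x)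
  have k1 := key Complex.reCLM
  have k2 := key Complex.imCLM
  simp only [mul_comm (ψ _)] at k1 k2 ⊢
  rw [hsplit ψ h.memLp, hsplit _ (memLp_axisComponent i h.memLp_grad), k1, k2]
  ring

end Rotations

end LiebThirring

/-! ### Spherical harmonics -/

namespace LiebThirring

open Set Filter Topology
open scoped ENNReal

section Harmonics

open MvPolynomial Module

/-- Polynomials as square integrable functions on the sphere. -/
noncomputable def polyL : Poly →ₗ[ℂ] Lp ℂ 2 surf :=
  (ContinuousMap.toLp 2 surf ℂ : C(S2, ℂ) →L[ℂ] Lp ℂ 2 surf).toLinearMap ∘ₗ spherePoly.toLinearMap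

lemma polyL_apply (p : Poly) : polyL p = ContinuousMap.toLp 2 surf ℂ (spherePoly p) := rfl

lemma inner_polyL (p q : Poly) :
    ⟪polyL p, polyL q⟫_ℂ = ∫ x : S2, polyVal q x * (starRingEnd ℂ) (polyVal p x) ∂surf := by
  rw [polyL_apply, polyL_apply, ContinuousMap.inner_toLp]
  simp only [spherePoly_apply]

lemma polyL_inj {p q : Poly} (h : polyL p = polyL q) (x : S2) : polyVal p x = polyVal q x := by
  have := ContinuousMap.toLp_injective (p := 2) (𝕜 := ℂ) surf h
  rw [← spherePoly_apply, ← spherePoly_apply]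
  exact DFunLike.congr_fun this x

lemma polyL_congr {p q : Poly} (h : spherePoly p = spherePoly q) : polyL p = polyL q := by
  rw [polyL_apply, polyL_apply, h]

lemma integrable_polyVal (p : Poly) : Integrable (fun x : S2 => polyVal p x) surf :=
  (continuous_polyVal_sphere p).integrable_of_hasCompactSupport (HasCompactSupport.of_compactSpace _)

/-- The Leibniz rule for q · conj p, whose rotation derivative has integral zero. -/
lemma inner_rotDeriv (i : Fin 3) (p q : Poly) :
    ⟪polyL (rotDeriv i p), polyL q⟫_ℂ = -⟪polyL p, polyL (rotDeriv i q)⟫_ℂ := by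
  have h := integral_rotDeriv i (q * polyConj p)
  rw [Derivation.leibniz, rotDeriv_polyConj] at h
  simp only [smul_eq_mul, polyVal_add] at h
  rw [integral_add (integrable_polyVal _) (integrable_polyVal _)] at h
  simp only [polyVal_mul, polyVal_polyConj] at h
  rw [inner_polyL, inner_polyL, eq_neg_iff_add_eq_zero, ← h]
  simp only [mul_comm]

lemma inner_angLaplace_left (p q : Poly) :
    ⟪polyL (angLaplace p), polyL q⟫_ℂ = -∑ i, ⟪polyL (rotDeriv i p), polyL (rotDeriv i q)⟫_ℂ := by
  rw [angLaplace, map_sum, sum_inner, ← Finset.sum_neg_distrib]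
  exact Finset.sum_congr rfl fun i _ => inner_rotDeriv i _ _

lemma inner_angLaplace_right (p q : Poly) :
    ⟪polyL p, polyL (angLaplace q)⟫_ℂ = -∑ i, ⟪polyL (rotDeriv i p), polyL (rotDeriv i q)⟫_ℂ := by
  rw [angLaplace, map_sum, inner_sum, ← Finset.sum_neg_distrib]
  refine Finset.sum_congr rfl fun i _ => ?_
  rw [inner_rotDeriv, neg_neg]

/-- The functions on the sphere given by polynomials of degree less than `n`. -/
noncomputable def polySpace (n : ℕ) : Submodule ℂ (Lp ℂ 2 surf) := (lowDeg n).map polyL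

lemma polySpace_mono {m n : ℕ} (h : m ≤ n) : polySpace m ≤ polySpace n :=
  Submodule.map_mono (lowDeg_mono h)

lemma polySpace_succ_le (n : ℕ) : ∃ s : Finset (Lp ℂ 2 surf), s.card ≤ 2 * n + 1 ∧
    polySpace (n + 1) ≤ polySpace n ⊔ Submodule.span ℂ (s : Set (Lp ℂ 2 surf)) := by
  classical
  set t : Finset Poly := (Finset.range (n + 1)).image (fun a => (X 0 ^ a * X 1 ^ (n - a) : Poly)) ∪
    (Finset.range n).image (fun a => (X 0 ^ a * X 1 ^ (n - 1 - a) * X 2 : Poly)) with ht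
  refine ⟨t.image polyL, ?_, ?_⟩
  · refine Finset.card_image_le.trans ((Finset.card_union_le _ _).trans ?_)
    have h1 := Finset.card_image_le (s := Finset.range (n + 1)) (f := fun a => (X 0 ^ a * X 1 ^ (n - a) : Poly))
    have h2 := Finset.card_image_le (s := Finset.range n) (f := fun a => (X 0 ^ a * X 1 ^ (n - 1 - a) * X 2 : Poly))
    rw [Finset.card_range] at h1 h2
    omega
  · rintro _ ⟨p, hp, rfl⟩
    have h := spherePoly_mem_sup hp
    have h2 := Submodule.mem_map_of_mem (f := (ContinuousMap.toLp 2 surf ℂ : C(S2, ℂ) →L[ℂ] Lp ℂ 2 surf).toLinearMap) h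
    rw [Submodule.map_sup, Submodule.map_span, ← Submodule.map_comp, ← image_comp] at h2
    rw [Finset.coe_image]
    exact h2

instance finiteDimensional_polySpace (n : ℕ) : FiniteDimensional ℂ (polySpace n) := by
  induction n with
  | zero => rw [polySpace, lowDeg_zero, Submodule.map_bot]; infer_instance
  | succ n ih =>
    obtain ⟨s, _, hs⟩ := polySpace_succ_le n
    exact Submodule.finiteDimensional_of_le hs

/-- The spherical harmonics of degree `n`. -/
noncomputable def harm (n : ℕ) : Submodule ℂ (Lp ℂ 2 surf) := (polySpace n)ᗮ ⊓ polySpace (n + 1)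

instance finiteDimensional_harm (n : ℕ) : FiniteDimensional ℂ (harm n) :=
  Submodule.finiteDimensional_of_le (S₂ := polySpace (n + 1)) inf_le_right

/-- The upper bound on the multiplicity suffices, because the kernel is only estimated from above.
-/
lemma finrank_harm_le (n : ℕ) : finrank ℂ (harm n) ≤ 2 * n + 1 := by
  have h := Submodule.finrank_add_inf_finrank_orthogonal (polySpace_mono n.le_succ)
  obtain ⟨s, hs, hle⟩ := polySpace_succ_le n
  have h2 := Submodule.finrank_mono hle
  have h3 := Submodule.finrank_add_le_finrank_add_finrank (polySpace n) (Submodule.span ℂ (s : Set (Lp ℂ 2 surf)))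
  have h4 : finrank ℂ (Submodule.span ℂ (s : Set (Lp ℂ 2 surf))) ≤ s.card :=
    finrank_span_finset_le_card s
  have h5 : finrank ℂ (harm n) = finrank ℂ ((polySpace n)ᗮ ⊓ polySpace (n + 1) : Submodule ℂ (Lp ℂ 2 surf)) := rfl
  simp only [Nat.succ_eq_add_one] at h
  omega

/-- The defect Δp + n(n + 1)p, with Δ the angular Laplacian, lies in the space of lower degree. It
is also orthogonal to that space, since Δ is symmetric and preserves it, so it vanishes. -/
lemma polyL_angLaplace {n : ℕ} {p : Poly} (hp : p ∈ lowDeg (n + 1)) (h : polyL p ∈ harm n) :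
    polyL (angLaplace p) = -(n * (n + 1) : ℂ) • polyL p := by
  obtain ⟨q, hq, e⟩ := exists_spherePoly_angLaplace hp
  have e2 := polyL_congr e
  rw [map_add, map_smul] at e2
  have hDq : angLaplace q ∈ lowDeg n := Submodule.sum_mem _ fun i _ =>
    rotDeriv_mem_lowDeg i (rotDeriv_mem_lowDeg i hq)
  have horth : ∀ r ∈ lowDeg n, ⟪polyL r, polyL p⟫_ℂ = 0 := fun r hr =>
    (Submodule.mem_orthogonal _ _).1 h.1 _ ⟨r, hr, rfl⟩
  have h0 : ⟪polyL q, polyL q⟫_ℂ = 0 := by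
    have : ⟪polyL q, polyL q⟫_ℂ = ⟪polyL q, polyL (angLaplace p) + (n * (n + 1) : ℂ) • polyL p⟫_ℂ := by
      rw [e2]
    rw [this, inner_add_right, inner_smul_right, horth q hq, inner_angLaplace_right, ← inner_angLaplace_left,
      horth _ hDq]
    simp
  rw [inner_self_eq_zero.1 h0] at e2
  rw [eq_neg_of_add_eq_zero_left e2, neg_smul]

/-- The index set of the spherical harmonics. -/
abbrev HarmIndex : Type := Σ n : ℕ, Fin (finrank ℂ (harm n))

lemma exists_harmPoly (k : HarmIndex) :
    ∃ p ∈ lowDeg (k.1 + 1), polyL p = (stdOrthonormalBasis ℂ (harm k.1) k.2 : Lp ℂ 2 surf) :=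
  (stdOrthonormalBasis ℂ (harm k.1) k.2).2.2

/-- A polynomial representing a member of the orthonormal basis of spherical harmonics. -/
noncomputable def harmPoly (k : HarmIndex) : Poly := (exists_harmPoly k).choose

lemma harmPoly_mem (k : HarmIndex) : harmPoly k ∈ lowDeg (k.1 + 1) := (exists_harmPoly k).choose_spec.1

lemma polyL_harmPoly (k : HarmIndex) :
    polyL (harmPoly k) = (stdOrthonormalBasis ℂ (harm k.1) k.2 : Lp ℂ 2 surf) :=
  (exists_harmPoly k).choose_spec.2

lemma polyL_harmPoly_mem (k : HarmIndex) : polyL (harmPoly k) ∈ harm k.1 := by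
  rw [polyL_harmPoly]
  exact Subtype.coe_prop _

lemma inner_harm_of_lt {m n : ℕ} (h : m < n) {u v : Lp ℂ 2 surf} (hu : u ∈ harm m) (hv : v ∈ harm n) :
    ⟪u, v⟫_ℂ = 0 :=
  (Submodule.mem_orthogonal _ _).1 hv.1 _ (polySpace_mono h hu.2)

lemma inner_harmPoly (k l : HarmIndex) :
    ⟪polyL (harmPoly k), polyL (harmPoly l)⟫_ℂ = if k = l then 1 else 0 := by
  rcases lt_trichotomy k.1 l.1 with h | h | h
  · rw [inner_harm_of_lt h (polyL_harmPoly_mem k) (polyL_harmPoly_mem l), if_neg]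
    rintro rfl
    exact h.ne rfl
  · obtain ⟨n, a⟩ := k
    obtain ⟨m, b⟩ := l
    obtain rfl : n = m := h
    rw [polyL_harmPoly, polyL_harmPoly]
    have := orthonormal_iff_ite.1 (stdOrthonormalBasis ℂ (harm n)).orthonormal a b
    rw [Submodule.coe_inner] at this
    simp [this]
  · rw [inner_eq_zero_symm.1 (inner_harm_of_lt h (polyL_harmPoly_mem l) (polyL_harmPoly_mem k)), if_neg]
    rintro rfl
    exact h.ne rfl

/-- By induction: `polySpace (n + 1)` is the orthogonal sum of `polySpace n` and `harm n`. -/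
lemma polySpace_le_span (n : ℕ) :
    polySpace n ≤ Submodule.span ℂ (range fun k : HarmIndex => polyL (harmPoly k)) := by
  induction n with
  | zero => rw [polySpace, lowDeg_zero, Submodule.map_bot]; exact bot_le
  | succ n ih =>
    rw [← Submodule.sup_orthogonal_inf_of_hasOrthogonalProjection (polySpace_mono n.le_succ)]
    refine sup_le ih fun v hv => ?_
    have h := (stdOrthonormalBasis ℂ (harm n)).sum_repr ⟨v, hv⟩
    have h2 := congrArg (Subtype.val) h
    rw [← show _ = v from h2, AddSubmonoidClass.coe_finsetSum]
    refine Submodule.sum_mem _ fun m _ => Submodule.smul_mem _ _ ?_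
    rw [← polyL_harmPoly ⟨n, m⟩]
    exact Submodule.subset_span ⟨_, rfl⟩

/-- Stone–Weierstrass for the restricted polynomials: the coordinates separate points, and
conjugation acts on the coefficients. -/
lemma dense_polyL : ⊤ ≤ (Submodule.span ℂ (range fun k : HarmIndex => polyL (harmPoly k))).topologicalClosure := by
  let S : StarSubalgebra ℂ C(S2, ℂ) :=
    { toSubalgebra := spherePoly.range
      star_mem' := by
        rintro _ ⟨p, rfl⟩
        refine ⟨polyConj p, ?_⟩
        ext x
        change spherePoly (polyConj p) x = star (spherePoly p x)
        rw [spherePoly_apply, spherePoly_apply, polyVal_polyConj]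
        rfl }
  have hsep : S.SeparatesPoints := by
    intro x y hxy
    by_contra hcon
    refine hxy (Subtype.ext ?_)
    ext i
    by_contra hi
    refine hcon ⟨_, ⟨spherePoly (X i), ⟨X i, rfl⟩, rfl⟩, ?_⟩
    change spherePoly (X i) x ≠ spherePoly (X i) y
    rw [spherePoly_apply, spherePoly_apply, polyVal_X, polyVal_X]
    exact_mod_cast hi
  have hS : (Subalgebra.toSubmodule S.toSubalgebra).topologicalClosure = ⊤ :=
    congr_arg (Subalgebra.toSubmodule <| StarSubalgebra.toSubalgebra ·)
      (ContinuousMap.starSubalgebra_topologicalClosure_eq_top_of_separatesPoints S hsep)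
  have h := (ContinuousMap.toLp_denseRange ℂ surf ℂ (p := 2)
    (by norm_num)).topologicalClosure_map_submodule hS
  rw [← h]
  refine Submodule.topologicalClosure_mono ?_
  rintro _ ⟨_, ⟨p, rfl⟩, rfl⟩
  obtain ⟨n, hn⟩ := exists_mem_lowDeg p
  exact polySpace_le_span n ⟨p, hn, rfl⟩

end Harmonics

end LiebThirring

/-! ### The kernel of an eigenspace is constant -/

namespace LiebThirring

open Set Filter Topology
open scoped ENNReal

section Kernel

open MvPolynomial Module

/-- The reproducing kernel of the spherical harmonics of degree `n` on the diagonal. -/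
noncomputable def harmKernel (n : ℕ) (x : S2) : ℝ :=
  ∑ m : Fin (finrank ℂ (harm n)), ‖polyVal (harmPoly ⟨n, m⟩) x‖ ^ 2

lemma inner_polySubst (φ : E3 ≃ₗᵢ[ℝ] E3) (p q : Poly) :
    ⟪polyL (polySubst φ.toLinearMap p), polyL (polySubst φ.toLinearMap q)⟫_ℂ = ⟪polyL p, polyL q⟫_ℂ := by
  rw [inner_polyL, inner_polyL]
  have h := integral_comp_sphereMap φ (spherePoly (q * polyConj p))
  simp only [spherePoly_apply, polyVal_mul, polyVal_polyConj] at h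
  rw [← h]
  simp only [polyVal_polySubst]
  rfl

lemma polyL_ext {p q : Poly} (h : ∀ x : S2, polyVal p x = polyVal q x) : polyL p = polyL q :=
  polyL_congr (ContinuousMap.ext fun x => by rw [spherePoly_apply, spherePoly_apply, h])

/-- Linear isometries preserve both the degree bound and the inner product, hence also the
orthogonal complement defining `harm n`. -/
lemma polyL_polySubst_mem (φ : E3 ≃ₗᵢ[ℝ] E3) {n : ℕ} {p : Poly} (hp : p ∈ lowDeg (n + 1))
    (h : polyL p ∈ harm n) : polyL (polySubst φ.toLinearMap p) ∈ harm n := by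
  refine ⟨(Submodule.mem_orthogonal _ _).2 ?_, ⟨_, polySubst_mem_lowDeg _ hp, rfl⟩⟩
  rintro _ ⟨r, hr, rfl⟩
  have e : polyL r = polyL (polySubst φ.toLinearMap (polySubst φ.symm.toLinearMap r)) :=
    polyL_ext fun x => by
      rw [polyVal_polySubst, polyVal_polySubst]
      congr 1
      exact (φ.symm_apply_apply _).symm
  rw [e, inner_polySubst]
  exact (Submodule.mem_orthogonal _ _).1 h.1 _ ⟨_, polySubst_mem_lowDeg _ hr, rfl⟩

/-- Expansion of a spherical harmonic in the orthonormal basis. -/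
lemma polyVal_eq_sum_harmPoly {n : ℕ} {p : Poly} (h : polyL p ∈ harm n) (x : S2) :
    polyVal p x = ∑ m, ⟪polyL (harmPoly ⟨n, m⟩), polyL p⟫_ℂ * polyVal (harmPoly ⟨n, m⟩) x := by
  have h1 := congrArg Subtype.val ((stdOrthonormalBasis ℂ (harm n)).sum_repr' ⟨polyL p, h⟩)
  rw [AddSubmonoidClass.coe_finsetSum] at h1
  have h2 : polyL p = polyL (∑ m, ⟪polyL (harmPoly ⟨n, m⟩), polyL p⟫_ℂ • harmPoly ⟨n, m⟩) := by
    rw [map_sum]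
    refine (show _ = polyL p from h1).symm.trans (Finset.sum_congr rfl fun m _ => ?_)
    rw [map_smul, polyL_harmPoly]
    rfl
  rw [polyL_inj h2 x]
  simp [polyVal]

lemma norm_sq_polyL {n : ℕ} {p : Poly} (h : polyL p ∈ harm n) :
    ∑ m, ‖⟪polyL (harmPoly ⟨n, m⟩), polyL p⟫_ℂ‖ ^ 2 = ‖polyL p‖ ^ 2 := by
  have h1 := (stdOrthonormalBasis ℂ (harm n)).sum_sq_norm_inner_right ⟨polyL p, h⟩
  simp only [Submodule.coe_inner] at h1
  simp only [polyL_harmPoly]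
  exact h1

/-- The harmonic h is the reproducing kernel with pole φx. Its composition with φ is again a
harmonic of degree n, has value K(φx) at x and squared norm K(φx). Expansion in the basis and
Cauchy–Schwarz give K(φx)² ≤ K(φx) K(x). -/
lemma harmKernel_sphereMap_le (φ : E3 ≃ₗᵢ[ℝ] E3) (n : ℕ) (x : S2) :
    harmKernel n (sphereMap φ x) ≤ harmKernel n x := by
  set a : Fin (finrank ℂ (harm n)) → ℂ := fun m => (starRingEnd ℂ) (polyVal (harmPoly ⟨n, m⟩) (sphereMap φ x))
    with ha
  set h : Poly := ∑ m, a m • harmPoly ⟨n, m⟩ with hh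
  have hlow : h ∈ lowDeg (n + 1) :=
    Submodule.sum_mem _ fun m _ => Submodule.smul_mem _ _ (harmPoly_mem ⟨n, m⟩)
  have hmem : polyL h ∈ harm n := by
    rw [hh, map_sum]
    refine Submodule.sum_mem _ fun m _ => ?_
    rw [map_smul]
    exact Submodule.smul_mem _ _ (polyL_harmPoly_mem ⟨n, m⟩)
  have hval : polyVal (polySubst φ.toLinearMap h) x = (harmKernel n (sphereMap φ x) : ℂ) := by
    rw [polyVal_polySubst]
    change polyVal h (sphereMap φ x) = _
    rw [hh, harmKernel]
    have : ∀ y : E3, polyVal (∑ m, a m • harmPoly ⟨n, m⟩) y = ∑ m, a m * polyVal (harmPoly ⟨n, m⟩) y := by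
      intro y
      simp [polyVal]
    rw [this]
    push_cast
    exact Finset.sum_congr rfl fun m _ => Complex.conj_mul' _
  have hnorm : ‖polyL (polySubst φ.toLinearMap h)‖ ^ 2 = harmKernel n (sphereMap φ x) := by
    have e1 : ‖polyL (polySubst φ.toLinearMap h)‖ ^ 2 = ‖polyL h‖ ^ 2 := by
      rw [← inner_self_eq_norm_sq (𝕜 := ℂ), inner_polySubst, inner_self_eq_norm_sq]
    rw [e1, ← norm_sq_polyL hmem, harmKernel]
    refine Finset.sum_congr rfl fun m _ => ?_
    congr 1
    have : ⟪polyL (harmPoly ⟨n, m⟩), polyL h⟫_ℂ = a m := by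
      rw [hh, map_sum, inner_sum, Finset.sum_eq_single m]
      · rw [map_smul, inner_smul_right, inner_harmPoly, if_pos rfl, mul_one]
      · intro l _ hl
        rw [map_smul, inner_smul_right, inner_harmPoly, if_neg, mul_zero]
        intro e
        exact hl (by simpa using e.symm)
      · simp
    rw [this, ha]
    exact RCLike.norm_conj _
  have hmem2 := polyL_polySubst_mem φ hlow hmem
  have hexp := polyVal_eq_sum_harmPoly hmem2 x
  rw [hval] at hexp
  have hK0 : ∀ y, 0 ≤ harmKernel n y := fun y => Finset.sum_nonneg fun _ _ => sq_nonneg _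
  have hcs : harmKernel n (sphereMap φ x) ^ 2 ≤ harmKernel n (sphereMap φ x) * harmKernel n x := by
    have e1 : harmKernel n (sphereMap φ x) ≤ ∑ m, ‖⟪polyL (harmPoly ⟨n, m⟩), polyL (polySubst φ.toLinearMap h)⟫_ℂ‖
        * ‖polyVal (harmPoly ⟨n, m⟩) x‖ := by
      have : harmKernel n (sphereMap φ x) = ‖((harmKernel n (sphereMap φ x) : ℝ) : ℂ)‖ := by
        rw [Complex.norm_real, Real.norm_of_nonneg (hK0 _)]
      rw [this, hexp]
      refine (norm_sum_le _ _).trans (le_of_eq ?_)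
      simp only [norm_mul]
    calc harmKernel n (sphereMap φ x) ^ 2 ≤ (∑ m, ‖⟪polyL (harmPoly ⟨n, m⟩), polyL (polySubst φ.toLinearMap h)⟫_ℂ‖
        * ‖polyVal (harmPoly ⟨n, m⟩) x‖) ^ 2 := pow_le_pow_left₀ (hK0 _) e1 2
      _ ≤ _ := Finset.sum_mul_sq_le_sq_mul_sq _ _ _
      _ = _ := by rw [norm_sq_polyL hmem2, hnorm]; rfl
  rcases (hK0 (sphereMap φ x)).eq_or_lt with h0 | h0
  · rw [← h0]
    exact hK0 x
  · nlinarith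

/-- The reflection in the hyperplane orthogonal to y − x interchanges the two points. -/
lemma harmKernel_const (n : ℕ) (x y : S2) : harmKernel n x = harmKernel n y := by
  have hle : ∀ x y : S2, harmKernel n x ≤ harmKernel n y := by
    intro x y
    have hn : ‖(y : E3)‖ = ‖(x : E3)‖ := by
      rw [mem_sphere_zero_iff_norm.1 x.2, mem_sphere_zero_iff_norm.1 y.2]
    have h := harmKernel_sphereMap_le (Submodule.reflection (ℝ ∙ ((y : E3) - x))ᗮ) n y
    have e : sphereMap (Submodule.reflection (ℝ ∙ ((y : E3) - x))ᗮ) y = x :=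
      Subtype.ext (Submodule.reflection_sub hn)
    rwa [e] at h
  exact le_antisymm (hle x y) (hle y x)

lemma surf_real_univ : surf.real univ = 4 * Real.pi := by
  rw [surf, Measure.toSphere_real_apply_univ, Measure.real, EuclideanSpace.volume_ball_fin_three]
  rw [ENNReal.ofReal_one, one_pow, one_mul, ENNReal.toReal_ofReal (by positivity)]
  simp
  ring

/-- The integral of the kernel is the dimension of the eigenspace; a constant is its integral
divided by the area 4π. -/
lemma harmKernel_le (n : ℕ) (x : S2) : harmKernel n x ≤ (2 * n + 1) / (4 * Real.pi) := by
  have h1 : ∫ y, harmKernel n y ∂surf = finrank ℂ (harm n) := by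
    unfold harmKernel
    have hi : ∀ m : Fin (finrank ℂ (harm n)), Integrable (fun y : S2 => ‖polyVal (harmPoly ⟨n, m⟩) y‖ ^ 2) surf :=
      fun m => ((continuous_polyVal_sphere _).norm.pow 2).integrable_of_hasCompactSupport
        (HasCompactSupport.of_compactSpace _)
    rw [integral_finsetSum _ fun m _ => hi m]
    have : ∀ m : Fin (finrank ℂ (harm n)), ∫ y : S2, ‖polyVal (harmPoly ⟨n, m⟩) y‖ ^ 2 ∂surf = 1 := by
      intro m
      have h := inner_harmPoly ⟨n, m⟩ ⟨n, m⟩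
      rw [inner_polyL, if_pos rfl] at h
      have h2 : ((∫ y : S2, ‖polyVal (harmPoly ⟨n, m⟩) y‖ ^ 2 ∂surf : ℝ) : ℂ) = 1 := by
        rw [← h, ← integral_complex_ofReal]
        refine integral_congr_ae (ae_of_all _ fun y => ?_)
        push_cast
        exact (Complex.mul_conj' _).symm
      exact_mod_cast h2
    simp [this]
  have h2 : ∫ y, harmKernel n y ∂surf = harmKernel n x * (4 * Real.pi) := by
    rw [integral_congr_ae (ae_of_all _ fun y => harmKernel_const n y x), integral_const, surf_real_univ,
      smul_eq_mul, mul_comm]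
  have h3 : (finrank ℂ (harm n) : ℝ) ≤ 2 * n + 1 := by exact_mod_cast finrank_harm_le n
  rw [le_div_iff₀ (by have := Real.pi_pos; positivity), ← h2, h1]
  exact h3

end Kernel

end LiebThirring

/-! ### The sphere -/

namespace LiebThirring

open Set Filter Topology
open scoped ENNReal

section Sphere

open MvPolynomial Module

/-- The components form the cross product x × g, and Lagrange's identity |x × g|² = |x|²|g|² − |x ·
g|² applies with |x| = 1 and x · g = 0. -/
lemma sum_norm_sq_axisComponent {g : S2 → EuclideanSpace ℂ (Fin 3)} {x : S2}
    (h : ∑ i : Fin 3, (((x : E3) i : ℝ) : ℂ) * g x i = 0) :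
    ∑ i, ‖axisComponent i g x‖ ^ 2 = ‖g x‖ ^ 2 := by
  have hx : ∑ i, (((x : E3) i : ℝ) : ℂ) ^ 2 = 1 := by exact_mod_cast sum_sq_sphere x
  rw [EuclideanSpace.norm_sq_eq]
  have : ((∑ i, ‖axisComponent i g x‖ ^ 2 : ℝ) : ℂ) = ((∑ i, ‖g x i‖ ^ 2 : ℝ) : ℂ) := by
    push_cast
    simp only [← Complex.mul_conj']
    simp only [axisComponent, axisField_apply, map_sum, map_mul, Complex.conj_ofReal]
    simp only [Fin.sum_univ_three] at h hx ⊢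
    simp
    have h2 := congrArg (starRingEnd ℂ) h
    simp only [map_add, map_mul, Complex.conj_ofReal, map_zero] at h2
    linear_combination (g x 0 * (starRingEnd ℂ) (g x 0) + g x 1 * (starRingEnd ℂ) (g x 1)
      + g x 2 * (starRingEnd ℂ) (g x 2)) * hx - ((((x : E3) 0 : ℝ) : ℂ) * (starRingEnd ℂ) (g x 0)
      + (((x : E3) 1 : ℝ) : ℂ) * (starRingEnd ℂ) (g x 1) + (((x : E3) 2 : ℝ) : ℂ) * (starRingEnd ℂ) (g x 2)) * h
  exact_mod_cast this

lemma memLp_polyVal (p : Poly) : MemLp (fun x : S2 => polyVal p x) 2 surf :=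
  (continuous_polyVal_sphere p).memLp_of_hasCompactSupport (HasCompactSupport.of_compactSpace _)

lemma toLp_polyVal (p : Poly) : (memLp_polyVal p).toLp (fun x : S2 => polyVal p x) = polyL p := by
  refine Lp.ext ?_
  filter_upwards [(memLp_polyVal p).coeFn_toLp,
    ContinuousMap.coeFn_toLp (𝕜 := ℂ) (p := 2) surf (spherePoly p)] with x h1 h2
  rw [h1, polyL_apply, h2, spherePoly_apply]

/-- Makes the harmonics of degree zero orthogonal to functions of mean zero. -/
lemma exists_polyVal_eq_of_mem_lowDeg_one {p : Poly} (hp : p ∈ lowDeg 1) : ∃ c, ∀ x, polyVal p x = c := by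
  induction hp using Submodule.span_induction with
  | mem p hp =>
    obtain ⟨m, hm, hp⟩ := hp
    obtain rfl : m = 0 := by omega
    rw [← totalDegree_zero_iff_isHomogeneous, totalDegree_eq_zero_iff_eq_C] at hp
    exact ⟨coeff 0 p, fun x => by rw [hp, polyVal_C, coeff_C, if_pos rfl]⟩
  | zero => exact ⟨0, fun x => by simp [polyVal]⟩
  | add p q _ _ hp hq =>
    obtain ⟨c, hc⟩ := hp
    obtain ⟨d, hd⟩ := hq
    exact ⟨c + d, fun x => by rw [polyVal_add, hc, hd]⟩
  | smul a p _ hp =>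
    obtain ⟨c, hc⟩ := hp
    exact ⟨a * c, fun x => by rw [MvPolynomial.smul_eq_C_mul, polyVal_mul, polyVal_C, hc]⟩

lemma sum_profile_harmPoly_le {a : ℝ} (ha : 0 < a) (K : Finset HarmIndex) (hK : ∀ k ∈ K, k.1 ≠ 0) (x : S2) :
    ∑ k ∈ K, (a ^ 2 / (((k.1 : ℝ) * (k.1 + 1)) ^ 2 + a ^ 2)) ^ 2 * ‖polyVal (harmPoly k) x‖ ^ 2 ≤ a / 16 := by
  classical
  have hpi := Real.pi_pos
  have hprof : ∀ s : ℝ, (a ^ 2 / (s ^ 2 + a ^ 2)) ^ 2 = profile a s := by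
    intro s
    unfold profile
    rw [div_pow, ← pow_mul, add_comm]
  have hprof0 : ∀ s : ℝ, 0 ≤ profile a s := fun s => by unfold profile; positivity
  simp only [hprof]
  -- Completing each degree to its full basis produces the kernel of the eigenspace, which is
  -- bounded independently of the point.
  have hsub : K ⊆ (K.image Sigma.fst).sigma fun n => (Finset.univ : Finset (Fin (finrank ℂ (harm n)))) := by
    intro k hk
    rw [Finset.mem_sigma]
    exact ⟨Finset.mem_image_of_mem _ hk, Finset.mem_univ _⟩
  refine (Finset.sum_le_sum_of_subset_of_nonneg hsub fun k _ _ => mul_nonneg (hprof0 _) (sq_nonneg _)).trans ?_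
  rw [Finset.sum_sigma]
  simp only [← Finset.mul_sum]
  have h1 := sum_profile_sphere_le ha (K.image Sigma.fst) (by
    intro n hn
    obtain ⟨k, hk, rfl⟩ := Finset.mem_image.1 hn
    exact Nat.one_le_iff_ne_zero.2 (hK k hk))
  calc _ ≤ ∑ n ∈ K.image Sigma.fst, (4 * Real.pi)⁻¹ * ((2 * (n : ℝ) + 1) * profile a (n * (n + 1))) := by
        refine Finset.sum_le_sum fun n _ => ?_
        refine (mul_le_mul_of_nonneg_left (harmKernel_le n x) (hprof0 _)).trans (le_of_eq ?_)
        rw [div_eq_mul_inv]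
        ring
    _ = (4 * Real.pi)⁻¹ * ∑ n ∈ K.image Sigma.fst, ((2 * (n : ℝ) + 1) * profile a (n * (n + 1))) := by
        rw [Finset.mul_sum]
    _ ≤ (4 * Real.pi)⁻¹ * (Real.pi * a / 4) := by gcongr
    _ = a / 16 := by field_simp; norm_num

/-- The spectral energy of a function is bounded by its Dirichlet integral. -/
lemma HasSphereGradient.sum_eigenvalue_mul_le {ψ : S2 → ℂ} {g : S2 → EuclideanSpace ℂ (Fin 3)}
    (h : HasSphereGradient ψ g) (K : Finset HarmIndex) :
    ∑ k ∈ K, ((k.1 : ℝ) * (k.1 + 1)) * ‖∫ x : S2, ψ x * (starRingEnd ℂ) (polyVal (harmPoly k) x) ∂surf‖ ^ 2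
      ≤ ∫ x, ‖g x‖ ^ 2 ∂surf := by
  set c : HarmIndex → ℂ := fun k => ∫ x : S2, ψ x * (starRingEnd ℂ) (polyVal (harmPoly k) x) ∂surf with hc
  set S : ℝ := ∑ k ∈ K, ((k.1 : ℝ) * (k.1 + 1)) * ‖c k‖ ^ 2 with hS
  change S ≤ _
  set φ : Poly := ∑ k ∈ K, c k • harmPoly k with hφ
  have hDL : polyL (angLaplace φ) = polyL (∑ k ∈ K, (-(k.1 * (k.1 + 1) : ℂ) * c k) • harmPoly k) := by
    have : angLaplace φ = ∑ k ∈ K, c k • angLaplace (harmPoly k) := by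
      simp only [angLaplace, hφ, map_sum, Derivation.map_smul, Finset.smul_sum]
      exact Finset.sum_comm
    rw [this, map_sum, map_sum]
    refine Finset.sum_congr rfl fun k _ => ?_
    rw [map_smul, map_smul, polyL_angLaplace (harmPoly_mem k) (polyL_harmPoly_mem k), smul_smul, mul_comm]
  -- The eigenvalue equation identifies the spectral energy `S` with the Dirichlet energy of the
  -- projection φ.
  have hnormφ : ∑ i, ‖polyL (rotDeriv i φ)‖ ^ 2 = S := by
    have h1 := inner_angLaplace_right φ φ
    have hDL2 := hDL
    rw [map_sum] at hDL2
    rw [hDL2, inner_sum] at h1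
    have h2 : ∀ k ∈ K, ⟪polyL φ, polyL ((-(k.1 * (k.1 + 1) : ℂ) * c k) • harmPoly k)⟫_ℂ
        = -(((k.1 : ℝ) * (k.1 + 1) * ‖c k‖ ^ 2 : ℝ) : ℂ) := by
      intro k hk
      have : ⟪polyL φ, polyL (harmPoly k)⟫_ℂ = (starRingEnd ℂ) (c k) := by
        rw [hφ, map_sum, sum_inner, Finset.sum_eq_single_of_mem k hk]
        · rw [map_smul, inner_smul_left, inner_harmPoly, if_pos rfl, mul_one]
        · intro l _ hl
          rw [map_smul, inner_smul_left, inner_harmPoly, if_neg hl, mul_zero]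
      rw [map_smul, inner_smul_right, this, mul_assoc, Complex.mul_conj']
      push_cast
      ring
    rw [Finset.sum_congr rfl h2, Finset.sum_neg_distrib, neg_inj] at h1
    have h3 : ((S : ℝ) : ℂ) = ((∑ i, ‖polyL (rotDeriv i φ)‖ ^ 2 : ℝ) : ℂ) := by
      rw [hS]
      push_cast
      push_cast at h1
      rw [h1]
      exact Finset.sum_congr rfl fun i _ => inner_self_eq_norm_sq_to_K _
    exact_mod_cast h3.symm
  have hint : ∀ p : Poly, Integrable (fun x : S2 => ψ x * polyVal p x) surf := fun p => by
    simp only [mul_comm (ψ _)]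
    exact (memLp_continuous_mul h.memLp (continuous_polyVal_sphere p)).integrable (by norm_num)
  -- Pairing ψ with the conjugate of the angular Laplacian of φ and integrating by parts once
  -- expresses `S` through the weak gradient.
  have hSint : (S : ℂ) = ∑ i, ∫ x : S2, polyVal (polyConj (rotDeriv i φ)) x * axisComponent i g x ∂surf := by
    have h1 : ∫ x : S2, ψ x * polyVal (polyConj (angLaplace φ)) x ∂surf = -(S : ℂ) := by
      have h2 : ∀ x : S2, ψ x * polyVal (polyConj (angLaplace φ)) x
          = ∑ k ∈ K, (-(k.1 * (k.1 + 1) : ℂ) * (starRingEnd ℂ) (c k))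
            * (ψ x * (starRingEnd ℂ) (polyVal (harmPoly k) x)) := by
        intro x
        rw [polyVal_polyConj, polyL_inj hDL x]
        simp only [polyVal, map_sum, MvPolynomial.smul_eval, map_mul, map_neg, map_add, map_natCast, map_one,
          Finset.mul_sum]
        exact Finset.sum_congr rfl fun k _ => by ring
      simp only [h2]
      rw [integral_finsetSum]
      · simp only [integral_const_mul]
        rw [hS]
        push_cast
        rw [← Finset.sum_neg_distrib]
        refine Finset.sum_congr rfl fun k _ => ?_
        change _ * c k = _
        rw [← Complex.conj_mul']
        ring
      · intro k _
        have := hint (polyConj (harmPoly k))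
        simp only [polyVal_polyConj] at this
        exact this.const_mul _
    have h3 : ∀ x : E3, polyVal (polyConj (angLaplace φ)) x
        = ∑ i, polyVal (rotDeriv i (polyConj (rotDeriv i φ))) x := by
      intro x
      simp only [rotDeriv_polyConj]
      simp only [angLaplace, polyVal, map_sum]
    simp only [h3, Finset.mul_sum] at h1
    rw [integral_finsetSum _ fun i _ => hint _] at h1
    simp only [h.integral_rotDeriv, Finset.sum_neg_distrib, neg_inj] at h1
    exact h1.symm
  -- Summed over i, the arithmetic–geometric mean inequality gives S ≤ (S + ∫|g|²)/2, that is S ≤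
  -- ∫|g|².
  have hbound : ∀ i, (∫ x : S2, polyVal (polyConj (rotDeriv i φ)) x * axisComponent i g x ∂surf).re
      ≤ (‖polyL (rotDeriv i φ)‖ ^ 2 + ∫ x, ‖axisComponent i g x‖ ^ 2 ∂surf) / 2 := by
    intro i
    have hG := memLp_axisComponent i h.memLp_grad
    have hi := (memLp_continuous_mul hG (continuous_polyVal_sphere (polyConj (rotDeriv i φ)))).integrable
      (by norm_num)
    have hu := (memLp_polyVal (rotDeriv i φ)).integrable_norm_pow (by norm_num)
    have hn : ‖polyL (rotDeriv i φ)‖ ^ 2 = ∫ x : S2, ‖polyVal (rotDeriv i φ) x‖ ^ 2 ∂surf := by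
      have h1 := inner_polyL (rotDeriv i φ) (rotDeriv i φ)
      rw [inner_self_eq_norm_sq_to_K] at h1
      have h2 : ((‖polyL (rotDeriv i φ)‖ ^ 2 : ℝ) : ℂ)
          = ((∫ x : S2, ‖polyVal (rotDeriv i φ) x‖ ^ 2 ∂surf : ℝ) : ℂ) := by
        rw [← integral_complex_ofReal]
        push_cast
        refine (show ((‖polyL (rotDeriv i φ)‖ : ℂ) ^ 2 = _) from h1).trans
          (integral_congr_ae (ae_of_all _ fun x => ?_))
        exact Complex.mul_conj' _
      exact_mod_cast h2
    have hg2 := hG.integrable_norm_pow (by norm_num)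
    rw [hn, ← integral_add hu hg2, ← MeasureTheory.integral_div, ← Complex.reCLM_apply, ← Complex.reCLM.integral_comp_comm hi]
    refine integral_mono (Complex.reCLM.integrable_comp hi) ((hu.add hg2).div_const 2) fun x => ?_
    have e1 := Complex.re_le_norm (polyVal (polyConj (rotDeriv i φ)) x * axisComponent i g x)
    rw [norm_mul, polyVal_polyConj, RCLike.norm_conj] at e1
    simp only [Complex.reCLM_apply, polyVal_polyConj]
    have e2 := two_mul_le_add_sq ‖polyVal (rotDeriv i φ) x‖ ‖axisComponent i g x‖
    linarith
  have hgrad : ∑ i, ∫ x, ‖axisComponent i g x‖ ^ 2 ∂surf = ∫ x, ‖g x‖ ^ 2 ∂surf := by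
    rw [← integral_finsetSum _ fun i _ => (memLp_axisComponent i h.memLp_grad).integrable_norm_pow (by norm_num)]
    refine integral_congr_ae ?_
    filter_upwards [h.tangent] with x hx
    exact sum_norm_sq_axisComponent hx
  have hre := congrArg Complex.re hSint
  rw [Complex.ofReal_re, Complex.re_sum] at hre
  have := Finset.sum_le_sum fun i (_ : i ∈ (Finset.univ : Finset (Fin 3))) => hbound i
  rw [← hre, ← Finset.sum_div, Finset.sum_add_distrib, hnormφ, hgrad] at this
  linarith

/-- The Lieb–Thirring inequality on the sphere. -/
theorem lieb_thirring_sphere {N : ℕ} {ψ : Fin N → S2 → ℂ} {g : Fin N → S2 → EuclideanSpace ℂ (Fin 3)}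
    (hg : ∀ j, HasSphereGradient (ψ j) (g j)) (hmean : ∀ j, ∫ x, ψ j x ∂surf = 0)
    (hort : IsL2Orthonormal surf ψ) :
    Integrable (fun x => density ψ x ^ 2) surf ∧
      ∫ x, density ψ x ^ 2 ∂surf ≤ 3 * Real.pi / 32 * ∑ j : Fin N, ∫ x, ‖g j x‖ ^ 2 ∂surf := by
  refine lieb_thirring_of_eigenbasis (ι := HarmIndex) (e := fun k (x : S2) => polyVal (harmPoly k) x)
    (fun k => memLp_polyVal _) ?_ ?_ (p := fun k => k.1 ≠ 0) (lam := fun k => (k.1 : ℝ) * (k.1 + 1))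
    ?_ (fun K hK a ha x => sum_profile_harmPoly_le ha K hK x) (fun j => (hg j).memLp) hort ?_
    (fun K _ j => (hg j).sum_eigenvalue_mul_le K)
  · intro k l
    rw [← inner_polyL, inner_harmPoly]
    simp only [eq_comm]
  · simp only [toLp_polyVal]
    exact dense_polyL
  · intro k hk
    have : 0 < (k.1 : ℝ) := by exact_mod_cast Nat.pos_of_ne_zero hk
    positivity
  · intro j k hk
    have hk0 : k.1 = 0 := by simpa using hk
    have hmem := harmPoly_mem k
    rw [hk0] at hmem
    obtain ⟨c, hc⟩ := exists_polyVal_eq_of_mem_lowDeg_one hmem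
    simp only [hc]
    rw [integral_mul_const, hmean, zero_mul]

end Sphere

end LiebThirring

theorem theorem1 :
    (∀ (N : ℕ) (ψ : Fin N → LiebThirring.S2 → ℂ)
        (g : Fin N → LiebThirring.S2 → EuclideanSpace ℂ (Fin 3)),
      (∀ j, LiebThirring.HasSphereGradient (ψ j) (g j)) →
      (∀ j, ∫ x, ψ j x ∂LiebThirring.surf = 0) →
      LiebThirring.IsL2Orthonormal LiebThirring.surf ψ →
      Integrable (fun x => LiebThirring.density ψ x ^ 2) LiebThirring.surf ∧
      ∫ x, LiebThirring.density ψ x ^ 2 ∂LiebThirring.surf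
        ≤ 3 * Real.pi / 32 * ∑ j : Fin N, ∫ x, ‖g j x‖ ^ 2 ∂LiebThirring.surf) ∧
    (∀ (L : ℝ) [Fact (0 < L)] (N : ℕ) (ψ : Fin N → LiebThirring.T2 L → ℂ)
        (g : Fin N → LiebThirring.T2 L → EuclideanSpace ℂ (Fin 2)),
      (∀ j, LiebThirring.HasTorusGradient L (ψ j) (g j)) →
      (∀ j, ∫ x, ψ j x = 0) →
      LiebThirring.IsL2Orthonormal volume ψ →
      Integrable (fun x => LiebThirring.density ψ x ^ 2) volume ∧
      ∫ x, LiebThirring.density ψ x ^ 2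
        ≤ 3 * Real.pi / 32 * ∑ j : Fin N, ∫ x, ‖g j x‖ ^ 2) :=
  ⟨fun _ _ _ hg hmean hort => LiebThirring.lieb_thirring_sphere hg hmean hort,
    fun _ _ _ _ _ hg hmean hort => LiebThirring.lieb_thirring_torus hg hmean hort⟩
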